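/- **Theorem (Convergence of SPIDER-RFW).** Let $M$ be a smooth finite-dimensional Riemannian manifold with distance $d$, and let $\mathcal X\subset M$ be compact, of diameter $D$, and geodesically convex: any two points $x,y\in\mathcal X$ are joined by exactly one minimizing geodesic $\gamma_{xy}:[0,1]\to M$, and it lies in $\mathcal X$. Write $\mathrm{Exp}_x^{-1}(y)=\dot\gamma_{xy}(0)$ and let $\Gamma_x^y$ be parallel transport along $\gamma_{xy}$. A function $f:M\to\mathbb R$ is $L$-smooth on $\mathcal X$ if it is differentiable at the points of $\mathcal X$ and $\|\mathrm{grad} f(y)-\Gamma_x^y\,\mathrm{grad} f(x)\|\le L\,d(x,y)$ for all $x,y\in\mathcal X$. Consider one of the following settings. * *Stochastic:* $\Phi(x)=\mathbb E_{\xi\sim P}[\phi(x,\xi)]$, where $\Phi$ and almost all $\phi(\cdot,\xi)$ are $L$-smooth on $\mathcal X$ ($L\ge 0$), $\|\mathrm{grad}\,\phi(x,\xi)\|\le C$ for all $x\in\mathcal X$ and almost all $\xi$, and $\mathbb E_\xi[\mathrm{grad}\,\phi(x,\xi)]=\mathrm{grad}\,\Phi(x)$ for $x\in\mathcal X$. *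 *Finite-sum:* $\Phi=\frac1m\sum_{i=1}^m\phi_i$ with $m\ge1$, where each $\phi_i$ is $L$-smooth on $\mathcal X$ ($L>0$). Here a sample is a uniformly distributed index $i\in\{1,\dots,m\}$. (All gradients and parallel transports are assumed to be measurable in their arguments.) For a batch $S$ of samples let $\mathrm{grad}\,\Phi_S(x)$ be the average over $S$ of the gradients at $x$ of the sampled functions ($0$ if $S$ is empty). For $K\ge1$ let $\eta=\varepsilon=1/\sqrt K$ and $n=\lceil\sqrt K\,\rceil$. SPIDER-RFW starts at $x_0\in\mathcal X$ and for $k=0,\dots,K-1$ does the following. 1. If $n\mid k$, draw a batch $S_1$ of $\lceil 2C^2/\varepsilon^2\rceil$ (stochastic) or $\lceil 2L^2D^2/\varepsilon^2\rceil$ (finite-sum) i.i.d. samples, and set $g_k=\mathrm{grad}\,\Phi_{S_1}(x_k)$. 2. If $n\nmid k$, let $r=2nL^2\|\mathrm{Exp}_{x_{k-1}}^{-1}(x_k)\|/\varepsilon^2$ and draw a batch $S_2$ of $\lceil r\rceil$ (stochastic) or $\lceil\min\{m,r\}\rceil$ (finite-sum) i.i.d. samples, except that in the finite-sum setting a batch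 whose size reaches $m$ is the full index set $\{1,\dots,m\}$. Set $g_k=\mathrm{grad}\,\Phi_{S_2}(x_k)-\Gamma_{x_{k-1}}^{x_k}\bigl(\mathrm{grad}\,\Phi_{S_2}(x_{k-1})-g_{k-1}\bigr)$. 3. Let $z_{k+1}\in\operatorname{argmin}_{z\in\mathcal X}\langle g_k,\mathrm{Exp}_{x_k}^{-1}(z)\rangle$ and $x_{k+1}=\gamma_{x_kz_{k+1}}(\eta)$. The samples drawn in iteration $k$ are independent of the past. The output $\hat x$ is chosen uniformly at random from the list $x_0,\dots,x_{K-1}$, independently of the run. With the Frank–Wolfe gap $\mathcal G(x)=\max_{y\in\mathcal X}\langle\mathrm{Exp}_x^{-1}(y),-\mathrm{grad}\,\Phi(x)\rangle$, in both settings $$\mathbb E[\mathcal G(\hat x)]=O\!\left(\tfrac1{\sqrt K}\right):$$ there is a constant $A$, depending only on the problem (not on $K$, on $x_0$, or on how minimizers are selected), such that $\mathbb E[\mathcal G(\hat x)]\le A/\sqrt K$ for all $K\ge1$. -/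

import Mathlib

open Set MeasureTheory ProbabilityTheory Bundle
open scoped Manifold ContDiff ENNReal

noncomputable section

namespace RiemannianFW

section Geometry

variable {E : Type*} [NormedAddCommGroup E] [NormedSpace ℝ E]
  {M : Type*} [MetricSpace M] [ChartedSpace E M]
  [RiemannianBundle (fun x : M => TangentSpace 𝓘(ℝ, E) x)]

/-- The components of the Riemannian metric in the chart at `p`, at the coordinate point `u`, on
the coordinate vectors `a`, `b`. -/
def chartMetric (p : M) (u a b : E) : ℝ :=
  inner ℝ
    (mfderiv 𝓘(ℝ, E) 𝓘(ℝ, E) (extChartAt 𝓘(ℝ, E) p).symm u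
      ((NormedSpace.fromTangentSpace u).symm a) :
      TangentSpace 𝓘(ℝ, E) ((extChartAt 𝓘(ℝ, E) p).symm u))
    (mfderiv 𝓘(ℝ, E) 𝓘(ℝ, E) (extChartAt 𝓘(ℝ, E) p).symm u
      ((NormedSpace.fromTangentSpace u).symm b) :
      TangentSpace 𝓘(ℝ, E) ((extChartAt 𝓘(ℝ, E) p).symm u))

/-- The Christoffel symbols of the first kind of the Levi-Civita connection in the chart at `p`:
`Γ(a, b; c) = (∂_a g(b, c) + ∂_b g(a, c) - ∂_c g(a, b)) / 2`. -/
def christoffel (p : M) (u a b c : E) : ℝ :=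
  (fderiv ℝ (fun w => chartMetric p w b c) u a + fderiv ℝ (fun w => chartMetric p w a c) u b
    - fderiv ℝ (fun w => chartMetric p w a b) u c) / 2

/-- The coordinates, in the chart at `p`, of the tangent vector `v` at `x`. -/
def chartVec (p : M) {x : M} (v : TangentSpace 𝓘(ℝ, E) x) : E :=
  NormedSpace.fromTangentSpace (extChartAt 𝓘(ℝ, E) p x)
    (mfderiv 𝓘(ℝ, E) 𝓘(ℝ, E) (extChartAt 𝓘(ℝ, E) p) x v)

/-- The vector field `V` along the curve `γ : [0, 1] → M` is parallel for the Levi-Civita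
connection: in each chart around `γ t`, the coordinates `u` of `γ` and `v` of `V` satisfy
`g(v', c) + Γ(u', v; c) = 0` for all `c` (the equation `v' + Γ(u', v) = 0`, index lowered). -/
def IsParallelAlong (γ : ℝ → M) (V : ∀ t, TangentSpace 𝓘(ℝ, E) (γ t)) : Prop :=
  ∀ t ∈ Icc (0 : ℝ) 1, ∀ p : M, γ t ∈ (chartAt E p).source →
    ∃ u' v' : E,
      HasDerivWithinAt (fun s => extChartAt 𝓘(ℝ, E) p (γ s)) u' (Icc 0 1) t ∧
      HasDerivWithinAt (fun s => chartVec p (V s)) v' (Icc 0 1) t ∧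
      ∀ c : E, chartMetric p (extChartAt 𝓘(ℝ, E) p (γ t)) v' c
        + christoffel p (extChartAt 𝓘(ℝ, E) p (γ t)) u' (chartVec p (V t)) c = 0

/-- The velocity of the curve `γ : [0, 1] → M`. -/
def velocity (γ : ℝ → M) (t : ℝ) : TangentSpace 𝓘(ℝ, E) (γ t) :=
  mfderivWithin 𝓘(ℝ, ℝ) 𝓘(ℝ, E) γ (Icc 0 1) t 1

variable (E) in
/-- Geodesics parametrized by `[0, 1]`: smooth curves whose velocity is parallel. -/
def IsGeodesic (γ : ℝ → M) : Prop :=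
  ContMDiffOn 𝓘(ℝ, ℝ) 𝓘(ℝ, E) ∞ γ (Icc 0 1) ∧ IsParallelAlong γ (velocity (E := E) γ)

variable (E) in
/-- `γ : [0, 1] → M` is a minimizing geodesic from `x` to `y`. The length of a geodesic
is its (constant) speed, so minimizing means that the speed is `d(x, y)`. -/
def IsMinGeodesic (γ : ℝ → M) (x y : M) : Prop :=
  IsGeodesic E γ ∧ γ 0 = x ∧ γ 1 = y ∧ ‖velocity (E := E) γ 0‖ = dist x y

variable (E) in
/-- Geodesic convexity: any two points of `X` are joined by exactly one minimizing geodesic of `M`,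
and this geodesic stays in `X`. -/
def GeodesicallyConvex (X : Set M) : Prop :=
  ∀ x ∈ X, ∀ y ∈ X, ∃ γ : ℝ → M, IsMinGeodesic E γ x y ∧ (∀ t ∈ Icc (0 : ℝ) 1, γ t ∈ X) ∧
    ∀ γ' : ℝ → M, IsMinGeodesic E γ' x y → EqOn γ' γ (Icc 0 1)

variable (E) in
/-- The geodesic map `γ` with `γ(0) = x` and `γ(1) = y` (the minimizing geodesic). -/
def geod (x y : M) : ℝ → M :=
  @Classical.epsilon (ℝ → M) ⟨fun _ => x⟩ fun γ => IsMinGeodesic E γ x y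

variable (E) in
/-- `Exp_x⁻¹(y)`: the initial velocity of the minimizing geodesic from `x` to `y`. -/
def expInv (x y : M) : TangentSpace 𝓘(ℝ, E) x :=
  Classical.epsilon fun v : TangentSpace 𝓘(ℝ, E) x =>
    ∃ γ : ℝ → M, IsMinGeodesic E γ x y ∧
      (⟨γ 0, velocity γ 0⟩ : TangentBundle 𝓘(ℝ, E) M) = ⟨x, v⟩

/-- Parallel transport `Γ_x^y : T_x M → T_y M` along the minimizing geodesic. -/
def transport (x y : M) (v : TangentSpace 𝓘(ℝ, E) x) : TangentSpace 𝓘(ℝ, E) y :=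
  Classical.epsilon fun w : TangentSpace 𝓘(ℝ, E) y =>
    ∃ (γ : ℝ → M) (V : ∀ t, TangentSpace 𝓘(ℝ, E) (γ t)),
      IsMinGeodesic E γ x y ∧ IsParallelAlong γ V ∧
      (⟨γ 0, V 0⟩ : TangentBundle 𝓘(ℝ, E) M) = ⟨x, v⟩ ∧
      (⟨γ 1, V 1⟩ : TangentBundle 𝓘(ℝ, E) M) = ⟨y, w⟩

variable [FiniteDimensional ℝ E]

instance (x : M) : FiniteDimensional ℝ (TangentSpace 𝓘(ℝ, E) x) :=
  inferInstanceAs (FiniteDimensional ℝ E)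

instance (x : M) : CompleteSpace (TangentSpace 𝓘(ℝ, E) x) :=
  FiniteDimensional.complete ℝ _

variable (E) in
/-- The Riemannian gradient: `⟪grad f x, v⟫ = Df(x)[v]` for all `v`. -/
def grad (f : M → ℝ) (x : M) : TangentSpace 𝓘(ℝ, E) x :=
  (InnerProductSpace.toDual ℝ (TangentSpace 𝓘(ℝ, E) x)).symm
    ((NormedSpace.fromTangentSpace (f x)).toContinuousLinearMap ∘L
      mfderiv 𝓘(ℝ, E) 𝓘(ℝ, ℝ) f x)

variable (E) in
/-- `f` is `L`-smooth on `X`. -/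
def LSmoothOn (L : ℝ) (X : Set M) (f : M → ℝ) : Prop :=
  (∀ x ∈ X, MDifferentiableAt 𝓘(ℝ, E) 𝓘(ℝ, ℝ) f x) ∧
    ∀ x ∈ X, ∀ y ∈ X, ‖grad E f y - transport x y (grad E f x)‖ ≤ L * dist x y

variable (E) in
/-- The Frank-Wolfe gap `max_{y ∈ X} ⟪Exp_x⁻¹(y), -grad Φ(x)⟫`, for `x ∈ X`. It is nonnegative
(take `y = x`), so it is the supremum of the positive parts; valued in `[0, ∞]`. -/
def fwGap (X : Set M) (Φ : M → ℝ) (x : M) : ℝ≥0∞ :=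
  ⨆ y ∈ X, ENNReal.ofReal (inner ℝ (expInv E x y) (-grad E Φ x))

variable [IsManifold 𝓘(ℝ, E) ∞ M]

/-- Borel σ-algebra of the tangent bundle. -/
instance : MeasurableSpace (TangentBundle 𝓘(ℝ, E) M) := borel _

instance : BorelSpace (TangentBundle 𝓘(ℝ, E) M) := ⟨rfl⟩

variable (E) in
/-- Parallel transport between points of `X` is a measurable operation. -/
def MeasurableTransport [MeasurableSpace M] (X : Set M) : Prop :=
  Measurable fun q : {v : TangentBundle 𝓘(ℝ, E) M // v.proj ∈ X} × X =>
    (⟨q.2, transport q.1.1.proj q.2 q.1.1.snd⟩ : TangentBundle 𝓘(ℝ, E) M)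

variable (E) in
/-- The gradients `grad φ(x, ξ)` are jointly measurable in `x ∈ X` and `ξ`. -/
def MeasurableGrad {Ξ : Type*} [MeasurableSpace Ξ] [MeasurableSpace M] (X : Set M)
    (φ : Ξ → M → ℝ) : Prop :=
  Measurable fun q : X × Ξ =>
    (⟨q.1, grad E (φ q.2) q.1⟩ : TangentBundle 𝓘(ℝ, E) M)

variable (E) in
/-- `grad Φ_S(x)`: the average of the gradients of `φ(·, ξ)` over the batch `S` (`0` for the empty
batch). -/
def batchGrad {Ξ : Type*} (φ : Ξ → M → ℝ) (S : List Ξ) (x : M) : TangentSpace 𝓘(ℝ, E) x :=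
  (S.length : ℝ)⁻¹ • (S.map fun ξ => grad E (φ ξ) x).sum

end Geometry

/-- The batch formed by the first `N` terms of the i.i.d. sequence `s`. -/
def firstSamples {Ξ : Type*} (N : ℕ) (s : ℕ → Ξ) : List Ξ := (List.range N).map s

/-- Small batch, stochastic case: `⌈r⌉` i.i.d. samples. -/
def smallBatchStochastic {Ξ : Type*} (r : ℝ) (s : ℕ → Ξ) : List Ξ := firstSamples ⌈r⌉₊ s

/-- Small batch, finite-sum case: `⌈min {m, r}⌉` i.i.d. indices; a batch whose size
reaches the cap `m` is the full index set. -/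
def smallBatchFiniteSum {m : ℕ} (r : ℝ) (s : ℕ → Fin m) : List (Fin m) :=
  if ⌈min (m : ℝ) r⌉₊ = m then List.finRange m else firstSamples ⌈min (m : ℝ) r⌉₊ s

/-- Accuracy parameter `ε = 1/√K`. -/
def accuracy (K : ℕ) : ℝ := 1 / √(K : ℝ)

/-- Step size `η = 1/√K`. -/
def stepSize (K : ℕ) : ℝ := 1 / √(K : ℝ)

/-- Epoch length `n = √K` (rounded up to an integer). -/
def epochLength (K : ℕ) : ℕ := ⌈√(K : ℝ)⌉₊

section Algorithm

variable {E : Type*} [NormedAddCommGroup E] [NormedSpace ℝ E] [FiniteDimensional ℝ E]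
  {M : Type*} [MetricSpace M] [MeasurableSpace M] [ChartedSpace E M]
  [RiemannianBundle (fun x : M => TangentSpace 𝓘(ℝ, E) x)]
  {Ξ : Type*} [MeasurableSpace Ξ] {Ω : Type*} [MeasurableSpace Ω]

variable (E) in
/-- A run of SPIDER-RFW with `K` iterations on the probability space `(Ω, μ)`, for component
functions `φ(·, ξ)`, `ξ ∼ P`, with large batches of size `N₁` and small batches formed by
`smallBatch`. The `σ`-algebra `history k` is the information available before
the samples `sample k 0, sample k 1, …` of iteration `k` are drawn. -/
structure SpiderRun (X : Set M) (φ : Ξ → M → ℝ) (P : Measure Ξ) (L : ℝ) (K N₁ : ℕ)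
    (smallBatch : ℝ → (ℕ → Ξ) → List Ξ) (x₀ : M) (μ : Measure Ω) where
  /-- information before iteration `k` -/
  history : Filtration ℕ (inferInstance : MeasurableSpace Ω)
  /-- the samples available in iteration `k` -/
  sample : ℕ → ℕ → Ω → Ξ
  /-- the iterates -/
  x : ℕ → Ω → M
  /-- the gradient estimates -/
  g : ∀ (k : ℕ) (w : Ω), TangentSpace 𝓘(ℝ, E) (x k w)
  /-- the answer of the linear oracle in iteration `k` -/
  z : ℕ → Ω → M
  /-- the index of the output -/
  outIdx : Ω → ℕ
  measurable_x : ∀ k ≤ K, Measurable[history k] (x k)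
  measurable_sample : ∀ k < K, ∀ i, Measurable[history (k + 1)] (sample k i)
  law_sample : ∀ k < K, ∀ i, μ.map (sample k i) = P
  iIndep_sample : ∀ k < K, iIndepFun (sample k) μ
  indep_sample : ∀ k < K,
    Indep (history k) (⨆ i, MeasurableSpace.comap (sample k i) inferInstance) μ
  x_zero : ∀ w, x 0 w = x₀
  g_epoch : ∀ k < K, k % epochLength K = 0 → ∀ w,
    g k w = batchGrad E φ (firstSamples N₁ fun i => sample k i w) (x k w)
  g_inner : ∀ k, k + 1 < K → (k + 1) % epochLength K ≠ 0 → ∀ w,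
    let S₂ := smallBatch
      (2 * epochLength K * L ^ 2 * ‖expInv E (x k w) (x (k + 1) w)‖ / accuracy K ^ 2)
      (fun i => sample (k + 1) i w)
    g (k + 1) w = batchGrad E φ S₂ (x (k + 1) w)
      - transport (x k w) (x (k + 1) w) (batchGrad E φ S₂ (x k w) - g k w)
  z_mem : ∀ k < K, ∀ w, z k w ∈ X
  z_min : ∀ k < K, ∀ w, IsMinOn (fun y => inner ℝ (g k w) (expInv E (x k w) y)) X (z k w)
  x_succ : ∀ k < K, ∀ w, x (k + 1) w = geod E (x k w) (z k w) (stepSize K)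
  measurable_outIdx : Measurable outIdx
  law_outIdx : ∀ j < K, μ (outIdx ⁻¹' {j}) = (K : ℝ≥0∞)⁻¹
  indep_outIdx : Indep (MeasurableSpace.comap outIdx ⊤) (history K) μ

/-- The output `x̂`, uniformly distributed on the list of iterates `x₀, …, x_{K-1}`. -/
def SpiderRun.output {X : Set M} {φ : Ξ → M → ℝ} {P : Measure Ξ} {L : ℝ} {K N₁ : ℕ}
    {smallBatch : ℝ → (ℕ → Ξ) → List Ξ} {x₀ : M} {μ : Measure Ω}
    (R : SpiderRun E X φ P L K N₁ smallBatch x₀ μ) (w : Ω) : M :=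
  R.x (R.outIdx w) w

end Algorithm

end RiemannianFW

end

open scoped Topology

set_option linter.unusedSectionVars false

noncomputable section

/-! Write `e_k = g_k - grad Φ(x_k)`, `q = √K`, `n` for the epoch length and `D` for the diameter.
Smoothness along the minimizing geodesic from `x_k` to `z_{k+1}` gives a quadratic upper bound for
`Φ(x_{k+1})`. Since `z_{k+1}` minimizes the linear form of `g_k`, replacing `grad Φ` by `g_k` costs
at most `2D‖e_k‖`. Hence the gap at `x_k` is at most `q(Φ(x_k) - Φ(x_{k+1})) + 2D‖e_k‖ + LD²/(2q)`
(`inner_neg_grad_le_of_isMinOn`, where `2‖e‖ ≤ q‖e‖² + 1/q` already replaces the norm by its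
square). Averaging over `k` telescopes the first term, so `𝔼‖e_k‖² = O(1/K)` suffices
(`lintegral_fwGap_output_le`).

For the variance, parallel transport `T` is a linear isometry. The new error is therefore `T
e_{k-1}` plus the centred average of independent vectors of norm at most `L d`, with `d = d(x_{k-1},
x_k)`. Given the past, the cross terms vanish and the average contributes at most `L²d²/⌈cd⌉ ≤ δd`,
where `c` is the batch size per unit of distance and `δ = 1/(2nK)` satisfies `cδ = L²`
(`lintegral_norm_sq_spiderUpdate_le`). Fewer than `n` such steps follow the `O(1/K)` error at the
start of an epoch, and they add at most `D/(2K)` (`lintegral_error_le`).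

Two foundations precede this. Geometry: transport, the inverse exponential map and geodesics are
chosen by `epsilon`, so their properties come from the chart equations: chart independence,
existence by linear ODEs, conservation of inner products, and the fact that initial pieces of
minimizing geodesics are minimizing. Measurability: tangent vectors at random points are read in a
measurable frame, and independence is used by integrating over fresh samples with the past frozen.
-/

namespace RiemannianFW

/-! ### Tangent vectors and the metric in a chart. -/

section ChartCalculus

variable {E : Type*} [NormedAddCommGroup E] [NormedSpace ℝ E]
  {M : Type*} [MetricSpace M] [ChartedSpace E M]

/-- The derivative of the inverse of the chart at `p`, as a map from the model space. -/
def chartInvDeriv (p : M) (u : E) : E →L[ℝ] TangentSpace 𝓘(ℝ, E) ((extChartAt 𝓘(ℝ, E) p).symm u) :=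
  mfderiv 𝓘(ℝ, E) 𝓘(ℝ, E) (extChartAt 𝓘(ℝ, E) p).symm u ∘L
    (NormedSpace.fromTangentSpace u).symm.toContinuousLinearMap

/-- The derivative of the chart at `p`, as a map to the model space. -/
def chartDeriv (p x : M) : TangentSpace 𝓘(ℝ, E) x →L[ℝ] E :=
  (NormedSpace.fromTangentSpace (extChartAt 𝓘(ℝ, E) p x)).toContinuousLinearMap ∘L
    mfderiv 𝓘(ℝ, E) 𝓘(ℝ, E) (extChartAt 𝓘(ℝ, E) p) x

theorem chartVec_eq (p : M) {x : M} (v : TangentSpace 𝓘(ℝ, E) x) :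
    chartVec p v = chartDeriv p x v := rfl

section Metric

variable [RiemannianBundle (fun x : M => TangentSpace 𝓘(ℝ, E) x)]

/-- The metric in the chart at `p`, as a bilinear form on the model space. -/
def chartForm (p : M) (u : E) : E →L[ℝ] E →L[ℝ] ℝ :=
  (innerSL ℝ (E := TangentSpace 𝓘(ℝ, E) ((extChartAt 𝓘(ℝ, E) p).symm u))).bilinearComp
    (chartInvDeriv p u) (chartInvDeriv p u)

theorem chartMetric_eq (p : M) (u a b : E) : chartMetric p u a b = chartForm p u a b := rfl

theorem chartForm_apply (p : M) (u a b : E) :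
    chartForm p u a b = inner ℝ (chartInvDeriv p u a) (chartInvDeriv p u b) := rfl

theorem chartForm_symm (p : M) (u a b : E) : chartForm p u a b = chartForm p u b a := by
  rw [chartForm_apply, chartForm_apply, real_inner_comm]

end Metric

variable [IsManifold 𝓘(ℝ, E) ∞ M]

theorem isManifold_one : IsManifold 𝓘(ℝ, E) 1 M :=
  IsManifold.of_le (n := ∞) (by exact_mod_cast le_top)

theorem chartDeriv_chartInvDeriv {p : M} {u : E} (hu : u ∈ (extChartAt 𝓘(ℝ, E) p).target) (a : E) :
    chartDeriv p ((extChartAt 𝓘(ℝ, E) p).symm u) (chartInvDeriv p u a) = a := by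
  have : IsManifold 𝓘(ℝ, E) 1 M := isManifold_one
  have h := mfderiv_extChartAt_comp_mfderivWithin_extChartAt_symm (I := 𝓘(ℝ, E)) hu
  rw [ModelWithCorners.range_eq_univ, mfderivWithin_univ] at h
  exact congrArg (fun f => f a) h

/-- The two base points are equal but not definitionally so. The equality is therefore stated in the
total space, a form used throughout to compare vectors. -/
theorem chartInvDeriv_chartDeriv {p x : M} (hx : x ∈ (chartAt E p).source)
    (v : TangentSpace 𝓘(ℝ, E) x) :
    (⟨(extChartAt 𝓘(ℝ, E) p).symm (extChartAt 𝓘(ℝ, E) p x),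
      chartInvDeriv p (extChartAt 𝓘(ℝ, E) p x) (chartDeriv p x v)⟩ : TangentBundle 𝓘(ℝ, E) M)
      = ⟨x, v⟩ := by
  have : IsManifold 𝓘(ℝ, E) 1 M := isManifold_one
  have hx' : x ∈ (extChartAt 𝓘(ℝ, E) p).source := by rwa [extChartAt_source]
  have h := mfderivWithin_extChartAt_symm_comp_mfderiv_extChartAt' (I := 𝓘(ℝ, E)) hx'
  rw [ModelWithCorners.range_eq_univ, mfderivWithin_univ] at h
  have h1 := congrArg (fun f => f v) h
  have h2 := (extChartAt 𝓘(ℝ, E) p).left_inv hx'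
  refine Bundle.TotalSpace.ext h2 ?_
  refine heq_of_eq ?_
  exact h1

theorem contMDiffOn_chartInvDeriv (p : M) (a : E) :
    ContMDiffOn 𝓘(ℝ, E) 𝓘(ℝ, E).tangent ∞
      (fun u => (⟨(extChartAt 𝓘(ℝ, E) p).symm u, chartInvDeriv p u a⟩ : TangentBundle 𝓘(ℝ, E) M))
      (extChartAt 𝓘(ℝ, E) p).target := by
  have hopen : IsOpen (extChartAt 𝓘(ℝ, E) p).target := isOpen_extChartAt_target p
  have h1 := (contMDiffOn_extChartAt_symm (I := 𝓘(ℝ, E)) (n := ∞) p).contMDiffOn_tangentMapWithin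
    (m := ∞) (by exact_mod_cast le_top) hopen.uniqueMDiffOn
  have h2 : ContMDiff 𝓘(ℝ, E) 𝓘(ℝ, E).tangent ∞
      (fun u : E => (⟨u, (NormedSpace.fromTangentSpace u).symm a⟩ : TangentBundle 𝓘(ℝ, E) E)) :=
    contMDiff_vectorSpace_iff_contDiff.2 contDiff_const
  refine (h1.comp h2.contMDiffOn fun u hu => hu).congr fun u hu => ?_
  simp only [Function.comp_def, tangentMapWithin, mfderivWithin_of_isOpen hopen hu]
  rfl

variable [RiemannianBundle (fun x : M => TangentSpace 𝓘(ℝ, E) x)]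

theorem inner_eq_chartForm {p x : M} (hx : x ∈ (chartAt E p).source)
    (v w : TangentSpace 𝓘(ℝ, E) x) :
    inner ℝ v w = chartForm p (extChartAt 𝓘(ℝ, E) p x) (chartVec p v) (chartVec p w) := by
  rw [chartForm_apply]
  have key : ∀ (q : TangentBundle 𝓘(ℝ, E) M) (w' : TangentSpace 𝓘(ℝ, E) q.proj),
      q = ⟨x, v⟩ → (⟨q.proj, w'⟩ : TangentBundle 𝓘(ℝ, E) M) = ⟨x, w⟩ →
      inner ℝ v w = inner ℝ q.snd w' := by
    rintro q w' rfl h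
    have := eq_of_heq (Bundle.TotalSpace.mk.inj h).2
    rw [this]
  exact key ⟨_, _⟩ _ (chartInvDeriv_chartDeriv hx v) (chartInvDeriv_chartDeriv hx w)

/-- In finite dimension a family of bilinear forms is smooth once its values on fixed vectors are;
these values are inner products of smooth coordinate fields. -/
theorem contDiffOn_chartForm [FiniteDimensional ℝ E]
    [IsContMDiffRiemannianBundle 𝓘(ℝ, E) ∞ E (fun x : M => TangentSpace 𝓘(ℝ, E) x)] (p : M) :
    ContDiffOn ℝ ∞ (chartForm (E := E) p) (extChartAt 𝓘(ℝ, E) p).target := by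
  rw [contDiffOn_clm_apply]
  intro a
  rw [contDiffOn_clm_apply]
  intro b
  rw [← contMDiffOn_iff_contDiffOn]
  exact ContMDiffOn.inner_bundle (F := E) (E := fun x : M => TangentSpace 𝓘(ℝ, E) x)
    (b := (extChartAt 𝓘(ℝ, E) p).symm) (v := fun u => chartInvDeriv p u a)
    (w := fun u => chartInvDeriv p u b)
    (contMDiffOn_chartInvDeriv p a) (contMDiffOn_chartInvDeriv p b)

theorem chartForm_pos {p : M} {u : E} (hu : u ∈ (extChartAt 𝓘(ℝ, E) p).target) {a : E}
    (ha : a ≠ 0) : 0 < chartForm p u a a := by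
  rw [chartForm_apply]
  refine real_inner_self_pos.2 fun h => ha ?_
  rw [← chartDeriv_chartInvDeriv hu a, h, map_zero]

end ChartCalculus

/-! ### Christoffel symbols of a field of bilinear forms on the model space. -/

section FlatChristoffel

variable {E : Type*} [NormedAddCommGroup E] [NormedSpace ℝ E]

instance : NormedAddCommGroup (E →L[ℝ] E →L[ℝ] ℝ) := ContinuousLinearMap.toNormedAddCommGroup

instance : AddCommGroup (E →L[ℝ] E →L[ℝ] ℝ) := NormedAddCommGroup.toAddCommGroup

instance : NormedSpace ℝ (E →L[ℝ] E →L[ℝ] ℝ) := ContinuousLinearMap.toNormedSpace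

/-- The Christoffel symbols of the first kind of a field of bilinear forms. -/
def christoffelForm (G : E → E →L[ℝ] E →L[ℝ] ℝ) (u a b c : E) : ℝ :=
  (fderiv ℝ G u a b c + fderiv ℝ G u b a c - fderiv ℝ G u c a b) / 2

/-- Metric compatibility of the Levi-Civita connection. It is the reason why inner products of
parallel fields are constant. -/
theorem christoffelForm_add_swap {G : E → E →L[ℝ] E →L[ℝ] ℝ} {u : E}
    (hs : ∀ a b c, fderiv ℝ G u a b c = fderiv ℝ G u a c b) (a b c : E) :
    christoffelForm G u a b c + christoffelForm G u a c b = fderiv ℝ G u a b c := by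
  simp only [christoffelForm]
  rw [hs a c b, hs b a c, hs c a b]
  ring

theorem hasFDerivAt_form_apply {G : E → E →L[ℝ] E →L[ℝ] ℝ} {G' : E →L[ℝ] E →L[ℝ] E →L[ℝ] ℝ} {u : E}
    (h : HasFDerivAt G G' u) (b c : E) :
    HasFDerivAt (fun w => G w b c) ((G'.flip b).flip c) u := by
  have h1 : HasFDerivAt (fun w => G w b) (G'.flip b) u :=
    (h.clm_apply (hasFDerivAt_const b u)).congr_fderiv (by ext; simp)
  exact (h1.clm_apply (hasFDerivAt_const c u)).congr_fderiv (by ext; simp)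

theorem fderiv_form_symm {G : E → E →L[ℝ] E →L[ℝ] ℝ} {u : E} (hG : DifferentiableAt ℝ G u)
    (hs : ∀ w a b, G w a b = G w b a) (a b c : E) :
    fderiv ℝ G u a b c = fderiv ℝ G u a c b := by
  have h1 := hasFDerivAt_form_apply hG.hasFDerivAt b c
  simp only [hs _ b c] at h1
  exact congrArg (fun f => f a) (h1.unique (hasFDerivAt_form_apply hG.hasFDerivAt c b))

/-- By the product rule, each of the three derivatives in the Christoffel symbol contributes two
terms with `D²τ`. Symmetry of `D²τ` and of the form cancels four of the six, and the other two
coincide; halved, they give the last term. -/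
theorem christoffelForm_pullback {G₁ G₂ : E → E →L[ℝ] E →L[ℝ] ℝ} {τ : E → E} {u : E}
    (hG₂ : DifferentiableAt ℝ G₂ (τ u)) (hG₁ : DifferentiableAt ℝ G₁ u)
    (hs : ∀ w a b, G₂ w a b = G₂ w b a) (hτ : ContDiffAt ℝ 2 τ u)
    (h : ∀ᶠ w in 𝓝 u, ∀ a b, G₁ w a b = G₂ (τ w) (fderiv ℝ τ w a) (fderiv ℝ τ w b)) (a b c : E) :
    christoffelForm G₁ u a b c =
      christoffelForm G₂ (τ u) (fderiv ℝ τ u a) (fderiv ℝ τ u b) (fderiv ℝ τ u c)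
        + G₂ (τ u) (fderiv ℝ (fderiv ℝ τ) u a b) (fderiv ℝ τ u c) := by
  have hτ1 : HasFDerivAt τ (fderiv ℝ τ u) u := (hτ.differentiableAt (by norm_num)).hasFDerivAt
  have hτ2 : HasFDerivAt (fderiv ℝ τ) (fderiv ℝ (fderiv ℝ τ) u) u :=
    ((hτ.fderiv_right (m := 1) (by norm_num)).differentiableAt (by norm_num)).hasFDerivAt
  have key : ∀ a b c, fderiv ℝ G₁ u a b c =
      fderiv ℝ G₂ (τ u) (fderiv ℝ τ u a) (fderiv ℝ τ u b) (fderiv ℝ τ u c)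
      + G₂ (τ u) (fderiv ℝ (fderiv ℝ τ) u a b) (fderiv ℝ τ u c)
      + G₂ (τ u) (fderiv ℝ τ u b) (fderiv ℝ (fderiv ℝ τ) u a c) := by
    intro a b c
    have h1 := hasFDerivAt_form_apply hG₁.hasFDerivAt b c
    have hb : HasFDerivAt (fun w => fderiv ℝ τ w b) ((fderiv ℝ (fderiv ℝ τ) u).flip b) u :=
      (hτ2.clm_apply (hasFDerivAt_const b u)).congr_fderiv (by ext; simp)
    have hc : HasFDerivAt (fun w => fderiv ℝ τ w c) ((fderiv ℝ (fderiv ℝ τ) u).flip c) u :=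
      (hτ2.clm_apply (hasFDerivAt_const c u)).congr_fderiv (by ext; simp)
    have h0 : HasFDerivAt (fun w => G₂ (τ w)) ((fderiv ℝ G₂ (τ u)).comp (fderiv ℝ τ u)) u :=
      hG₂.hasFDerivAt.comp u hτ1
    have h2 := (h0.clm_apply hb).clm_apply hc
    have h3 := h1.unique (h2.congr_of_eventuallyEq (h.mono fun w hw => hw b c))
    have h4 := congrArg (fun f => f a) h3
    simp only [ContinuousLinearMap.comp_apply,
      add_apply, ContinuousLinearMap.flip_apply] at h4
    rw [h4]
    ring
  have hsym : ∀ a b, fderiv ℝ (fderiv ℝ τ) u a b = fderiv ℝ (fderiv ℝ τ) u b a :=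
    fun a b => (hτ.isSymmSndFDerivAt (by simp)).eq a b
  simp only [christoffelForm, key]
  rw [hsym b a, hsym c a, hsym c b, hs _ (fderiv ℝ τ u b) (fderiv ℝ (fderiv ℝ τ) u a c),
    hs _ (fderiv ℝ τ u a) (fderiv ℝ (fderiv ℝ τ) u b c),
    hs _ (fderiv ℝ (fderiv ℝ τ) u a c) (fderiv ℝ τ u b)]
  ring

end FlatChristoffel

/-! ### Parallelism does not depend on the chart. -/

section ChartChange

variable {E : Type*} [NormedAddCommGroup E] [NormedSpace ℝ E]
  {M : Type*} [MetricSpace M] [ChartedSpace E M]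

variable (E) in
/-- The change of coordinates from the chart at `p` to the chart at `q`. -/
def chartChange (p q : M) : E → E := extChartAt 𝓘(ℝ, E) q ∘ (extChartAt 𝓘(ℝ, E) p).symm

variable (E) in
/-- The domain of the change of coordinates from the chart at `p` to the chart at `q`. -/
def changeDomain (p q : M) : Set E :=
  (extChartAt 𝓘(ℝ, E) p).target ∩ (extChartAt 𝓘(ℝ, E) p).symm ⁻¹' (chartAt E q).source

theorem isOpen_changeDomain (p q : M) : IsOpen (changeDomain E p q) :=
  (continuousOn_extChartAt_symm p).isOpen_inter_preimage (isOpen_extChartAt_target p)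
    (chartAt E q).open_source

theorem mem_changeDomain {p q x : M} (hp : x ∈ (chartAt E p).source)
    (hq : x ∈ (chartAt E q).source) : extChartAt 𝓘(ℝ, E) p x ∈ changeDomain E p q := by
  have hp' : x ∈ (extChartAt 𝓘(ℝ, E) p).source := by rwa [extChartAt_source]
  refine ⟨(extChartAt 𝓘(ℝ, E) p).map_source hp', ?_⟩
  rwa [mem_preimage, (extChartAt 𝓘(ℝ, E) p).left_inv hp']

theorem chartChange_extChartAt {p q x : M} (hp : x ∈ (chartAt E p).source) :
    chartChange E p q (extChartAt 𝓘(ℝ, E) p x) = extChartAt 𝓘(ℝ, E) q x := by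
  have hp' : x ∈ (extChartAt 𝓘(ℝ, E) p).source := by rwa [extChartAt_source]
  rw [chartChange, Function.comp_apply, (extChartAt 𝓘(ℝ, E) p).left_inv hp']

variable [IsManifold 𝓘(ℝ, E) ∞ M]

theorem contDiffAt_chartChange {p q : M} {u : E} (hu : u ∈ changeDomain E p q) :
    ContDiffAt ℝ ∞ (chartChange E p q) u := by
  have h1 := (contMDiffOn_extChartAt_symm (I := 𝓘(ℝ, E)) (n := ∞) p).contMDiffAt
    ((isOpen_extChartAt_target p).mem_nhds hu.1)
  have h2 := contMDiffAt_extChartAt' (I := 𝓘(ℝ, E)) (n := ∞) (x := q) hu.2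
  exact (h2.comp u h1).contDiffAt

theorem fderiv_chartChange {p q : M} {u : E} (hu : u ∈ changeDomain E p q) (a : E) :
    fderiv ℝ (chartChange E p q) u a =
      chartDeriv q ((extChartAt 𝓘(ℝ, E) p).symm u) (chartInvDeriv p u a) := by
  have h1 := ((contMDiffOn_extChartAt_symm (I := 𝓘(ℝ, E)) (n := ∞) p).contMDiffAt
    ((isOpen_extChartAt_target p).mem_nhds hu.1)).mdifferentiableAt (by simp)
  have h2 := (contMDiffAt_extChartAt' (I := 𝓘(ℝ, E)) (n := ∞) (x := q) hu.2).mdifferentiableAt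
    (by simp)
  have h3 := mfderiv_comp u h2 h1
  rw [mfderiv_eq_fderiv] at h3
  exact congrArg (fun f => f a) h3

theorem chartVec_change {p q x : M} (hp : x ∈ (chartAt E p).source)
    (hq : x ∈ (chartAt E q).source) (v : TangentSpace 𝓘(ℝ, E) x) :
    chartVec q v = fderiv ℝ (chartChange E p q) (extChartAt 𝓘(ℝ, E) p x) (chartVec p v) := by
  rw [fderiv_chartChange (mem_changeDomain hp hq)]
  exact (congrArg (fun z : TangentBundle 𝓘(ℝ, E) M => chartVec q z.snd)
    (chartInvDeriv_chartDeriv hp v)).symm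

variable [RiemannianBundle (fun x : M => TangentSpace 𝓘(ℝ, E) x)]

theorem chartForm_change {p q : M} {u : E} (hu : u ∈ changeDomain E p q) (a b : E) :
    chartForm p u a b = chartForm q (chartChange E p q u)
      (fderiv ℝ (chartChange E p q) u a) (fderiv ℝ (chartChange E p q) u b) := by
  rw [chartForm_apply, inner_eq_chartForm hu.2, fderiv_chartChange hu, fderiv_chartChange hu]
  rfl

variable [FiniteDimensional ℝ E]
  [IsContMDiffRiemannianBundle 𝓘(ℝ, E) ∞ E (fun x : M => TangentSpace 𝓘(ℝ, E) x)]

theorem differentiableAt_chartForm {p : M} {u : E} (hu : u ∈ (extChartAt 𝓘(ℝ, E) p).target) :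
    DifferentiableAt ℝ (chartForm (E := E) p) u :=
  ((contDiffOn_chartForm p).differentiableOn (by simp)).differentiableAt
    ((isOpen_extChartAt_target p).mem_nhds hu)

theorem christoffel_eq {p : M} {u : E} (hu : u ∈ (extChartAt 𝓘(ℝ, E) p).target) (a b c : E) :
    christoffel p u a b c = christoffelForm (chartForm p) u a b c := by
  have h (b c : E) : HasFDerivAt (fun w => chartMetric p w b c) _ u :=
    hasFDerivAt_form_apply (differentiableAt_chartForm hu).hasFDerivAt b c
  rw [christoffel, (h b c).fderiv, (h a c).fderiv, (h a b).fderiv]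
  rfl

/-- The equation of parallel transport in the chart at `p`, at time `t`, for a vector field along a
curve defined on `S`. -/
def ParallelAt (S : Set ℝ) (γ : ℝ → M) (V : ∀ t, TangentSpace 𝓘(ℝ, E) (γ t)) (p : M) (t : ℝ) :
    Prop :=
  ∃ u' v' : E,
    HasDerivWithinAt (fun s => extChartAt 𝓘(ℝ, E) p (γ s)) u' S t ∧
    HasDerivWithinAt (fun s => chartVec p (V s)) v' S t ∧
    ∀ c : E, chartMetric p (extChartAt 𝓘(ℝ, E) p (γ t)) v' c
      + christoffel p (extChartAt 𝓘(ℝ, E) p (γ t)) u' (chartVec p (V t)) c = 0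

/-- Differentiating `Dτ(u) v` produces the term `D²τ(u', v)`, which is exactly the inhomogeneous
term in the transformation law of the Christoffel symbols. -/
theorem ParallelAt.chart_change {S : Set ℝ} {γ : ℝ → M} {V : ∀ t, TangentSpace 𝓘(ℝ, E) (γ t)}
    {p q : M} {t : ℝ} (hγ : ContinuousWithinAt γ S t)
    (hp : γ t ∈ (chartAt E p).source) (hq : γ t ∈ (chartAt E q).source)
    (h : ParallelAt S γ V p t) : ParallelAt S γ V q t := by
  obtain ⟨u', v', hu, hv, heq⟩ := h
  set u := extChartAt 𝓘(ℝ, E) p (γ t) with hudef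
  set τ := chartChange E p q with hτdef
  have hdom := mem_changeDomain hp hq
  have hτ := contDiffAt_chartChange hdom
  have hτ1 : HasFDerivAt τ (fderiv ℝ τ u) u := (hτ.differentiableAt (by simp)).hasFDerivAt
  have hτ2 : HasFDerivAt (fderiv ℝ τ) (fderiv ℝ (fderiv ℝ τ) u) u :=
    ((hτ.fderiv_right (m := 1) (ENat.LEInfty.out : (2 : ℕ∞ω) ≤ (∞ : ℕ∞ω))).differentiableAt
      (by norm_num)).hasFDerivAt
  have hevp : ∀ᶠ s in 𝓝[S] t, γ s ∈ (chartAt E p).source :=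
    hγ.eventually ((chartAt E p).open_source.mem_nhds hp)
  have hevq : ∀ᶠ s in 𝓝[S] t, γ s ∈ (chartAt E q).source :=
    hγ.eventually ((chartAt E q).open_source.mem_nhds hq)
  have e1 : τ u = extChartAt 𝓘(ℝ, E) q (γ t) := chartChange_extChartAt hp
  have e2 : chartVec q (V t) = fderiv ℝ τ u (chartVec p (V t)) := chartVec_change hp hq (V t)
  have ht1 : u ∈ (extChartAt 𝓘(ℝ, E) p).target := hdom.1
  have ht2 : τ u ∈ (extChartAt 𝓘(ℝ, E) q).target := by
    rw [e1]
    exact (extChartAt 𝓘(ℝ, E) q).map_source (by rwa [extChartAt_source])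
  refine ⟨fderiv ℝ τ u u', fderiv ℝ (fderiv ℝ τ) u u' (chartVec p (V t)) + fderiv ℝ τ u v',
    ?_, ?_, ?_⟩
  · refine HasDerivWithinAt.congr_of_eventuallyEq (f := fun s => τ (extChartAt 𝓘(ℝ, E) p (γ s)))
      (HasFDerivAt.comp_hasDerivWithinAt (l := τ) t hτ1 hu) ?_ e1.symm
    filter_upwards [hevp] with s hs using (chartChange_extChartAt hs).symm
  · have h1 : HasDerivWithinAt (fun s => fderiv ℝ τ (extChartAt 𝓘(ℝ, E) p (γ s)))
        (fderiv ℝ (fderiv ℝ τ) u u') S t := hτ2.comp_hasDerivWithinAt t hu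
    refine (h1.clm_apply hv).congr_of_eventuallyEq ?_ e2
    filter_upwards [hevp, hevq] with s hs hs' using chartVec_change hs hs' (V s)
  · intro c
    -- `Dτ` is onto, so every test vector in the chart at `q` comes from one in the chart at `p`.
    obtain ⟨d, hc⟩ : ∃ d, fderiv ℝ τ u d = c := by
      refine ⟨chartVec p (chartInvDeriv q (τ u) c), ?_⟩
      have h1 : (extChartAt 𝓘(ℝ, E) q).symm (τ u) = γ t := by
        rw [e1, (extChartAt 𝓘(ℝ, E) q).left_inv (by rwa [extChartAt_source])]
      have hp' : (extChartAt 𝓘(ℝ, E) q).symm (τ u) ∈ (chartAt E p).source := by rwa [h1]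
      have hq' : (extChartAt 𝓘(ℝ, E) q).symm (τ u) ∈ (chartAt E q).source := by rwa [h1]
      have h2 := chartVec_change hp' hq' (chartInvDeriv q (τ u) c)
      rw [chartVec_eq q, chartDeriv_chartInvDeriv ht2,
        congrArg (extChartAt 𝓘(ℝ, E) p) h1] at h2
      exact h2.symm
    have h0 := heq d
    rw [chartMetric_eq, christoffel_eq ht1, chartForm_change hdom,
      christoffelForm_pullback (differentiableAt_chartForm ht2) (differentiableAt_chartForm ht1)
        (chartForm_symm q) (hτ.of_le ENat.LEInfty.out)
        (by filter_upwards [(isOpen_changeDomain p q).mem_nhds hdom] with w hw a b using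
          chartForm_change hw a b)] at h0
    rw [← e1, chartMetric_eq, christoffel_eq ht2, e2, ← hc, map_add, add_apply]
    linarith

end ChartChange

/-! ### Linear differential equations on short intervals. -/

section LinearODE

variable {E : Type*} [NormedAddCommGroup E] [NormedSpace ℝ E]

/-- On the ball of radius `‖v‖ + 1` about `v` the field is bounded by `C(2‖v‖ + 1)`. Over a length
with `C(b - a) ≤ 1/2` a solution moves by at most `‖v‖ + 1/2`, so it stays in the ball and
Picard–Lindelöf applies. -/
theorem exists_linear_ode_solution [CompleteSpace E] {A : ℝ → E →L[ℝ] E} {a b C : ℝ} (hab : a ≤ b)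
    (hA : ContinuousOn A (Icc a b)) (hC : ∀ t ∈ Icc a b, ‖A t‖ ≤ C) (h : C * (b - a) ≤ 1 / 2)
    (v : E) :
    ∃ α : ℝ → E, α a = v ∧ ∀ t ∈ Icc a b, HasDerivWithinAt α (A t (α t)) (Icc a b) t := by
  have hC0 : 0 ≤ C := (norm_nonneg _).trans (hC a (left_mem_Icc.2 hab))
  let R : NNReal := ⟨‖v‖ + 1, by positivity⟩
  let Lb : NNReal := ⟨C * (2 * ‖v‖ + 1), by positivity⟩
  have hR : (R : ℝ) = ‖v‖ + 1 := rfl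
  have hPL : IsPicardLindelof (fun t w => A t w) (⟨a, left_mem_Icc.2 hab⟩ : Icc a b) v R 0 Lb
      ⟨C, hC0⟩ := by
    refine ⟨fun t ht => ?_, fun x _ => ?_, fun t ht x hx => ?_, ?_⟩
    · refine LipschitzWith.lipschitzOnWith (LipschitzWith.of_dist_le_mul fun x y => ?_)
      rw [dist_eq_norm, dist_eq_norm, ← map_sub]
      exact (A t).le_of_opNorm_le (hC t ht) _
    · exact hA.clm_apply continuousOn_const
    · have hx' : ‖x‖ ≤ 2 * ‖v‖ + 1 := by
        have h1 : ‖x - v‖ ≤ ‖v‖ + 1 := by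
          rw [← dist_eq_norm]
          exact hx
        have h2 : ‖x‖ ≤ ‖x - v‖ + ‖v‖ := by
          simpa using norm_add_le (x - v) v
        linarith
      exact ((A t).le_of_opNorm_le (hC t ht) _).trans (mul_le_mul_of_nonneg_left hx' hC0)
    · have hLb : (Lb : ℝ) = C * (2 * ‖v‖ + 1) := rfl
      have h0 : max (b - a) (a - a) = b - a := by
        rw [sub_self]
        exact max_eq_left (sub_nonneg.2 hab)
      simp only [NNReal.coe_zero, sub_zero, h0, hR, hLb]
      nlinarith [norm_nonneg v]
  exact hPL.exists_eq_forall_mem_Icc_hasDerivWithinAt₀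

end LinearODE

/-! ### Parallel fields: solved form of the equation and conservation of inner products. -/

section ParallelField

variable {E : Type*} [NormedAddCommGroup E] [NormedSpace ℝ E]
  {M : Type*} [MetricSpace M] [ChartedSpace E M]

theorem mem_target {p x : M} (hp : x ∈ (chartAt E p).source) :
    extChartAt 𝓘(ℝ, E) p x ∈ (extChartAt 𝓘(ℝ, E) p).target :=
  (extChartAt 𝓘(ℝ, E) p).map_source (by rwa [extChartAt_source])

theorem chartVec_add (p : M) {x : M} (v w : TangentSpace 𝓘(ℝ, E) x) :
    chartVec p (v + w) = chartVec p v + chartVec p w := (chartDeriv p x).map_add v w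

theorem chartVec_smul (p : M) {x : M} (c : ℝ) (v : TangentSpace 𝓘(ℝ, E) x) :
    chartVec p (c • v) = c • chartVec p v := (chartDeriv p x).map_smul c v

variable [IsManifold 𝓘(ℝ, E) ∞ M]

theorem chartVec_injective {p x : M} (hx : x ∈ (chartAt E p).source)
    {v w : TangentSpace 𝓘(ℝ, E) x} (h : chartVec p v = chartVec p w) : v = w := by
  have hv := chartInvDeriv_chartDeriv hx v
  have hw := chartInvDeriv_chartDeriv hx w
  rw [← chartVec_eq] at hv hw
  rw [h, hw] at hv
  exact (eq_of_heq (Bundle.TotalSpace.mk.inj hv).2).symm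

theorem exists_chartVec_eq {p x : M} (hx : x ∈ (chartAt E p).source) (a : E) :
    ∃ v : TangentSpace 𝓘(ℝ, E) x, chartVec p v = a := by
  have hx' : x ∈ (extChartAt 𝓘(ℝ, E) p).source := by rwa [extChartAt_source]
  have h1 := chartDeriv_chartInvDeriv ((extChartAt 𝓘(ℝ, E) p).map_source hx') a
  have h2 := (extChartAt 𝓘(ℝ, E) p).left_inv hx'
  obtain ⟨z, hz, hza⟩ : ∃ z : TangentBundle 𝓘(ℝ, E) M, z.proj = x ∧ chartVec p z.snd = a :=
    ⟨⟨_, chartInvDeriv p _ a⟩, h2, h1⟩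
  obtain ⟨y, v⟩ := z
  obtain rfl : y = x := hz
  exact ⟨v, hza⟩

variable [RiemannianBundle (fun x : M => TangentSpace 𝓘(ℝ, E) x)]

theorem eq_of_chartForm_eq {p : M} {u : E} (hu : u ∈ (extChartAt 𝓘(ℝ, E) p).target) {a b : E}
    (h : ∀ c, chartForm p u a c = chartForm p u b c) : a = b := by
  by_contra hab
  have h1 := chartForm_pos hu (sub_ne_zero.2 hab)
  simp [h] at h1

variable [FiniteDimensional ℝ E]

/-- A positive definite form is injective, and both sides have the same dimension. The inverse
raises the index in the parallel equation, turning it into an ODE solved for `v'`. -/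
theorem chartForm_isInvertible {p : M} {u : E} (hu : u ∈ (extChartAt 𝓘(ℝ, E) p).target) :
    (chartForm p u).IsInvertible := by
  have hinj : Function.Injective (chartForm p u : E →ₗ[ℝ] (E →L[ℝ] ℝ)) := by
    intro a b hab
    exact eq_of_chartForm_eq hu fun c => congrArg (fun f : E →L[ℝ] ℝ => f c) hab
  have hrank : Module.finrank ℝ E = Module.finrank ℝ (E →L[ℝ] ℝ) := by
    rw [← LinearEquiv.finrank_eq (LinearMap.toContinuousLinearMap : (E →ₗ[ℝ] ℝ) ≃ₗ[ℝ] (E →L[ℝ] ℝ))]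
    exact (Subspace.dual_finrank_eq).symm
  let e := (LinearEquiv.ofInjectiveOfFinrankEq _ hinj hrank).toContinuousLinearEquiv
  exact ⟨e, by ext; rfl⟩

variable [IsContMDiffRiemannianBundle 𝓘(ℝ, E) ∞ E (fun x : M => TangentSpace 𝓘(ℝ, E) x)]

/-- The bilinear form `(v, c) ↦ Γ(u', v; c)`. -/
def christoffelBilin (p : M) (u u' : E) : E →L[ℝ] E →L[ℝ] ℝ :=
  (2 : ℝ)⁻¹ • (fderiv ℝ (chartForm p) u u' + (fderiv ℝ (chartForm p) u).flip u'
    - ((fderiv ℝ (chartForm p) u).flip u').flip)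

theorem christoffelBilin_apply {p : M} {u : E} (hu : u ∈ (extChartAt 𝓘(ℝ, E) p).target)
    (u' v c : E) : christoffelBilin p u u' v c = christoffel p u u' v c := by
  rw [christoffel_eq hu, christoffelForm, christoffelBilin]
  simp only [add_apply, sub_apply, smul_apply, ContinuousLinearMap.flip_apply, smul_eq_mul]
  rw [fderiv_form_symm (differentiableAt_chartForm hu) (chartForm_symm p) c u' v]
  ring

/-- The endomorphism `A` such that the equation of parallel transport is `v' = A v`. -/
def parallelEndo (p : M) (u u' : E) : E →L[ℝ] E :=
  -((chartForm p u).inverse ∘L christoffelBilin p u u')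

theorem chartForm_parallelEndo {p : M} {u : E} (hu : u ∈ (extChartAt 𝓘(ℝ, E) p).target)
    (u' v c : E) :
    chartForm p u (parallelEndo p u u' v) c + christoffel p u u' v c = 0 := by
  rw [← christoffelBilin_apply hu, parallelEndo]
  have h := (chartForm_isInvertible hu).self_apply_inverse (christoffelBilin p u u' v)
  simp [h]

theorem continuousOn_parallelEndo {p : M} {S : Set ℝ} {u u' : ℝ → E} (hu : ContinuousOn u S)
    (hu' : ContinuousOn u' S) (hmem : ∀ t ∈ S, u t ∈ (extChartAt 𝓘(ℝ, E) p).target) :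
    ContinuousOn (fun t => parallelEndo p (u t) (u' t)) S := by
  have hopen : IsOpen (extChartAt 𝓘(ℝ, E) p).target := isOpen_extChartAt_target p
  have h1 : ContinuousOn (fun t => (chartForm p (u t)).inverse) S := by
    intro t ht
    obtain ⟨e, he⟩ := chartForm_isInvertible (hmem t ht)
    have h2 := (contDiffAt_map_inverse (n := 0) e).continuousAt
    rw [he] at h2
    exact ContinuousAt.comp_continuousWithinAt (f := fun t => chartForm p (u t)) h2
      (((contDiffOn_chartForm p).continuousOn.comp hu hmem) t ht)
  have h2 : ContinuousOn (fun t => fderiv ℝ (chartForm p) (u t)) S :=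
    ((contDiffOn_chartForm p).continuousOn_fderiv_of_isOpen hopen (by simp)).comp hu hmem
  have h3 : ContinuousOn (fun t => christoffelBilin p (u t) (u' t)) S := by
    rw [continuousOn_clm_apply]
    intro v
    rw [continuousOn_clm_apply]
    intro c
    simp only [christoffelBilin, add_apply, sub_apply, smul_apply, ContinuousLinearMap.flip_apply]
    have h4 : ∀ f g : ℝ → E, ContinuousOn f S → ContinuousOn g S → ∀ c,
        ContinuousOn (fun t => fderiv ℝ (chartForm p) (u t) (f t) (g t) c) S := fun f g hf hg c =>
      ((h2.clm_apply hf).clm_apply hg).clm_apply continuousOn_const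
    have h5 := h4 u' (fun _ => v) hu' continuousOn_const c
    have h6 := h4 (fun _ => v) u' continuousOn_const hu' c
    have h7 := h4 (fun _ => c) u' continuousOn_const hu' v
    exact ((h5.add h6).sub h7).const_smul (2 : ℝ)⁻¹
  exact (h1.clm_comp h3).neg

/-- The product rule gives `∂_{u'}g(v, w) + g(v', w) + g(v, w')`; the two parallel equations turn
the last two terms into Christoffel symbols, and metric compatibility cancels everything. -/
theorem hasDerivWithinAt_inner_parallel {S : Set ℝ} {γ : ℝ → M}
    {V W : ∀ t, TangentSpace 𝓘(ℝ, E) (γ t)} {p : M} {t : ℝ} (hS : UniqueDiffWithinAt ℝ S t)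
    (hγ : ContinuousWithinAt γ S t)
    (hp : γ t ∈ (chartAt E p).source) (hV : ParallelAt S γ V p t) (hW : ParallelAt S γ W p t) :
    HasDerivWithinAt (fun s => inner ℝ (V s) (W s)) 0 S t := by
  obtain ⟨u', v', hu, hv, hveq⟩ := hV
  obtain ⟨u'', w', hu2, hw, hweq⟩ := hW
  -- Each parallel equation carries its own witness for the velocity of the curve; unique
  -- differentiability identifies them.
  obtain rfl : u' = u'' := hS.eq_deriv _ hu hu2
  have ht := mem_target (E := E) hp
  have hG := (differentiableAt_chartForm ht).hasFDerivAt
  have h1 : HasDerivWithinAt (fun s => chartForm p (extChartAt 𝓘(ℝ, E) p (γ s)))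
      (fderiv ℝ (chartForm p) (extChartAt 𝓘(ℝ, E) p (γ t)) u') S t :=
    HasFDerivAt.comp_hasDerivWithinAt (l := chartForm p) t hG hu
  have h2 := (h1.clm_apply hv).clm_apply hw
  have hev : ∀ᶠ s in 𝓝[S] t, γ s ∈ (chartAt E p).source :=
    hγ.eventually ((chartAt E p).open_source.mem_nhds hp)
  have h3 := h2.congr_of_eventuallyEq
    (f₁ := fun s => inner ℝ (V s) (W s))
    (by filter_upwards [hev] with s hs using inner_eq_chartForm hs (V s) (W s))
    (inner_eq_chartForm hp (V t) (W t))
  have e1 := hveq (chartVec p (W t))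
  have e2 := hweq (chartVec p (V t))
  rw [chartMetric_eq, christoffel_eq ht] at e1 e2
  have e3 := christoffelForm_add_swap (G := chartForm (E := E) p)
    (fderiv_form_symm (differentiableAt_chartForm ht) (chartForm_symm p))
    u' (chartVec p (V t)) (chartVec p (W t))
  rw [chartForm_symm] at e2
  refine h3.congr_deriv ?_
  rw [add_apply]
  linarith

/-- Three facts follow: transport is isometric, a parallel field is determined by its initial value
(apply this to a difference), and geodesics have constant speed. -/
theorem inner_parallel_eq {γ : ℝ → M} (hγ : ContinuousOn γ (Icc 0 1))
    {V W : ∀ t, TangentSpace 𝓘(ℝ, E) (γ t)} (hV : IsParallelAlong γ V) (hW : IsParallelAlong γ W)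
    {t : ℝ} (ht : t ∈ Icc (0 : ℝ) 1) : (inner ℝ (V t) (W t) : ℝ) = inner ℝ (V 0) (W 0) := by
  have h : ∀ t ∈ Icc (0 : ℝ) 1,
      HasDerivWithinAt (fun s => (inner ℝ (V s) (W s) : ℝ)) 0 (Icc 0 1) t := fun t ht =>
    hasDerivWithinAt_inner_parallel (uniqueDiffOn_Icc zero_lt_one t ht) (hγ t ht)
      (mem_chart_source E (γ t)) (hV t ht (γ t) (mem_chart_source E (γ t)))
      (hW t ht (γ t) (mem_chart_source E (γ t)))
  exact constant_of_derivWithin_zero (fun t ht => (h t ht).differentiableWithinAt)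
    (fun t ht => (h t (Ico_subset_Icc_self ht)).derivWithin
      (uniqueDiffOn_Icc zero_lt_one t (Ico_subset_Icc_self ht))) t ht

theorem ParallelAt.add_smul {S : Set ℝ} {γ : ℝ → M}
    {V W : ∀ t, TangentSpace 𝓘(ℝ, E) (γ t)} {p : M} {t : ℝ} (hS : UniqueDiffWithinAt ℝ S t)
    (hp : γ t ∈ (chartAt E p).source) (hV : ParallelAt S γ V p t) (hW : ParallelAt S γ W p t)
    (k : ℝ) : ParallelAt S γ (fun s => V s + k • W s) p t := by
  obtain ⟨u', v', hu, hv, hveq⟩ := hV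
  obtain ⟨u'', w', hu2, hw, hweq⟩ := hW
  obtain rfl : u' = u'' := hS.eq_deriv _ hu hu2
  refine ⟨u', v' + k • w', hu, ?_, fun c => ?_⟩
  · simp only [chartVec_add, chartVec_smul]
    exact hv.add (hw.const_smul k)
  · have ht := mem_target (E := E) hp
    have e1 := hveq c
    have e2 := hweq c
    rw [chartMetric_eq, ← christoffelBilin_apply ht] at e1 e2 ⊢
    simp only [chartVec_add, chartVec_smul, map_add, map_smul, add_apply, smul_apply, smul_eq_mul]
    linear_combination e1 + k * e2

end ParallelField

/-! ### Existence of parallel fields along smooth curves. -/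

section ParallelExistence

variable {E : Type*} [NormedAddCommGroup E] [NormedSpace ℝ E]
  {M : Type*} [MetricSpace M] [ChartedSpace E M] [IsManifold 𝓘(ℝ, E) ∞ M]

theorem contDiffOn_coord {γ : ℝ → M} {S : Set ℝ} (hγ : ContMDiffOn 𝓘(ℝ, ℝ) 𝓘(ℝ, E) ∞ γ S)
    {p : M} (hp : ∀ t ∈ S, γ t ∈ (chartAt E p).source) :
    ContDiffOn ℝ ∞ (fun s => extChartAt 𝓘(ℝ, E) p (γ s)) S := by
  intro t ht
  have h2 := contMDiffAt_extChartAt' (I := 𝓘(ℝ, E)) (n := ∞) (x := p) (hp t ht)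
  exact (h2.comp_contMDiffWithinAt t (hγ t ht)).contDiffWithinAt

theorem exists_hasDerivWithinAt_coord {γ : ℝ → M} {S : Set ℝ}
    (hγ : ContMDiffOn 𝓘(ℝ, ℝ) 𝓘(ℝ, E) ∞ γ S) {p : M} {t : ℝ} (ht : t ∈ S)
    (hp : γ t ∈ (chartAt E p).source) :
    ∃ u', HasDerivWithinAt (fun s => extChartAt 𝓘(ℝ, E) p (γ s)) u' S t := by
  have h2 := contMDiffAt_extChartAt' (I := 𝓘(ℝ, E)) (n := ∞) (x := p) hp
  have h3 := (h2.comp_contMDiffWithinAt t (hγ t ht)).contDiffWithinAt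
  exact ⟨_, (h3.differentiableWithinAt (by simp)).hasDerivWithinAt⟩

variable [RiemannianBundle (fun x : M => TangentSpace 𝓘(ℝ, E) x)] [FiniteDimensional ℝ E]
  [IsContMDiffRiemannianBundle 𝓘(ℝ, E) ∞ E (fun x : M => TangentSpace 𝓘(ℝ, E) x)]

/-- The vector field `V` is parallel along the restriction of `γ` to `S`. -/
def ParallelOn (γ : ℝ → M) (V : ∀ t, TangentSpace 𝓘(ℝ, E) (γ t)) (S : Set ℝ) : Prop :=
  ∀ t ∈ S, ∀ p : M, γ t ∈ (chartAt E p).source → ParallelAt S γ V p t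

theorem ParallelAt.congr_mono {S S' : Set ℝ} {γ : ℝ → M} {V V' : ∀ t, TangentSpace 𝓘(ℝ, E) (γ t)}
    {p : M} {t : ℝ} (h : ParallelAt S γ V p t) (hS : S ∈ 𝓝[S'] t)
    (hV : ∀ᶠ s in 𝓝[S'] t, V' s = V s) (hVt : V' t = V t) : ParallelAt S' γ V' p t := by
  obtain ⟨u', v', hu, hv, heq⟩ := h
  refine ⟨u', v', hu.mono_of_mem_nhdsWithin hS,
    (hv.mono_of_mem_nhdsWithin hS).congr_of_eventuallyEq ?_ (by rw [hVt]), by rwa [hVt]⟩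
  filter_upwards [hV] with s hs
  rw [hs]

/-- At a junction the one-sided derivatives of the field agree: both solve the same equation with
the same `u'`, and the metric is nondegenerate. -/
theorem ParallelAt.union {S S' : Set ℝ} {γ : ℝ → M} {V : ∀ t, TangentSpace 𝓘(ℝ, E) (γ t)}
    {p : M} {t : ℝ} {u' : E} (hp : γ t ∈ (chartAt E p).source)
    (hu : HasDerivWithinAt (fun s => extChartAt 𝓘(ℝ, E) p (γ s)) u' (S ∪ S') t)
    (hS : UniqueDiffWithinAt ℝ S t) (hS' : UniqueDiffWithinAt ℝ S' t)
    (h : ParallelAt S γ V p t) (h' : ParallelAt S' γ V p t) : ParallelAt (S ∪ S') γ V p t := by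
  obtain ⟨u₁, v₁, hu₁, hv₁, heq₁⟩ := h
  obtain ⟨u₂, v₂, hu₂, hv₂, heq₂⟩ := h'
  obtain rfl := hS.eq_deriv _ (hu.mono subset_union_left) hu₁
  obtain rfl := hS'.eq_deriv _ (hu.mono subset_union_right) hu₂
  have hv : v₁ = v₂ := eq_of_chartForm_eq (mem_target hp) fun c => by
    have e1 := heq₁ c
    have e2 := heq₂ c
    rw [chartMetric_eq] at e1 e2
    linarith
  subst hv
  exact ⟨u', v₁, hu, hv₁.union hv₂, heq₁⟩

theorem ParallelOn.concat {γ : ℝ → M} (hγ : ContMDiffOn 𝓘(ℝ, ℝ) 𝓘(ℝ, E) ∞ γ (Icc 0 1))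
    {a b c : ℝ} (h0 : 0 ≤ a) (hac : a < c) (hcb : c < b) (h1 : b ≤ 1)
    {V W : ∀ t, TangentSpace 𝓘(ℝ, E) (γ t)} (hV : ParallelOn γ V (Icc a c))
    (hW : ParallelOn γ W (Icc c b)) (hVW : V c = W c) :
    ParallelOn γ (fun t => if t ≤ c then V t else W t) (Icc a b) := by
  intro t ht p hp
  rcases lt_trichotomy t c with htc | rfl | htc
  · refine (hV t ⟨ht.1, htc.le⟩ p hp).congr_mono ?_ ?_ (if_pos htc.le)
    · filter_upwards [self_mem_nhdsWithin, mem_nhdsWithin_of_mem_nhds (Iio_mem_nhds htc)]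
        with s hs hs' using ⟨hs.1, le_of_lt hs'⟩
    · filter_upwards [mem_nhdsWithin_of_mem_nhds (Iio_mem_nhds htc)] with s hs
      exact if_pos (le_of_lt hs)
  · obtain ⟨u', hu'⟩ := exists_hasDerivWithinAt_coord hγ ⟨h0.trans ht.1, ht.2.trans h1⟩ hp
    have hun : Icc a t ∪ Icc t b = Icc a b := Icc_union_Icc_eq_Icc ht.1 ht.2
    rw [← hun]
    refine ParallelAt.union hp (hu'.mono ?_) (uniqueDiffOn_Icc hac t (right_mem_Icc.2 hac.le))
      (uniqueDiffOn_Icc hcb t (left_mem_Icc.2 hcb.le)) ?_ ?_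
    · rw [hun]
      exact Icc_subset_Icc h0 h1
    · refine (hV t (right_mem_Icc.2 hac.le) p hp).congr_mono self_mem_nhdsWithin ?_ (if_pos le_rfl)
      filter_upwards [self_mem_nhdsWithin] with s hs using if_pos hs.2
    · refine (hW t (left_mem_Icc.2 hcb.le) p hp).congr_mono self_mem_nhdsWithin ?_
        ((if_pos le_rfl).trans hVW)
      filter_upwards [self_mem_nhdsWithin] with s hs
      rcases hs.1.eq_or_lt with rfl | hlt
      · exact (if_pos le_rfl).trans hVW
      · exact if_neg (not_le.2 hlt)
  · refine (hW t ⟨htc.le, ht.2⟩ p hp).congr_mono ?_ ?_ (if_neg (not_le.2 htc))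
    · filter_upwards [self_mem_nhdsWithin, mem_nhdsWithin_of_mem_nhds (Ioi_mem_nhds htc)]
        with s hs hs' using ⟨le_of_lt hs', hs.2⟩
    · filter_upwards [mem_nhdsWithin_of_mem_nhds (Ioi_mem_nhds htc)] with s hs
      exact if_neg (not_le.2 hs)

theorem exists_parallelOn_short {γ : ℝ → M} (hγ : ContMDiffOn 𝓘(ℝ, ℝ) 𝓘(ℝ, E) ∞ γ (Icc 0 1))
    {t₀ : ℝ} (ht₀ : t₀ ∈ Icc (0 : ℝ) 1) :
    ∃ r > 0, ∀ a b, a < b → Icc a b ⊆ Icc 0 1 ∩ Metric.ball t₀ r →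
      ∀ v : TangentSpace 𝓘(ℝ, E) (γ a), ∃ V, ParallelOn γ V (Icc a b) ∧ V a = v := by
  set p := γ t₀
  obtain ⟨O, hO, hOeq⟩ := (continuousOn_iff'.1 hγ.continuousOn) _ (chartAt E p).open_source
  have hO0 : t₀ ∈ O := by
    have : t₀ ∈ γ ⁻¹' (chartAt E p).source ∩ Icc 0 1 := ⟨mem_chart_source E p, ht₀⟩
    rw [hOeq] at this
    exact this.1
  set S := O ∩ Icc (0 : ℝ) 1 with hS
  have hSsrc : ∀ t ∈ S, γ t ∈ (chartAt E p).source := fun t ht => by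
    rw [← hOeq] at ht
    exact ht.1
  have hSu : UniqueDiffOn ℝ S := by
    rw [hS, inter_comm]
    exact (uniqueDiffOn_Icc zero_lt_one).inter hO
  set u : ℝ → E := fun s => extChartAt 𝓘(ℝ, E) p (γ s) with hu
  have hcd : ContDiffOn ℝ ∞ u S := contDiffOn_coord (hγ.mono inter_subset_right) hSsrc
  set A : ℝ → E →L[ℝ] E := fun t => parallelEndo p (u t) (derivWithin u S t)
  have hA : ContinuousOn A S := continuousOn_parallelEndo hcd.continuousOn
    (hcd.continuousOn_derivWithin hSu (by simp)) fun t ht => mem_target (hSsrc t ht)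
  have hev : ∀ᶠ s in 𝓝[S] t₀, ‖A s‖ < ‖A t₀‖ + 1 :=
    (hA t₀ ⟨hO0, ht₀⟩).norm.eventually (Iio_mem_nhds (lt_add_one _))
  obtain ⟨r₁, hr₁, hball₁⟩ := Metric.mem_nhdsWithin_iff.1 hev
  obtain ⟨r₂, hr₂, hball₂⟩ := Metric.isOpen_iff.1 hO t₀ hO0
  set C := ‖A t₀‖ + 1
  have hC : 0 < C := by positivity
  -- `r₁` bounds the coefficients by `C`, `r₂` keeps the curve in the chart, and an interval inside
  -- a ball of radius `1/(4C)` has length at most `1/(2C)`, as the ODE lemma requires.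
  refine ⟨min (min r₁ r₂) (1 / (4 * C)), by positivity, fun a b hab hsub v => ?_⟩
  have hsubS : Icc a b ⊆ S := fun t ht =>
    ⟨hball₂ (Metric.ball_subset_ball ((min_le_left _ _).trans (min_le_right _ _)) (hsub ht).2),
      (hsub ht).1⟩
  have hbound : ∀ t ∈ Icc a b, ‖A t‖ ≤ C := fun t ht => le_of_lt (hball₁
    ⟨Metric.ball_subset_ball ((min_le_left _ _).trans (min_le_left _ _)) (hsub ht).2, hsubS ht⟩)
  have hlen : C * (b - a) ≤ 1 / 2 := by
    have h1 : |a - t₀| < 1 / (4 * C) :=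
      (hsub (left_mem_Icc.2 hab.le)).2.trans_le (min_le_right _ _)
    have h2 : |b - t₀| < 1 / (4 * C) :=
      (hsub (right_mem_Icc.2 hab.le)).2.trans_le (min_le_right _ _)
    rw [abs_lt] at h1 h2
    have h3 : C * (b - a) ≤ C * (2 * (1 / (4 * C))) :=
      mul_le_mul_of_nonneg_left (by linarith) hC.le
    refine h3.trans (le_of_eq ?_)
    field_simp
    norm_num
  obtain ⟨α, hα0, hα⟩ := exists_linear_ode_solution hab.le (hA.mono hsubS) hbound hlen
    (chartVec p v)
  have hex : ∀ t, ∃ w : TangentSpace 𝓘(ℝ, E) (γ t), γ t ∈ (chartAt E p).source →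
      chartVec p w = α t := fun t => by
    by_cases h : γ t ∈ (chartAt E p).source
    · obtain ⟨w, hw⟩ := exists_chartVec_eq h (α t)
      exact ⟨w, fun _ => hw⟩
    · exact ⟨0, fun h' => absurd h' h⟩
  choose V hV using hex
  refine ⟨V, fun t ht q hq => ?_, ?_⟩
  · have hts := hsubS ht
    have hdu : HasDerivWithinAt u (derivWithin u S t) S t :=
      ((hcd t hts).differentiableWithinAt (by simp)).hasDerivWithinAt
    have hpar : ParallelAt (Icc a b) γ V p t := by
      refine ⟨derivWithin u S t, A t (α t), hdu.mono hsubS, ?_, fun c => ?_⟩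
      · exact (hα t ht).congr (fun s hs => hV s (hSsrc s (hsubS hs))) (hV t (hSsrc t hts))
      · rw [hV t (hSsrc t hts)]
        exact chartForm_parallelEndo (mem_target (hSsrc t hts)) _ _ c
    exact hpar.chart_change
      ((hγ.continuousOn t (hsub ht).1).mono fun s hs => (hsub hs).1) (hSsrc t hts) hq
  · have ha := hSsrc a (hsubS (left_mem_Icc.2 hab.le))
    exact chartVec_injective ha ((hV a ha).trans hα0)

theorem exists_isParallelAlong {γ : ℝ → M} (hγ : ContMDiffOn 𝓘(ℝ, ℝ) 𝓘(ℝ, E) ∞ γ (Icc 0 1))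
    (v : TangentSpace 𝓘(ℝ, E) (γ 0)) : ∃ V, IsParallelAlong γ V ∧ V 0 = v := by
  choose! r hr hshort using fun t (ht : t ∈ Icc (0 : ℝ) 1) => exists_parallelOn_short hγ ht
  obtain ⟨τ, hτ0, hτm, ⟨m, hm⟩, hτ⟩ := exists_monotone_Icc_subset_open_cover_Icc
    (zero_le_one (α := ℝ)) (c := fun i : Icc (0 : ℝ) 1 => Metric.ball i (r i))
    (fun i => Metric.isOpen_ball)
    (fun i _ => mem_iUnion.2 ⟨i, Metric.mem_ball_self (hr i i.2)⟩)
  -- The partition starts at `0` and may repeat values. A one-point interval imposes no useful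
  -- condition, so parallelism is claimed only once `τ n > 0`; the first genuine piece then replaces
  -- `V` instead of being glued to it.
  have key : ∀ n, ∃ V : ∀ t, TangentSpace 𝓘(ℝ, E) (γ t), V 0 = v ∧
      (0 < (τ n : ℝ) → ParallelOn γ V (Icc 0 (τ n))) := by
    intro n
    induction n with
    | zero =>
      refine ⟨Function.update (fun _ => 0) 0 v, Function.update_self .., fun h => ?_⟩
      rw [hτ0] at h
      exact absurd h (lt_irrefl _)
    | succ n ih =>
      obtain ⟨V, hV0, hV⟩ := ih
      obtain ⟨i, hi⟩ := hτ n
      rcases (hτm n.le_succ).eq_or_lt with heq | hlt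
      · rw [← heq]
        exact ⟨V, hV0, hV⟩
      have hlt' : (τ n : ℝ) < τ (n + 1) := hlt
      have hsub : Icc (τ n : ℝ) (τ (n + 1)) ⊆ Icc 0 1 ∩ Metric.ball (i : ℝ) (r i) := by
        intro s hs
        have hs01 : s ∈ Icc (0 : ℝ) 1 := ⟨(τ n).2.1.trans hs.1, hs.2.trans (τ (n + 1)).2.2⟩
        exact ⟨hs01, hi (show (⟨s, hs01⟩ : Icc (0 : ℝ) 1) ∈ Icc (τ n) (τ (n + 1)) from hs)⟩
      obtain ⟨W, hW, hWV⟩ := hshort i i.2 _ _ hlt' hsub (V (τ n))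
      rcases (τ n).2.1.eq_or_lt with h0 | h0
      · refine ⟨W, ?_, fun _ => ?_⟩
        · rw [← h0] at hWV
          rw [hWV, hV0]
        · rwa [← h0] at hW
      · exact ⟨_, (if_pos h0.le).trans hV0, fun _ =>
          (hV h0).concat hγ le_rfl h0 hlt' (τ (n + 1)).2.2 hW hWV.symm⟩
  obtain ⟨V, hV0, hV⟩ := key m
  rw [hm m le_rfl] at hV
  exact ⟨V, hV zero_lt_one, hV0⟩

end ParallelExistence

/-! ### Parallel transport and the inverse exponential map as well-defined operations. -/

section Transport

variable {E : Type*} [NormedAddCommGroup E] [NormedSpace ℝ E]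
  {M : Type*} [MetricSpace M] [ChartedSpace E M]

theorem vector_eq_of_mk_eq {x : M} {v w : TangentSpace 𝓘(ℝ, E) x}
    (h : (⟨x, v⟩ : TangentBundle 𝓘(ℝ, E) M) = ⟨x, w⟩) : v = w :=
  eq_of_heq (Bundle.TotalSpace.mk.inj h).2

theorem exists_mk_eq {x y : M} (h : x = y) (v : TangentSpace 𝓘(ℝ, E) x) :
    ∃ w : TangentSpace 𝓘(ℝ, E) y, (⟨x, v⟩ : TangentBundle 𝓘(ℝ, E) M) = ⟨y, w⟩ := by
  subst h
  exact ⟨v, rfl⟩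

variable [IsManifold 𝓘(ℝ, E) ∞ M]

theorem hasDerivWithinAt_coord_velocity {γ : ℝ → M}
    (hγ : ContMDiffOn 𝓘(ℝ, ℝ) 𝓘(ℝ, E) ∞ γ (Icc 0 1)) {p : M} {t : ℝ} (ht : t ∈ Icc (0 : ℝ) 1)
    (hp : γ t ∈ (chartAt E p).source) :
    HasDerivWithinAt (fun s => extChartAt 𝓘(ℝ, E) p (γ s)) (chartVec p (velocity γ t))
      (Icc 0 1) t := by
  have h1 := ((contMDiffAt_extChartAt' (I := 𝓘(ℝ, E)) (n := ∞) (x := p) hp).mdifferentiableAt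
    (by simp)).hasMFDerivAt
  have h2 := ((hγ t ht).mdifferentiableWithinAt (by simp)).hasMFDerivWithinAt
  obtain ⟨A, hA, hA1⟩ : ∃ A : ℝ →L[ℝ] E,
      HasFDerivWithinAt (fun s => extChartAt 𝓘(ℝ, E) p (γ s)) A (Icc 0 1) t ∧
      A 1 = chartVec p (velocity γ t) :=
    ⟨_, (h1.comp_hasMFDerivWithinAt t h2).hasFDerivWithinAt, rfl⟩
  rw [← hA1]
  exact hA.hasDerivWithinAt

variable [RiemannianBundle (fun x : M => TangentSpace 𝓘(ℝ, E) x)]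

/-- Geodesic convexity identifies minimizing geodesics only on `[0, 1]`, so parallel fields have to
be carried between curves that agree just there. -/
theorem IsParallelAlong.congr_curve {γ γ' : ℝ → M} (h : EqOn γ' γ (Icc 0 1))
    {V : ∀ t, TangentSpace 𝓘(ℝ, E) (γ t)} (hV : IsParallelAlong γ V) :
    ∃ V' : ∀ t, TangentSpace 𝓘(ℝ, E) (γ' t), IsParallelAlong γ' V' ∧
      ∀ t ∈ Icc (0 : ℝ) 1, (⟨γ' t, V' t⟩ : TangentBundle 𝓘(ℝ, E) M) = ⟨γ t, V t⟩ := by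
  have hex : ∀ t, ∃ w : TangentSpace 𝓘(ℝ, E) (γ' t), t ∈ Icc (0 : ℝ) 1 →
      (⟨γ' t, w⟩ : TangentBundle 𝓘(ℝ, E) M) = ⟨γ t, V t⟩ := fun t => by
    by_cases ht : t ∈ Icc (0 : ℝ) 1
    · obtain ⟨w, hw⟩ := exists_mk_eq (h ht).symm (V t)
      exact ⟨w, fun _ => hw.symm⟩
    · exact ⟨0, fun h' => absurd h' ht⟩
  choose V' hV' using hex
  refine ⟨V', fun t ht p hp => ?_, hV'⟩
  have hc : ∀ s ∈ Icc (0 : ℝ) 1, chartVec p (V' s) = chartVec p (V s) := fun s hs =>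
    congrArg (fun z : TangentBundle 𝓘(ℝ, E) M => chartVec p z.snd) (hV' s hs)
  rw [h ht] at hp
  obtain ⟨u', v', hu, hv, heq⟩ := hV t ht p hp
  refine ⟨u', v', hu.congr (fun s hs => ?_) ?_, hv.congr hc (hc t ht), ?_⟩
  · rw [h hs]
  · rw [h ht]
  · rw [hc t ht, h ht]
    exact heq

theorem velocity_congr {γ γ' : ℝ → M} (h : EqOn γ' γ (Icc 0 1)) {t : ℝ} (ht : t ∈ Icc (0 : ℝ) 1) :
    (⟨γ' t, velocity γ' t⟩ : TangentBundle 𝓘(ℝ, E) M) = ⟨γ t, velocity γ t⟩ := by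
  refine Bundle.TotalSpace.ext (h ht) (heq_of_eq ?_)
  have h1 := mfderivWithin_congr (I := 𝓘(ℝ, ℝ)) (I' := 𝓘(ℝ, E)) h (h ht)
  exact congrArg (fun f : ℝ →L[ℝ] E => f 1) h1

variable [FiniteDimensional ℝ E]
  [IsContMDiffRiemannianBundle 𝓘(ℝ, E) ∞ E (fun x : M => TangentSpace 𝓘(ℝ, E) x)]

theorem IsParallelAlong.add_smul {γ : ℝ → M} {V W : ∀ t, TangentSpace 𝓘(ℝ, E) (γ t)}
    (hV : IsParallelAlong γ V) (hW : IsParallelAlong γ W) (k : ℝ) :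
    IsParallelAlong γ (fun s => V s + k • W s) := fun t ht p hp =>
  ParallelAt.add_smul (uniqueDiffOn_Icc zero_lt_one t ht) hp (hV t ht p hp) (hW t ht p hp) k

/-- The difference is parallel, and its norm keeps its initial value zero. -/
theorem IsParallelAlong.eq_of_zero {γ : ℝ → M} (hγ : ContinuousOn γ (Icc 0 1))
    {V W : ∀ t, TangentSpace 𝓘(ℝ, E) (γ t)} (hV : IsParallelAlong γ V) (hW : IsParallelAlong γ W)
    (h0 : V 0 = W 0) {t : ℝ} (ht : t ∈ Icc (0 : ℝ) 1) : V t = W t := by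
  have h1 := hV.add_smul hW (-1)
  have h2 := inner_parallel_eq hγ h1 h1 ht
  simp only [h0, neg_smul, one_smul, add_neg_cancel, inner_zero_left, inner_self_eq_zero] at h2
  exact sub_eq_zero.1 (by rw [sub_eq_add_neg]; exact h2)

variable {X : Set M}

/-- The `epsilon` in `transport` has no freedom: the minimizing geodesic is unique on `[0, 1]`, and
a parallel field is determined by its initial value. Any geodesic and field at hand thus compute the
transport. -/
theorem transport_spec (hX : GeodesicallyConvex E X) {x y : M} (hx : x ∈ X) (hy : y ∈ X)
    {v : TangentSpace 𝓘(ℝ, E) x} {γ : ℝ → M} (hγ : IsMinGeodesic E γ x y)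
    {V : ∀ t, TangentSpace 𝓘(ℝ, E) (γ t)} (hV : IsParallelAlong γ V)
    (hV0 : (⟨γ 0, V 0⟩ : TangentBundle 𝓘(ℝ, E) M) = ⟨x, v⟩) :
    (⟨γ 1, V 1⟩ : TangentBundle 𝓘(ℝ, E) M) = ⟨y, transport x y v⟩ := by
  have h0 : (0 : ℝ) ∈ Icc (0 : ℝ) 1 := left_mem_Icc.2 zero_le_one
  have h1 : (1 : ℝ) ∈ Icc (0 : ℝ) 1 := right_mem_Icc.2 zero_le_one
  obtain ⟨w, hw⟩ := exists_mk_eq hγ.2.2.1 (V 1)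
  obtain ⟨γ', V', hγ', hV', hV'0, hV'1⟩ : ∃ (γ : ℝ → M) (V : ∀ t, TangentSpace 𝓘(ℝ, E) (γ t)),
      IsMinGeodesic E γ x y ∧ IsParallelAlong γ V ∧
      (⟨γ 0, V 0⟩ : TangentBundle 𝓘(ℝ, E) M) = ⟨x, v⟩ ∧
      (⟨γ 1, V 1⟩ : TangentBundle 𝓘(ℝ, E) M) = ⟨y, transport x y v⟩ :=
    Classical.epsilon_spec (p := fun w : TangentSpace 𝓘(ℝ, E) y =>
      ∃ (γ : ℝ → M) (V : ∀ t, TangentSpace 𝓘(ℝ, E) (γ t)),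
        IsMinGeodesic E γ x y ∧ IsParallelAlong γ V ∧
        (⟨γ 0, V 0⟩ : TangentBundle 𝓘(ℝ, E) M) = ⟨x, v⟩ ∧
        (⟨γ 1, V 1⟩ : TangentBundle 𝓘(ℝ, E) M) = ⟨y, w⟩) ⟨w, γ, V, hγ, hV, hV0, hw⟩
  obtain ⟨γ₀, -, -, huniq⟩ := hX x hx y hy
  have hEq : EqOn γ γ' (Icc 0 1) := fun t ht => (huniq γ hγ ht).trans (huniq γ' hγ' ht).symm
  obtain ⟨W, hW, hWV⟩ := hV'.congr_curve hEq
  have hVW : V 1 = W 1 := hV.eq_of_zero hγ.1.1.continuousOn hW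
    (vector_eq_of_mk_eq (hV0.trans ((hWV 0 h0).trans hV'0).symm)) h1
  rw [hVW, hWV 1 h1, hV'1]

theorem expInv_spec (hX : GeodesicallyConvex E X) {x y : M} (hx : x ∈ X) (hy : y ∈ X)
    {γ : ℝ → M} (hγ : IsMinGeodesic E γ x y) :
    (⟨γ 0, velocity γ 0⟩ : TangentBundle 𝓘(ℝ, E) M) = ⟨x, expInv E x y⟩ := by
  obtain ⟨w, hw⟩ := exists_mk_eq hγ.2.1 (velocity (E := E) γ 0)
  obtain ⟨γ', hγ', h'⟩ : ∃ γ : ℝ → M, IsMinGeodesic E γ x y ∧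
      (⟨γ 0, velocity γ 0⟩ : TangentBundle 𝓘(ℝ, E) M) = ⟨x, expInv E x y⟩ :=
    Classical.epsilon_spec (p := fun v : TangentSpace 𝓘(ℝ, E) x =>
      ∃ γ : ℝ → M, IsMinGeodesic E γ x y ∧
        (⟨γ 0, velocity γ 0⟩ : TangentBundle 𝓘(ℝ, E) M) = ⟨x, v⟩) ⟨w, γ, hγ, hw⟩
  obtain ⟨γ₀, -, -, huniq⟩ := hX x hx y hy
  have hEq : EqOn γ γ' (Icc 0 1) := fun t ht => (huniq γ hγ ht).trans (huniq γ' hγ' ht).symm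
  rw [velocity_congr hEq (left_mem_Icc.2 zero_le_one), h']

theorem geod_spec (hX : GeodesicallyConvex E X) {x y : M} (hx : x ∈ X) (hy : y ∈ X) :
    IsMinGeodesic E (geod E x y) x y ∧ ∀ t ∈ Icc (0 : ℝ) 1, geod E x y t ∈ X := by
  obtain ⟨γ, hγ, hγX, huniq⟩ := hX x hx y hy
  have h := @Classical.epsilon_spec_aux (ℝ → M) ⟨fun _ => x⟩ (fun γ => IsMinGeodesic E γ x y) ⟨γ, hγ⟩
  refine ⟨h, fun t ht => ?_⟩
  have := huniq _ h ht
  rw [geod, this]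
  exact hγX t ht

theorem norm_expInv (hX : GeodesicallyConvex E X) {x y : M} (hx : x ∈ X) (hy : y ∈ X) :
    ‖expInv E x y‖ = dist x y := by
  obtain ⟨γ, hγ, -, -⟩ := hX x hx y hy
  rw [← hγ.2.2.2]
  exact (congrArg (fun z : TangentBundle 𝓘(ℝ, E) M => ‖z.snd‖) (expInv_spec hX hx hy hγ)).symm

/-- Parallel transport between points of a geodesically convex set is a linear isometry. -/
theorem exists_transport_eq (hX : GeodesicallyConvex E X) {x y : M} (hx : x ∈ X) (hy : y ∈ X) :
    ∃ T : TangentSpace 𝓘(ℝ, E) x →ₗᵢ[ℝ] TangentSpace 𝓘(ℝ, E) y, ∀ v, transport x y v = T v := by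
  obtain ⟨γ, hγ, -, -⟩ := hX x hx y hy
  obtain ⟨rfl, rfl⟩ : γ 0 = x ∧ γ 1 = y := ⟨hγ.2.1, hγ.2.2.1⟩
  choose V hV hV0 using exists_isParallelAlong hγ.1.1
  have hT : ∀ v, transport (γ 0) (γ 1) v = V v 1 := fun v =>
    (vector_eq_of_mk_eq (transport_spec hX hx hy hγ (hV v) (by rw [hV0 v]))).symm
  have hlin : ∀ (v w : TangentSpace 𝓘(ℝ, E) (γ 0)) (k : ℝ), transport (γ 0) (γ 1) (v + k • w)
      = transport (γ 0) (γ 1) v + k • transport (γ 0) (γ 1) w := by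
    intro v w k
    rw [hT v, hT w]
    exact (vector_eq_of_mk_eq (transport_spec hX hx hy hγ ((hV v).add_smul (hV w) k)
      (by rw [hV0 v, hV0 w]))).symm
  have hnorm : ∀ v, ‖transport (γ 0) (γ 1) v‖ = ‖v‖ := fun v => by
    have h := inner_parallel_eq hγ.1.1.continuousOn (hV v) (hV v) (right_mem_Icc.2 zero_le_one)
    rw [hV0, ← hT, real_inner_self_eq_norm_sq, real_inner_self_eq_norm_sq] at h
    exact (pow_left_inj₀ (norm_nonneg _) (norm_nonneg _) two_ne_zero).1 h
  have h0 : transport (γ 0) (γ 1) (0 : TangentSpace 𝓘(ℝ, E) (γ 0)) = 0 := by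
    rw [← norm_eq_zero, hnorm, norm_zero]
  refine ⟨⟨⟨⟨transport (γ 0) (γ 1), fun v w => ?_⟩, fun k w => ?_⟩, hnorm⟩, fun _ => rfl⟩
  · simpa using hlin v w 1
  · simpa [h0] using hlin 0 w k

end Transport

/-! ### Minimizing geodesics and the descent inequality. -/

section Geodesic

variable {E : Type*} [NormedAddCommGroup E] [NormedSpace ℝ E]
  {M : Type*} [MetricSpace M] [ChartedSpace E M] [IsManifold 𝓘(ℝ, E) ∞ M]
  [RiemannianBundle (fun x : M => TangentSpace 𝓘(ℝ, E) x)] [FiniteDimensional ℝ E]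
  [IsContMDiffRiemannianBundle 𝓘(ℝ, E) ∞ E (fun x : M => TangentSpace 𝓘(ℝ, E) x)]

theorem IsGeodesic.norm_velocity {γ : ℝ → M} (hγ : IsGeodesic E γ) {t : ℝ}
    (ht : t ∈ Icc (0 : ℝ) 1) : ‖velocity (E := E) γ t‖ = ‖velocity (E := E) γ 0‖ := by
  have h := inner_parallel_eq hγ.1.continuousOn hγ.2 hγ.2 ht
  rw [real_inner_self_eq_norm_sq, real_inner_self_eq_norm_sq] at h
  exact (pow_left_inj₀ (norm_nonneg _) (norm_nonneg _) two_ne_zero).1 h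

/-- The Riemannian distance is at most the length, and the speed is constant. -/
theorem IsGeodesic.dist_le [IsRiemannianManifold 𝓘(ℝ, E) M] {γ : ℝ → M} (hγ : IsGeodesic E γ)
    {a b : ℝ} (h0 : 0 ≤ a) (hab : a ≤ b) (h1 : b ≤ 1) :
    dist (γ a) (γ b) ≤ (b - a) * ‖velocity (E := E) γ 0‖ := by
  have hsub : Icc a b ⊆ Icc 0 1 := Icc_subset_Icc h0 h1
  have h2 : edist (γ a) (γ b) ≤ Manifold.pathELength 𝓘(ℝ, E) γ a b := by
    rw [IsRiemannianManifold.out (I := 𝓘(ℝ, E)) (γ a) (γ b)]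
    exact Manifold.riemannianEDist_le_pathELength
      ((hγ.1.mono hsub).of_le ENat.LEInfty.out) rfl rfl hab
  rw [Manifold.pathELength_eq_lintegral_mfderiv_Ioo] at h2
  have h3 : ∫⁻ t in Ioo a b, ‖mfderiv 𝓘(ℝ, ℝ) 𝓘(ℝ, E) γ t 1‖ₑ
      = ∫⁻ _ in Ioo a b, ENNReal.ofReal ‖velocity (E := E) γ 0‖ := by
    refine setLIntegral_congr_fun measurableSet_Ioo fun t ht => ?_
    have ht' : Icc (0 : ℝ) 1 ∈ 𝓝 t := Icc_mem_nhds (h0.trans_lt ht.1) (ht.2.trans_le h1)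
    have h4 := mfderivWithin_of_mem_nhds (I := 𝓘(ℝ, ℝ)) (I' := 𝓘(ℝ, E)) (f := γ) ht'
    rw [← hγ.norm_velocity (hsub (Ioo_subset_Icc_self ht)), velocity, h4, ofReal_norm]
  rw [h3, setLIntegral_const, Real.volume_Ioo, edist_dist, ← ENNReal.ofReal_mul (norm_nonneg _)] at h2
  rw [mul_comm]
  exact (ENNReal.ofReal_le_ofReal_iff (mul_nonneg (norm_nonneg _) (sub_nonneg.2 hab))).1 h2

theorem IsParallelAlong.restrict {γ : ℝ → M} {V : ∀ t, TangentSpace 𝓘(ℝ, E) (γ t)}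
    (hV : IsParallelAlong γ V) {τ : ℝ} (h0 : 0 ≤ τ) (h1 : τ ≤ 1) :
    IsParallelAlong (fun s => γ (τ * s)) (fun s => V (τ * s)) := by
  intro t ht p hp
  have hmaps : MapsTo (fun s => τ * s) (Icc 0 1) (Icc (0 : ℝ) 1) := fun s hs =>
    ⟨mul_nonneg h0 hs.1, mul_le_one₀ h1 hs.1 hs.2⟩
  obtain ⟨u', v', hu, hv, heq⟩ := hV (τ * t) (hmaps ht) p hp
  have hd : HasDerivWithinAt (fun s => τ * s) τ (Icc 0 1) t := by
    simpa using ((hasDerivAt_id t).const_mul τ).hasDerivWithinAt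
  refine ⟨τ • u', τ • v', hu.scomp t hd hmaps, hv.scomp t hd hmaps, fun c => ?_⟩
  have e := heq c
  have ht := mem_target (E := E) hp
  rw [chartMetric_eq, christoffel_eq ht] at e ⊢
  simp only [christoffelForm, map_smul, smul_apply, smul_eq_mul] at e ⊢
  linear_combination τ * e

theorem velocity_restrict {γ : ℝ → M} (hγ : ContMDiffOn 𝓘(ℝ, ℝ) 𝓘(ℝ, E) ∞ γ (Icc 0 1))
    {τ : ℝ} (h0 : 0 ≤ τ) (h1 : τ ≤ 1) :
    ContMDiffOn 𝓘(ℝ, ℝ) 𝓘(ℝ, E) ∞ (fun s => γ (τ * s)) (Icc 0 1) ∧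
    ∀ t ∈ Icc (0 : ℝ) 1, velocity (E := E) (fun s => γ (τ * s)) t = τ • velocity γ (τ * t) := by
  have hmaps : MapsTo (fun s => τ * s) (Icc 0 1) (Icc (0 : ℝ) 1) := fun s hs =>
    ⟨mul_nonneg h0 hs.1, mul_le_one₀ h1 hs.1 hs.2⟩
  have hσ : ContMDiffOn 𝓘(ℝ, ℝ) 𝓘(ℝ, E) ∞ (fun s => γ (τ * s)) (Icc 0 1) :=
    hγ.comp (contDiff_const.mul contDiff_id).contMDiff.contMDiffOn hmaps
  refine ⟨hσ, fun t ht => ?_⟩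
  have hp := mem_chart_source E (γ (τ * t))
  have hd : HasDerivWithinAt (fun s => τ * s) τ (Icc 0 1) t := by
    simpa using ((hasDerivAt_id t).const_mul τ).hasDerivWithinAt
  refine chartVec_injective hp ?_
  rw [chartVec_smul]
  exact (uniqueDiffOn_Icc zero_lt_one t ht).eq_deriv _ (hasDerivWithinAt_coord_velocity hσ ht hp)
    ((hasDerivWithinAt_coord_velocity hγ (hmaps ht) hp).scomp t hd hmaps)

/-- The pieces before and after `τ` have lengths `τ d` and `(1 - τ) d`. If the first were not
minimizing, the triangle inequality would make `d(x, y)` smaller than `d`. -/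
theorem IsMinGeodesic.restrict [IsRiemannianManifold 𝓘(ℝ, E) M] {γ : ℝ → M} {x y : M}
    (hγ : IsMinGeodesic E γ x y) {τ : ℝ} (h0 : 0 ≤ τ) (h1 : τ ≤ 1) :
    IsMinGeodesic E (fun s => γ (τ * s)) x (γ τ) := by
  obtain ⟨hσ, hvel⟩ := velocity_restrict hγ.1.1 h0 h1
  have hz : (0 : ℝ) ∈ Icc (0 : ℝ) 1 := left_mem_Icc.2 zero_le_one
  refine ⟨⟨hσ, fun t ht p hp => ?_⟩, ?_, ?_, ?_⟩
  · have h2 := hγ.1.2.restrict h0 h1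
    -- The restricted curve has velocity `τ w`, where `w` is the old velocity; it is written as `w +
    -- (τ - 1) w` to fit the linearity lemma.
    have h3 := h2.add_smul h2 (τ - 1)
    have e : ∀ s ∈ Icc (0 : ℝ) 1, velocity (E := E) (fun s => γ (τ * s)) s
        = velocity γ (τ * s) + (τ - 1) • velocity γ (τ * s) := fun s hs => by
      rw [hvel s hs]
      module
    exact ParallelAt.congr_mono (h3 t ht p hp) self_mem_nhdsWithin
      (by filter_upwards [self_mem_nhdsWithin] with s hs using e s hs) (e t ht)
  · simp [hγ.2.1]
  · simp
  · have e1 : ‖velocity (E := E) (fun s => γ (τ * s)) 0‖ = τ * dist x y := by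
      rw [hvel 0 hz, norm_smul, Real.norm_of_nonneg h0, hγ.1.norm_velocity
        (by simp), hγ.2.2.2]
    have e2 := hγ.1.dist_le le_rfl h0 h1
    have e3 := hγ.1.dist_le h0 h1 le_rfl
    have e4 := dist_triangle (γ 0) (γ τ) (γ 1)
    rw [hγ.2.2.2, hγ.2.1, hγ.2.2.1] at *
    linarith

theorem inner_grad (f : M → ℝ) (x : M) (v : TangentSpace 𝓘(ℝ, E) x) :
    inner ℝ (grad E f x) v
      = NormedSpace.fromTangentSpace (f x) (mfderiv 𝓘(ℝ, E) 𝓘(ℝ, ℝ) f x v) := by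
  rw [grad, InnerProductSpace.toDual_symm_apply]
  rfl

theorem hasDerivWithinAt_comp_curve {f : M → ℝ} {γ : ℝ → M}
    (hγ : ContMDiffOn 𝓘(ℝ, ℝ) 𝓘(ℝ, E) ∞ γ (Icc 0 1)) {t : ℝ} (ht : t ∈ Icc (0 : ℝ) 1)
    (hf : MDifferentiableAt 𝓘(ℝ, E) 𝓘(ℝ, ℝ) f (γ t)) :
    HasDerivWithinAt (fun s => f (γ s)) (inner ℝ (grad E f (γ t)) (velocity γ t)) (Icc 0 1) t := by
  have h2 := ((hγ t ht).mdifferentiableWithinAt (by simp)).hasMFDerivWithinAt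
  obtain ⟨A, hA, hA1⟩ : ∃ A : ℝ →L[ℝ] ℝ, HasFDerivWithinAt (fun s => f (γ s)) A (Icc 0 1) t ∧
      A 1 = inner ℝ (grad E f (γ t)) (velocity γ t) :=
    ⟨_, (hf.hasMFDerivAt.comp_hasMFDerivWithinAt t h2).hasFDerivWithinAt,
      (inner_grad f (γ t) (velocity γ t)).symm⟩
  rw [← hA1]
  exact hA.hasDerivWithinAt

variable {X : Set M}

/-- The quadratic upper bound for an `L`-smooth function along a minimizing geodesic. -/
theorem LSmoothOn.le_along_minGeodesic [IsRiemannianManifold 𝓘(ℝ, E) M]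
    (hX : GeodesicallyConvex E X) {L : ℝ} (hL : 0 ≤ L) {f : M → ℝ} (hf : LSmoothOn E L X f)
    {x y : M} (hx : x ∈ X) (hy : y ∈ X) {γ : ℝ → M} (hγ : IsMinGeodesic E γ x y)
    (hγX : ∀ s ∈ Icc (0 : ℝ) 1, γ s ∈ X) {t : ℝ} (ht : t ∈ Icc (0 : ℝ) 1) :
    f (γ t) ≤ f x + t * inner ℝ (grad E f x) (expInv E x y)
      + L * t ^ 2 / 2 * dist x y ^ 2 := by
  obtain ⟨rfl, rfl⟩ : γ 0 = x ∧ γ 1 = y := ⟨hγ.2.1, hγ.2.2.1⟩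
  have hexp := vector_eq_of_mk_eq (expInv_spec hX hx hy hγ)
  rw [← hexp]
  set c : ℝ := inner ℝ (grad E f (γ 0)) (velocity γ 0)
  set d := dist (γ 0) (γ 1)
  have hslope : ∀ s ∈ Icc (0 : ℝ) 1,
      inner ℝ (grad E f (γ s)) (velocity γ s) ≤ c + L * s * d ^ 2 := by
    intro s hs
    obtain ⟨W, hW, hW0⟩ := exists_isParallelAlong hγ.1.1 (grad E f (γ 0))
    have hmk : ∀ r r', r = r' → (⟨γ r, W r⟩ : TangentBundle 𝓘(ℝ, E) M) = ⟨γ r', W r'⟩ := by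
      rintro r _ rfl
      rfl
    -- Since the initial piece of `γ` is minimizing, transport from `γ 0` to `γ s` runs along `γ`,
    -- and its value is `W s`.
    have h1 := transport_spec (v := grad E f (γ 0)) hX hx (hγX s hs) (hγ.restrict hs.1 hs.2)
      (hW.restrict hs.1 hs.2) ((hmk _ _ (mul_zero s)).trans (by rw [hW0]))
    have h2 : W s = transport (γ 0) (γ s) (grad E f (γ 0)) :=
      vector_eq_of_mk_eq ((hmk _ _ (mul_one s)).symm.trans h1)
    -- `W` and the velocity are both parallel, so their inner product keeps its initial value; only
    -- `grad f - W` changes the slope.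
    have h3 : (inner ℝ (W s) (velocity γ s) : ℝ) = c := by
      rw [inner_parallel_eq hγ.1.1.continuousOn hW hγ.1.2 hs, hW0]
    have h4 := hf.2 _ hx _ (hγX s hs)
    rw [← h2] at h4
    have h5 : dist (γ 0) (γ s) ≤ s * d := by
      have := hγ.1.dist_le le_rfl hs.1 hs.2
      rwa [hγ.2.2.2, sub_zero] at this
    have h6 := real_inner_le_norm (grad E f (γ s) - W s) (velocity γ s)
    rw [inner_sub_left, h3, hγ.1.norm_velocity hs, hγ.2.2.2] at h6
    have h7 : ‖grad E f (γ s) - W s‖ * d ≤ L * (s * d) * d :=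
      mul_le_mul_of_nonneg_right (h4.trans (mul_le_mul_of_nonneg_left h5 hL)) dist_nonneg
    calc inner ℝ (grad E f (γ s)) (velocity γ s) ≤ c + ‖grad E f (γ s) - W s‖ * d := by linarith
      _ ≤ c + L * s * d ^ 2 := by linarith
  have hder : ∀ s ∈ Icc (0 : ℝ) 1, HasDerivWithinAt
      (fun s => f (γ s) - (s * c + L * s ^ 2 / 2 * d ^ 2))
      (inner ℝ (grad E f (γ s)) (velocity γ s) - (c + L * s * d ^ 2)) (Icc 0 1) s := by
    intro s hs
    refine (hasDerivWithinAt_comp_curve hγ.1.1 hs (hf.1 _ (hγX s hs))).sub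
      (HasDerivAt.hasDerivWithinAt ?_)
    have h1 : HasDerivAt (fun s : ℝ => s * c) c s := by simpa using (hasDerivAt_id s).mul_const c
    have h2 : HasDerivAt (fun s : ℝ => L * s ^ 2 / 2 * d ^ 2) (L * s * d ^ 2) s := by
      have := (((hasDerivAt_pow 2 s).const_mul L).div_const 2).mul_const (d ^ 2)
      refine this.congr_deriv ?_
      simp only [Nat.cast_ofNat, Nat.add_one_sub_one, pow_one]
      ring
    exact h1.add h2
  have hanti : AntitoneOn (fun s => f (γ s) - (s * c + L * s ^ 2 / 2 * d ^ 2)) (Icc 0 1) :=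
    antitoneOn_of_hasDerivWithinAt_nonpos (convex_Icc 0 1)
      (fun s hs => (hder s hs).continuousWithinAt)
      (fun s hs => (hder s (interior_subset hs)).mono interior_subset)
      (fun s hs => sub_nonpos.2 (hslope s (interior_subset hs)))
  have := hanti (left_mem_Icc.2 zero_le_one) ht ht.1
  simp only [zero_mul] at this
  norm_num at this
  linarith

theorem LSmoothOn.le_along_geod [IsRiemannianManifold 𝓘(ℝ, E) M] (hX : GeodesicallyConvex E X)
    {L : ℝ} (hL : 0 ≤ L) {f : M → ℝ} (hf : LSmoothOn E L X f) {x y : M} (hx : x ∈ X) (hy : y ∈ X)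
    {t : ℝ} (ht : t ∈ Icc (0 : ℝ) 1) :
    f (geod E x y t) ≤ f x + t * inner ℝ (grad E f x) (expInv E x y)
      + L * t ^ 2 / 2 * dist x y ^ 2 :=
  hf.le_along_minGeodesic hX hL hx hy (geod_spec hX hx hy).1 (geod_spec hX hx hy).2 ht


end Geodesic

/-! ### A measurable frame of the tangent bundle. -/

/-- Continuous local formulas, selected by a measurable index with countably many values, make a
measurable map. This replaces a global continuous frame, which need not exist. -/
theorem measurable_of_continuousOn_pieces {α β : Type*} [TopologicalSpace α] [MeasurableSpace α]
    [OpensMeasurableSpace α] [TopologicalSpace β] [MeasurableSpace β] [BorelSpace β] {f : α → β}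
    {idx : α → ℕ} (hidx : Measurable idx) {O : ℕ → Set α} (hO : ∀ n, IsOpen (O n)) {F : ℕ → α → β}
    (hF : ∀ n, ContinuousOn (F n) (O n)) (hmem : ∀ a, a ∈ O (idx a))
    (hf : ∀ a, f a = F (idx a) a) : Measurable f := by
  refine measurable_of_isOpen fun U hU => ?_
  have h : f ⁻¹' U = ⋃ n, idx ⁻¹' {n} ∩ (O n ∩ F n ⁻¹' U) := by
    ext a
    simp only [mem_preimage, mem_iUnion, mem_inter_iff, mem_singleton_iff]
    constructor
    · intro ha
      exact ⟨idx a, rfl, hmem a, by rwa [← hf]⟩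
    · rintro ⟨n, rfl, -, ha⟩
      rwa [hf]
  rw [h]
  exact MeasurableSet.iUnion fun n => (hidx (measurableSet_singleton n)).inter
    ((hF n).isOpen_inter_preimage (hO n) hU).measurableSet

section Frame

variable {E : Type*} [NormedAddCommGroup E] [NormedSpace ℝ E]
  {M : Type*} [MetricSpace M] [ChartedSpace E M]

section Index

variable [SecondCountableTopology M] [Nonempty M]

variable (E M) in
theorem exists_chart_cover : ∃ p : ℕ → M, ∀ x, ∃ n, x ∈ (chartAt E (p n)).source := by
  obtain ⟨s, hs, hcov⟩ := TopologicalSpace.countable_cover_nhds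
    (f := fun x : M => (chartAt E x).source)
    fun x => (chartAt E x).open_source.mem_nhds (mem_chart_source E x)
  have hne : s.Nonempty := by
    by_contra h
    rw [not_nonempty_iff_eq_empty] at h
    have : (Classical.arbitrary M) ∈ ⋃ x ∈ s, (chartAt E x).source := hcov ▸ mem_univ _
    simp [h] at this
  obtain ⟨p, rfl⟩ := hs.exists_eq_range hne
  refine ⟨p, fun x => ?_⟩
  have : x ∈ ⋃ y ∈ range p, (chartAt E y).source := hcov ▸ mem_univ x
  simpa using this

variable (E M) in
/-- Centres of countably many charts that cover the manifold. -/
def chartCentre : ℕ → M := (exists_chart_cover E M).choose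

variable (E) in
/-- The least index of a chart of the countable cover around `x`. -/
def chartIndex (x : M) : ℕ :=
  @Nat.find _ (Classical.decPred _) ((exists_chart_cover E M).choose_spec x)

theorem mem_source_chartIndex (x : M) : x ∈ (chartAt E (chartCentre E M (chartIndex E x))).source :=
  @Nat.find_spec _ (Classical.decPred _) ((exists_chart_cover E M).choose_spec x)

theorem measurable_chartIndex [MeasurableSpace M] [BorelSpace M] :
    Measurable (chartIndex E : M → ℕ) := by
  exact @measurable_find _ _ _ (fun _ => Classical.decPred _) _ fun n => (chartAt E (chartCentre E M n)).open_source.measurableSet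

end Index

variable [IsManifold 𝓘(ℝ, E) ∞ M]

/-- The trivialization of the tangent bundle over the chart at `p`. -/
abbrev tangentTriv (p : M) :
    Trivialization E (TotalSpace.proj : TangentBundle 𝓘(ℝ, E) M → M) :=
  trivializationAt E (TangentSpace 𝓘(ℝ, E)) p

variable [SecondCountableTopology M] [Nonempty M]

/-- The frame at `x` in the chart of the countable cover chosen around `x`. -/
def frame (x : M) : TangentSpace 𝓘(ℝ, E) x ≃L[ℝ] E :=
  (tangentTriv (chartCentre E M (chartIndex E x))).continuousLinearEquivAt ℝ x
    (mem_source_chartIndex x)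

variable [MeasurableSpace M] [BorelSpace M] [MeasurableSpace E] [BorelSpace E]

theorem measurable_frame :
    Measurable (fun z : TangentBundle 𝓘(ℝ, E) M => frame z.proj z.snd) := by
  have hproj : Continuous (TotalSpace.proj : TangentBundle 𝓘(ℝ, E) M → M) :=
    FiberBundle.continuous_proj E _
  exact measurable_of_continuousOn_pieces (idx := fun z => chartIndex E z.proj)
    (measurable_chartIndex.comp hproj.measurable)
    (O := fun n => TotalSpace.proj ⁻¹' (chartAt E (chartCentre E M n)).source)
    (fun n => (chartAt E (chartCentre E M n)).open_source.preimage hproj)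
    (F := fun n z => (tangentTriv (chartCentre E M n) z).2)
    (fun n => continuous_snd.comp_continuousOn
      ((tangentTriv (chartCentre E M n)).continuousOn.mono fun z hz =>
        (tangentTriv (chartCentre E M n)).mem_source.2 hz))
    (fun z => mem_source_chartIndex z.proj)
    (fun z => rfl)

variable [FiniteDimensional ℝ E]

theorem measurable_frame_symm :
    Measurable (fun q : M × E => (⟨q.1, frame q.1 |>.symm q.2⟩ : TangentBundle 𝓘(ℝ, E) M)) := by
  have : ProperSpace E := FiniteDimensional.proper ℝ E
  exact measurable_of_continuousOn_pieces (idx := fun q : M × E => chartIndex E q.1)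
    (measurable_chartIndex.comp measurable_fst)
    (O := fun n => (chartAt E (chartCentre E M n)).source ×ˢ univ)
    (fun n => (chartAt E (chartCentre E M n)).open_source.prod isOpen_univ)
    (F := fun n q => (tangentTriv (chartCentre E M n)).toOpenPartialHomeomorph.symm q)
    (fun n => (tangentTriv (chartCentre E M n)).toOpenPartialHomeomorph.continuousOn_symm.mono
      fun q hq => (tangentTriv (chartCentre E M n)).mem_target.2 hq.1)
    (fun q => ⟨mem_source_chartIndex q.1, mem_univ _⟩)
    (fun q => ((tangentTriv (chartCentre E M _)).symm_apply_eq_mk_continuousLinearEquivAt_symm q.1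
      (mem_source_chartIndex q.1) q.2).symm)

theorem frame_symm_eq (x : M) (a : E) :
    (frame x).symm a = (tangentTriv (chartCentre E M (chartIndex E x))).symmL ℝ x a :=
  congrFun (Trivialization.symm_continuousLinearEquivAt_eq _ (mem_source_chartIndex x)) a

attribute [irreducible] frame chartIndex chartCentre

/-- Measurability of a vector field along `x` becomes measurability of a map into the fixed space
`E`, where sums, multiples and integrals are available. -/
theorem measurable_mk_iff {α : Type*} [MeasurableSpace α] {x : α → M}
    {v : ∀ a, TangentSpace 𝓘(ℝ, E) (x a)} :
    Measurable (fun a => (⟨x a, v a⟩ : TangentBundle 𝓘(ℝ, E) M)) ↔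
      Measurable x ∧ Measurable (fun a => frame (x a) (v a)) := by
  constructor
  · intro h
    have hproj : Continuous (TotalSpace.proj : TangentBundle 𝓘(ℝ, E) M → M) :=
      FiberBundle.continuous_proj E _
    have h1 := hproj.measurable.comp h
    have h2 := measurable_frame.comp h
    exact ⟨h1, h2⟩
  · rintro ⟨h1, h2⟩
    have h3 : (fun a => (⟨x a, v a⟩ : TangentBundle 𝓘(ℝ, E) M)) =
        fun a => ⟨x a, (frame (x a)).symm (frame (x a) (v a))⟩ := by
      funext a
      rw [ContinuousLinearEquiv.symm_apply_apply]
    rw [h3]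
    exact measurable_frame_symm.comp (h1.prodMk h2)

end Frame

/-! ### Measurable operations on vectors at varying base points. -/

section MeasurableFields

variable {E : Type*} [NormedAddCommGroup E] [NormedSpace ℝ E] [FiniteDimensional ℝ E]
  {M : Type*} [MetricSpace M] [SecondCountableTopology M] [MeasurableSpace M] [BorelSpace M]
  [ChartedSpace E M] [IsManifold 𝓘(ℝ, E) ∞ M]
  {α : Type*} [MeasurableSpace α] {x : α → M}

section Linear

variable {v w : ∀ a, TangentSpace 𝓘(ℝ, E) (x a)}

theorem measurable_base_of_mk (hv : Measurable fun a => (⟨x a, v a⟩ : TangentBundle 𝓘(ℝ, E) M)) :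
    Measurable x := by
  have hproj : Continuous (TotalSpace.proj : TangentBundle 𝓘(ℝ, E) M → M) :=
    FiberBundle.continuous_proj E _
  exact hproj.measurable.comp hv

theorem measurable_mk_add_smul
    (hv : Measurable fun a => (⟨x a, v a⟩ : TangentBundle 𝓘(ℝ, E) M))
    (hw : Measurable fun a => (⟨x a, w a⟩ : TangentBundle 𝓘(ℝ, E) M))
    {c : α → ℝ} (hc : Measurable c) :
    Measurable fun a => (⟨x a, v a + c a • w a⟩ : TangentBundle 𝓘(ℝ, E) M) := by
  rcases isEmpty_or_nonempty M with hM | hM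
  · have : IsEmpty α := ⟨fun a => hM.elim (x a)⟩
    exact measurable_of_empty _
  borelize E
  have : ProperSpace E := FiniteDimensional.proper ℝ E
  rw [measurable_mk_iff] at hv hw ⊢
  refine ⟨hv.1, ?_⟩
  simp only [map_add, map_smul]
  exact hv.2.add (hc.smul hw.2)

theorem measurable_mk_zero (hx : Measurable x) :
    Measurable fun a => (⟨x a, 0⟩ : TangentBundle 𝓘(ℝ, E) M) := by
  rcases isEmpty_or_nonempty M with hM | hM
  · have : IsEmpty α := ⟨fun a => hM.elim (x a)⟩
    exact measurable_of_empty _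
  borelize E
  rw [measurable_mk_iff]
  refine ⟨hx, ?_⟩
  simp only [map_zero]
  exact measurable_const

theorem measurable_mk_sub
    (hv : Measurable fun a => (⟨x a, v a⟩ : TangentBundle 𝓘(ℝ, E) M))
    (hw : Measurable fun a => (⟨x a, w a⟩ : TangentBundle 𝓘(ℝ, E) M)) :
    Measurable fun a => (⟨x a, v a - w a⟩ : TangentBundle 𝓘(ℝ, E) M) := by
  have := measurable_mk_add_smul hv hw (c := fun _ => -1) measurable_const
  simpa only [neg_smul, one_smul, ← sub_eq_add_neg] using this

theorem measurable_mk_smul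
    (hv : Measurable fun a => (⟨x a, v a⟩ : TangentBundle 𝓘(ℝ, E) M))
    {c : α → ℝ} (hc : Measurable c) :
    Measurable fun a => (⟨x a, c a • v a⟩ : TangentBundle 𝓘(ℝ, E) M) := by
  have := measurable_mk_add_smul (measurable_mk_zero (measurable_base_of_mk hv)) hv hc
  simpa only [zero_add] using this

theorem measurable_mk_list_sum (hx : Measurable x) {ι : Type*} (l : List ι)
    {v : ι → ∀ a, TangentSpace 𝓘(ℝ, E) (x a)}
    (hv : ∀ i, Measurable fun a => (⟨x a, v i a⟩ : TangentBundle 𝓘(ℝ, E) M)) :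
    Measurable fun a => (⟨x a, (l.map fun i => v i a).sum⟩ : TangentBundle 𝓘(ℝ, E) M) := by
  induction l with
  | nil => simpa using measurable_mk_zero hx
  | cons i l ih =>
    have := measurable_mk_add_smul (hv i) ih (c := fun _ => 1) measurable_const
    simpa only [one_smul, List.map_cons, List.sum_cons] using this

end Linear

variable [RiemannianBundle (fun x : M => TangentSpace 𝓘(ℝ, E) x)]

theorem stronglyMeasurable_of_mk {x : M} {v : α → TangentSpace 𝓘(ℝ, E) x}
    (hv : Measurable fun a => (⟨x, v a⟩ : TangentBundle 𝓘(ℝ, E) M)) : StronglyMeasurable v := by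
  have : Nonempty M := ⟨x⟩
  borelize E
  have : ProperSpace E := FiniteDimensional.proper ℝ E
  have h1 := (measurable_mk_iff (x := fun _ => x)).1 hv
  have h2 := (frame x).symm.continuous.comp_stronglyMeasurable h1.2.stronglyMeasurable
  simpa [Function.comp_def] using h2

/-- The frame is a linear isomorphism on each fibre and commutes with the integral. This yields
measurability of `grad Φ` from that of the sampled gradients. -/
theorem measurable_mk_integral {β : Type*} [MeasurableSpace β] {P : Measure β} [SFinite P]
    {v : ∀ a, β → TangentSpace 𝓘(ℝ, E) (x a)} (hx : Measurable x)
    (hv : Measurable fun q : α × β => (⟨x q.1, v q.1 q.2⟩ : TangentBundle 𝓘(ℝ, E) M)) :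
    Measurable fun a => (⟨x a, ∫ b, v a b ∂P⟩ : TangentBundle 𝓘(ℝ, E) M) := by
  rcases isEmpty_or_nonempty M with hM | hM
  · have : IsEmpty α := ⟨fun a => hM.elim (x a)⟩
    exact measurable_of_empty _
  borelize E
  have : ProperSpace E := FiniteDimensional.proper ℝ E
  rw [measurable_mk_iff]
  refine ⟨hx, ?_⟩
  have h := ((measurable_mk_iff (x := fun q : α × β => x q.1)).1 hv).2
  have h2 := h.stronglyMeasurable.integral_prod_right' (ν := P)
  simp only [← ContinuousLinearEquiv.integral_comp_comm]
  exact h2.measurable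

variable [IsContMDiffRiemannianBundle 𝓘(ℝ, E) ∞ E (fun x : M => TangentSpace 𝓘(ℝ, E) x)]

variable (E M) in
theorem isContinuousRiemannianBundle_tangent :
    IsContinuousRiemannianBundle E (fun x : M => TangentSpace 𝓘(ℝ, E) x) := by
  obtain ⟨g, hg, hg'⟩ := IsContMDiffRiemannianBundle.exists_contMDiff (IB := 𝓘(ℝ, E)) (n := ∞)
    (F := E) (E := fun x : M => TangentSpace 𝓘(ℝ, E) x)
  exact ⟨g, hg.continuous, hg'⟩

theorem measurable_inner_mk {v w : ∀ a, TangentSpace 𝓘(ℝ, E) (x a)}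
    (hv : Measurable fun a => (⟨x a, v a⟩ : TangentBundle 𝓘(ℝ, E) M))
    (hw : Measurable fun a => (⟨x a, w a⟩ : TangentBundle 𝓘(ℝ, E) M)) :
    Measurable fun a => (inner ℝ (v a) (w a) : ℝ) := by
  rcases isEmpty_or_nonempty M with hM | hM
  · have : IsEmpty α := ⟨fun a => hM.elim (x a)⟩
    exact measurable_of_empty _
  borelize E
  have : ProperSpace E := FiniteDimensional.proper ℝ E
  have := isContinuousRiemannianBundle_tangent E M
  have key : Measurable fun q : M × E × E =>
      (inner ℝ ((frame q.1).symm q.2.1) ((frame q.1).symm q.2.2) : ℝ) := by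
    have hsymm : ∀ (n : ℕ) (g : M × E × E → E), Continuous g → ContinuousOn
        (fun q : M × E × E => (⟨q.1, (tangentTriv (chartCentre E M n)).symmL ℝ q.1 (g q)⟩ :
          TangentBundle 𝓘(ℝ, E) M)) ((chartAt E (chartCentre E M n)).source ×ˢ univ) := by
      intro n g hg
      refine ((tangentTriv (chartCentre E M n)).toOpenPartialHomeomorph.continuousOn_symm.comp
        (continuous_fst.prodMk hg).continuousOn fun q hq =>
          (tangentTriv (chartCentre E M n)).mem_target.2 hq.1).congr fun q hq => ?_
      rw [Trivialization.symmL_apply _ hq.1, Trivialization.mk_symm _ hq.1]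
      rfl
    refine measurable_of_continuousOn_pieces (idx := fun q : M × E × E => chartIndex E q.1)
      (measurable_chartIndex.comp measurable_fst)
      (O := fun n => (chartAt E (chartCentre E M n)).source ×ˢ univ)
      (fun n => (chartAt E (chartCentre E M n)).open_source.prod isOpen_univ)
      (F := fun n q => inner ℝ ((tangentTriv (chartCentre E M n)).symmL ℝ q.1 q.2.1)
        ((tangentTriv (chartCentre E M n)).symmL ℝ q.1 q.2.2))
      (fun n => ContinuousOn.inner_bundle (F := E) (E := fun x : M => TangentSpace 𝓘(ℝ, E) x)
        (b := fun q : M × E × E => q.1)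
        (hsymm n _ continuous_snd.fst) (hsymm n _ continuous_snd.snd))
      (fun q => ⟨mem_source_chartIndex q.1, mem_univ _⟩) (fun q => ?_)
    rw [frame_symm_eq, frame_symm_eq]
  rw [measurable_mk_iff] at hv hw
  have := key.comp (hv.1.prodMk (hv.2.prodMk hw.2))
  simpa only [Function.comp_def, ContinuousLinearEquiv.symm_apply_apply] using this

theorem measurable_norm_mk {v : ∀ a, TangentSpace 𝓘(ℝ, E) (x a)}
    (hv : Measurable fun a => (⟨x a, v a⟩ : TangentBundle 𝓘(ℝ, E) M)) :
    Measurable fun a => ‖v a‖ := by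
  simp only [norm_eq_sqrt_real_inner]
  exact (measurable_inner_mk hv hv).sqrt

end MeasurableFields

/-! ### Independence and the variance of sample averages. -/

section Sampling

/-- Serves as conditioning on the past: with `U` the state before an iteration, the inner integral
averages over fresh samples with the state frozen. -/
theorem lintegral_comp_indepFun {Ω α β : Type*} [MeasurableSpace Ω] [MeasurableSpace α]
    [MeasurableSpace β] {μ : Measure Ω} [IsProbabilityMeasure μ] {U : Ω → α} {S : Ω → β}
    (hU : Measurable U) (hS : Measurable S) (hind : IndepFun U S μ) {G : α × β → ℝ≥0∞}
    (hG : Measurable G) :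
    ∫⁻ w, G (U w, S w) ∂μ = ∫⁻ w, ∫⁻ w', G (U w, S w') ∂μ ∂μ := by
  have h := (indepFun_iff_map_prod_eq_prod_map_map hU.aemeasurable hS.aemeasurable).1 hind
  calc ∫⁻ w, G (U w, S w) ∂μ = ∫⁻ q, G q ∂(μ.map fun w => (U w, S w)) :=
        (lintegral_map hG (hU.prodMk hS)).symm
    _ = ∫⁻ a, ∫⁻ b, G (a, b) ∂(μ.map S) ∂(μ.map U) := by
        rw [h]
        have := Measure.isProbabilityMeasure_map (μ := μ) hS.aemeasurable
        exact lintegral_prod _ hG.aemeasurable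
    _ = ∫⁻ w, ∫⁻ b, G (U w, b) ∂(μ.map S) ∂μ := by
        have := Measure.isProbabilityMeasure_map (μ := μ) hS.aemeasurable
        exact lintegral_map hG.lintegral_prod_right' hU
    _ = _ := by
        refine lintegral_congr fun w => ?_
        exact lintegral_map (hG.comp measurable_prodMk_left) hS

variable {Ω Ξ : Type*} [MeasurableSpace Ω] [MeasurableSpace Ξ] {μ : Measure Ω}
  [IsProbabilityMeasure μ] {P : Measure Ξ} [IsProbabilityMeasure P]
  {T : Type*} [NormedAddCommGroup T] [InnerProductSpace ℝ T] [CompleteSpace T]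

/-- Independent centred vectors are orthogonal in `L²`: integrating one variable first already gives
zero. -/
theorem integral_inner_comp_indepFun {s t : Ω → Ξ} (hs : Measurable s) (ht : Measurable t)
    (hPs : μ.map s = P) (hPt : μ.map t = P) (hind : IndepFun s t μ) {y : Ξ → T}
    (hy : StronglyMeasurable y) (hint : Integrable y P) (h0 : ∫ ξ, y ξ ∂P = 0) :
    ∫ w, inner ℝ (y (s w)) (y (t w)) ∂μ = 0 := by
  have h := (indepFun_iff_map_prod_eq_prod_map_map hs.aemeasurable ht.aemeasurable).1 hind
  have hm : StronglyMeasurable fun q : Ξ × Ξ => (inner ℝ (y q.1) (y q.2) : ℝ) :=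
    (hy.comp_measurable measurable_fst).inner (hy.comp_measurable measurable_snd)
  have hi : Integrable (fun q : Ξ × Ξ => (inner ℝ (y q.1) (y q.2) : ℝ)) (P.prod P) := by
    refine (hint.norm.mul_prod hint.norm).mono hm.aestronglyMeasurable ?_
    refine Filter.Eventually.of_forall fun q => ?_
    rw [norm_mul, norm_norm, norm_norm]
    exact norm_inner_le_norm _ _
  calc ∫ w, inner ℝ (y (s w)) (y (t w)) ∂μ
      = ∫ q, inner ℝ (y q.1) (y q.2) ∂(μ.map fun w => (s w, t w)) :=
        (integral_map (hs.prodMk ht).aemeasurable hm.aestronglyMeasurable).symm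
    _ = ∫ a, ∫ b, inner ℝ (y a) (y b) ∂P ∂P := by
        rw [h, hPs, hPt, integral_prod _ hi]
    _ = 0 := by
        simp_rw [integral_inner hint, h0, inner_zero_right, integral_zero]

/-- Variance of an average of `N` independent samples around a shifted mean. -/
theorem lintegral_norm_sq_average_le {s : ℕ → Ω → Ξ} (hs : ∀ i, Measurable (s i))
    (hP : ∀ i, μ.map (s i) = P) (hind : iIndepFun s μ) {y : Ξ → T} (hy : StronglyMeasurable y)
    {c : ℝ} (hc : ∀ᵐ ξ ∂P, ‖y ξ‖ ≤ c) (b : T) {N : ℕ} (hN : N ≠ 0) :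
    ∫⁻ w, ENNReal.ofReal
      (‖(N : ℝ)⁻¹ • ∑ i ∈ Finset.range N, y (s i w) - ∫ ξ, y ξ ∂P + b‖ ^ 2) ∂μ
      ≤ ENNReal.ofReal (‖b‖ ^ 2 + c ^ 2 / N) := by
  have hint : Integrable y P := Integrable.of_bound hy.aestronglyMeasurable c hc
  set m := ∫ ξ, y ξ ∂P with hm
  set z : Ξ → T := fun ξ => y ξ - m with hz
  have hzm : StronglyMeasurable z := hy.sub stronglyMeasurable_const
  have hzi : Integrable z P := hint.sub (integrable_const m)
  have hz0 : ∫ ξ, z ξ ∂P = 0 := by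
    rw [hz, integral_sub hint (integrable_const m), ← hm]
    simp
  have hzb : ∀ᵐ ξ ∂P, ‖z ξ‖ ≤ c + ‖m‖ := by
    filter_upwards [hc] with ξ hξ
    exact (norm_sub_le _ _).trans (by gcongr)
  have hym : Integrable (fun ξ => ‖y ξ‖ ^ 2) P :=
    Integrable.of_bound (C := c ^ 2) (hy.norm.pow 2).aestronglyMeasurable (by
      filter_upwards [hc] with ξ hξ
      rw [Real.norm_of_nonneg (by positivity)]
      gcongr)
  -- The variance is the second moment minus `‖m‖²`, so centring does not spoil the bound `c²`.
  have hzsq : ∫ ξ, ‖z ξ‖ ^ 2 ∂P ≤ c ^ 2 := by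
    have h1 : ∀ ξ, ‖z ξ‖ ^ 2 = ‖y ξ‖ ^ 2 - 2 * inner ℝ m (y ξ) + ‖m‖ ^ 2 := fun ξ => by
      rw [hz, norm_sub_sq_real, real_inner_comm]
    have h2 : Integrable (fun ξ => (2 : ℝ) * inner ℝ m (y ξ)) P := (hint.const_inner m).const_mul 2
    have h3 : ∫ ξ, ‖y ξ‖ ^ 2 ∂P ≤ c ^ 2 := by
      have := integral_mono_ae hym (integrable_const (c ^ 2)) (by
        filter_upwards [hc] with ξ hξ
        show ‖y ξ‖ ^ 2 ≤ c ^ 2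
        gcongr)
      simpa using this
    have h4 : Integrable (fun ξ => ‖y ξ‖ ^ 2 - 2 * inner ℝ m (y ξ)) P := hym.sub h2
    simp_rw [h1]
    rw [integral_add h4 (integrable_const _), integral_sub hym h2, integral_const_mul,
      integral_inner hint, ← hm, real_inner_self_eq_norm_sq]
    simp only [integral_const, probReal_univ, one_smul]
    nlinarith [sq_nonneg ‖m‖]
  have hZm : ∀ i, StronglyMeasurable fun w => z (s i w) := fun i => hzm.comp_measurable (hs i)
  have hZi : ∀ i, Integrable (fun w => z (s i w)) μ := fun i =>
    ((hP i).symm ▸ hzi : Integrable z (μ.map (s i))).comp_measurable (hs i)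
  have hZ0 : ∀ i, ∫ w, z (s i w) ∂μ = 0 := fun i => by
    rw [← integral_map (f := z) (hs i).aemeasurable hzm.aestronglyMeasurable, hP i, hz0]
  have hZsq : ∀ i, ∫ w, ‖z (s i w)‖ ^ 2 ∂μ ≤ c ^ 2 := fun i => by
    rw [← integral_map (f := fun ξ => ‖z ξ‖ ^ 2) (hs i).aemeasurable
      (hzm.norm.pow 2).aestronglyMeasurable, hP i]
    exact hzsq
  have hZb : ∀ i, ∀ᵐ w ∂μ, ‖z (s i w)‖ ≤ c + ‖m‖ := fun i =>
    ae_of_ae_map (hs i).aemeasurable (p := fun ξ => ‖z ξ‖ ≤ c + ‖m‖) ((hP i).symm ▸ hzb)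
  have hZZ : ∀ i j, Integrable (fun w => (inner ℝ (z (s i w)) (z (s j w)) : ℝ)) μ := fun i j => by
    refine Integrable.of_bound (C := (c + ‖m‖) * (c + ‖m‖))
      ((hZm i).inner (hZm j)).aestronglyMeasurable ?_
    filter_upwards [hZb i, hZb j] with w h1 h2
    exact (norm_inner_le_norm _ _).trans
      (mul_le_mul h1 h2 (norm_nonneg _) ((norm_nonneg _).trans h1))
  have hNr : (N : ℝ) ≠ 0 := Nat.cast_ne_zero.2 hN
  -- After integration the linear term vanishes, and only the `N` diagonal terms of the double sum
  -- survive: `N c² / N² = c² / N`.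
  have hexp : ∀ w, ‖(N : ℝ)⁻¹ • ∑ i ∈ Finset.range N, y (s i w) - m + b‖ ^ 2
      = ‖b‖ ^ 2 + 2 * (N : ℝ)⁻¹ * ∑ i ∈ Finset.range N, inner ℝ b (z (s i w))
        + ((N : ℝ)⁻¹) ^ 2 * ∑ i ∈ Finset.range N, ∑ j ∈ Finset.range N,
            inner ℝ (z (s i w)) (z (s j w)) := fun w => by
    have h1 : (N : ℝ)⁻¹ • ∑ i ∈ Finset.range N, y (s i w) - m + b
        = b + (N : ℝ)⁻¹ • ∑ i ∈ Finset.range N, z (s i w) := by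
      simp only [hz, Finset.sum_sub_distrib, Finset.sum_const, Finset.card_range, smul_sub]
      rw [← Nat.cast_smul_eq_nsmul ℝ, smul_smul, inv_mul_cancel₀ hNr, one_smul]
      abel
    rw [h1, norm_add_sq_real, inner_smul_right, inner_sum, norm_smul, mul_pow,
      ← real_inner_self_eq_norm_sq (∑ i ∈ Finset.range N, z (s i w)), sum_inner]
    simp_rw [inner_sum]
    rw [norm_inv, RCLike.norm_natCast]
    ring
  have hA : Integrable (fun w => 2 * (N : ℝ)⁻¹ * ∑ i ∈ Finset.range N,
      (inner ℝ b (z (s i w)) : ℝ)) μ :=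
    (integrable_finsetSum _ fun i _ => (hZi i).const_inner b).const_mul _
  have hB : Integrable (fun w => ((N : ℝ)⁻¹) ^ 2 * ∑ i ∈ Finset.range N,
      ∑ j ∈ Finset.range N, (inner ℝ (z (s i w)) (z (s j w)) : ℝ)) μ :=
    (integrable_finsetSum _ fun i _ => integrable_finsetSum _ fun j _ => hZZ i j).const_mul _
  have hA' : Integrable (fun w => ‖b‖ ^ 2 + 2 * (N : ℝ)⁻¹ * ∑ i ∈ Finset.range N,
      (inner ℝ b (z (s i w)) : ℝ)) μ := (integrable_const _).add hA
  rw [← ofReal_integral_eq_lintegral_ofReal]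
  · refine ENNReal.ofReal_le_ofReal ?_
    simp_rw [hexp]
    rw [integral_add hA' hB, integral_add (integrable_const _) hA,
      integral_const_mul, integral_const_mul,
      integral_finsetSum _ fun i _ => (hZi i).const_inner b,
      integral_finsetSum _ fun i _ => integrable_finsetSum _ fun j _ => hZZ i j]
    have h1 : ∀ i, ∫ w, (inner ℝ b (z (s i w)) : ℝ) ∂μ = 0 := fun i => by
      rw [integral_inner (hZi i), hZ0 i, inner_zero_right]
    have h2 : ∀ i ∈ Finset.range N,
        ∫ w, ∑ j ∈ Finset.range N, (inner ℝ (z (s i w)) (z (s j w)) : ℝ) ∂μ ≤ c ^ 2 := by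
      intro i hi
      rw [integral_finsetSum _ fun j _ => hZZ i j, Finset.sum_eq_single_of_mem i hi fun j _ hj =>
        integral_inner_comp_indepFun (hs i) (hs j) (hP i) (hP j) (hind.indepFun hj.symm) hzm hzi
          hz0]
      simp_rw [real_inner_self_eq_norm_sq]
      exact hZsq i
    simp_rw [h1]
    have h3 := Finset.sum_le_sum h2
    simp only [Finset.sum_const, Finset.card_range, nsmul_eq_mul] at h3
    have h4 := mul_le_mul_of_nonneg_left h3 (sq_nonneg (N : ℝ)⁻¹)
    have h5 : ((N : ℝ)⁻¹) ^ 2 * (N * c ^ 2) = c ^ 2 / N := by field_simp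
    simp only [integral_const, probReal_univ, one_smul, Finset.sum_const_zero, mul_zero, add_zero]
    linarith
  · simp_rw [hexp]
    exact hA'.add hB
  · exact Filter.Eventually.of_forall fun w => by positivity

end Sampling

/-! ### Measurability of batch gradients and of the estimator update. -/

section MeasurableSteps

variable {E : Type*} [NormedAddCommGroup E] [NormedSpace ℝ E] [FiniteDimensional ℝ E]
  {M : Type*} [MetricSpace M] [SecondCountableTopology M] [MeasurableSpace M] [BorelSpace M]
  [ChartedSpace E M] [IsManifold 𝓘(ℝ, E) ∞ M]
  [RiemannianBundle (fun x : M => TangentSpace 𝓘(ℝ, E) x)]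
  {X : Set M} {α : Type*} [MeasurableSpace α] {Ξ : Type*} [MeasurableSpace Ξ] {φ : Ξ → M → ℝ}

theorem MeasurableGrad.comp (hφ : MeasurableGrad E X φ) {x : α → M} (hx : Measurable x)
    (hxX : ∀ a, x a ∈ X) {ξ : α → Ξ} (hξ : Measurable ξ) :
    Measurable fun a => (⟨x a, grad E (φ (ξ a)) (x a)⟩ : TangentBundle 𝓘(ℝ, E) M) :=
  Measurable.comp (g := fun q : X × Ξ => (⟨q.1, grad E (φ q.2) q.1⟩ : TangentBundle 𝓘(ℝ, E) M)) hφ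
    ((hx.subtype_mk (h := hxX)).prodMk hξ)

theorem MeasurableTransport.comp (hΓ : MeasurableTransport E X) {x y : α → M}
    {v : ∀ a, TangentSpace 𝓘(ℝ, E) (x a)}
    (hv : Measurable fun a => (⟨x a, v a⟩ : TangentBundle 𝓘(ℝ, E) M)) (hy : Measurable y)
    (hxX : ∀ a, x a ∈ X) (hyX : ∀ a, y a ∈ X) :
    Measurable fun a => (⟨y a, transport (x a) (y a) (v a)⟩ : TangentBundle 𝓘(ℝ, E) M) :=
  Measurable.comp (g := fun q : {v : TangentBundle 𝓘(ℝ, E) M // v.proj ∈ X} × X =>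
    (⟨q.2, transport q.1.1.proj q.2 q.1.1.snd⟩ : TangentBundle 𝓘(ℝ, E) M)) hΓ
    ((hv.subtype_mk (h := hxX)).prodMk (hy.subtype_mk (h := hyX)))

/-- The random batch size takes countably many values, so it is enough to treat each fixed size. -/
theorem MeasurableGrad.batchGrad_firstSamples (hφ : MeasurableGrad E X φ) {x : α → M}
    (hx : Measurable x) (hxX : ∀ a, x a ∈ X) {s : α → ℕ → Ξ} (hs : Measurable s) {N : α → ℕ}
    (hN : Measurable N) :
    Measurable fun a =>
      (⟨x a, batchGrad E φ (firstSamples (N a) (s a)) (x a)⟩ : TangentBundle 𝓘(ℝ, E) M) := by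
  have key : ∀ n, Measurable fun a =>
      (⟨x a, batchGrad E φ (firstSamples n (s a)) (x a)⟩ : TangentBundle 𝓘(ℝ, E) M) := by
    intro n
    have := measurable_mk_smul (measurable_mk_list_sum hx (List.range n) fun i =>
      hφ.comp hx hxX ((measurable_pi_apply i).comp hs)) (c := fun _ => (n : ℝ)⁻¹) measurable_const
    simpa [batchGrad, firstSamples, Function.comp_def] using this
  have h2 : Measurable fun p : ℕ × α =>
      (⟨x p.2, batchGrad E φ (firstSamples p.1 (s p.2)) (x p.2)⟩ : TangentBundle 𝓘(ℝ, E) M) :=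
    measurable_from_prod_countable_right key
  exact h2.comp (hN.prodMk measurable_id)

theorem MeasurableGrad.batchGrad_const (hφ : MeasurableGrad E X φ) {x : α → M}
    (hx : Measurable x) (hxX : ∀ a, x a ∈ X) (S : List Ξ) :
    Measurable fun a => (⟨x a, batchGrad E φ S (x a)⟩ : TangentBundle 𝓘(ℝ, E) M) :=
  measurable_mk_smul (measurable_mk_list_sum hx S fun _ => hφ.comp hx hxX measurable_const)
    measurable_const

theorem MeasurableGrad.of_integral (hφ : MeasurableGrad E X φ) {x : α → M}
    (hx : Measurable x) (hxX : ∀ a, x a ∈ X) {P : Measure Ξ} [IsProbabilityMeasure P] {Φ : M → ℝ}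
    (hΦ : ∀ x ∈ X, ∫ ξ, grad E (φ ξ) x ∂P = grad E Φ x) :
    Measurable fun a => (⟨x a, grad E Φ (x a)⟩ : TangentBundle 𝓘(ℝ, E) M) := by
  have := measurable_mk_integral (P := P) (v := fun a ξ => grad E (φ ξ) (x a)) hx
    (hφ.comp (hx.comp measurable_fst) (fun q => hxX q.1) measurable_snd)
  simpa only [hΦ _ (hxX _)] using this

/-- The rule that forms small batches takes `⌈r⌉` fresh samples, unless `r` lies in a measurable set
of sizes for which a fixed batch with exact gradients of `Φ` is used. -/
def IsSmallBatchRule (E : Type*) [NormedAddCommGroup E] [NormedSpace ℝ E] [FiniteDimensional ℝ E]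
    {M : Type*} [MetricSpace M] [ChartedSpace E M]
    [RiemannianBundle (fun x : M => TangentSpace 𝓘(ℝ, E) x)] {Ξ : Type*}
    (X : Set M) (φ : Ξ → M → ℝ) (Φ : M → ℝ) (smallBatch : ℝ → (ℕ → Ξ) → List Ξ) : Prop :=
  ∃ (T : Set ℝ) (S₀ : List Ξ), MeasurableSet T ∧
    (∀ r ∈ T, (∀ s, smallBatch r s = S₀) ∧ ∀ x ∈ X, batchGrad E φ S₀ x = grad E Φ x) ∧
    ∀ r ∉ T, ∀ s, smallBatch r s = firstSamples ⌈r⌉₊ s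

theorem MeasurableGrad.batchGrad_smallBatch (hφ : MeasurableGrad E X φ) {Φ : M → ℝ}
    {smallBatch : ℝ → (ℕ → Ξ) → List Ξ} (hsb : IsSmallBatchRule E X φ Φ smallBatch) {x : α → M}
    (hx : Measurable x) (hxX : ∀ a, x a ∈ X) {s : α → ℕ → Ξ} (hs : Measurable s) {r : α → ℝ}
    (hr : Measurable r) :
    Measurable fun a =>
      (⟨x a, batchGrad E φ (smallBatch (r a) (s a)) (x a)⟩ : TangentBundle 𝓘(ℝ, E) M) := by
  classical
  obtain ⟨T, S₀, hT, h1, h2⟩ := hsb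
  have := @Measurable.piecewise _ _ (r ⁻¹' T) _ _ _ _ (fun a => Classical.propDecidable _)
    (hr hT)
    (hφ.batchGrad_const hx hxX S₀)
    (hφ.batchGrad_firstSamples hx hxX hs (N := fun a => ⌈r a⌉₊) (Nat.measurable_ceil.comp hr))
  refine (congrArg Measurable (funext fun a => ?_)).mp this
  by_cases ha : a ∈ r ⁻¹' T
  · rw [piecewise_eq_of_mem _ _ _ ha, (h1 (r a) ha).1]
  · rw [piecewise_eq_of_notMem _ _ _ ha, h2 (r a) ha]

/-- The gradient estimate at `y` from the gradient estimate `v` at `x`, with the batch `S`. -/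
def spiderUpdate (φ : Ξ → M → ℝ) (S : List Ξ) (x y : M) (v : TangentSpace 𝓘(ℝ, E) x) :
    TangentSpace 𝓘(ℝ, E) y :=
  batchGrad E φ S y - transport x y (batchGrad E φ S x - v)

theorem measurable_spiderUpdate (hΓ : MeasurableTransport E X) (hφ : MeasurableGrad E X φ)
    {Φ : M → ℝ} {smallBatch : ℝ → (ℕ → Ξ) → List Ξ} (hsb : IsSmallBatchRule E X φ Φ smallBatch)
    {x y : α → M} {v : ∀ a, TangentSpace 𝓘(ℝ, E) (x a)}
    (hv : Measurable fun a => (⟨x a, v a⟩ : TangentBundle 𝓘(ℝ, E) M)) (hy : Measurable y)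
    (hxX : ∀ a, x a ∈ X) (hyX : ∀ a, y a ∈ X) {s : α → ℕ → Ξ} (hs : Measurable s) (c : ℝ) :
    Measurable fun a =>
      (⟨y a, spiderUpdate φ (smallBatch (c * dist (x a) (y a)) (s a)) (x a) (y a) (v a)⟩ :
        TangentBundle 𝓘(ℝ, E) M) := by
  have hx : Measurable x := measurable_base_of_mk hv
  have hr : Measurable fun a => c * dist (x a) (y a) := (hx.dist hy).const_mul c
  exact measurable_mk_sub (hφ.batchGrad_smallBatch hsb hy hyX hs hr)
    (hΓ.comp (measurable_mk_sub (hφ.batchGrad_smallBatch hsb hx hxX hs hr) hv) hy hxX hyX)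

end MeasurableSteps

/-! ### Mean squared error of one estimate with the past frozen. -/

section Variance

variable {E : Type*} [NormedAddCommGroup E] [NormedSpace ℝ E] [FiniteDimensional ℝ E]
  {M : Type*} [MetricSpace M] [SecondCountableTopology M] [MeasurableSpace M] [BorelSpace M]
  [ChartedSpace E M] [IsManifold 𝓘(ℝ, E) ∞ M]
  [RiemannianBundle (fun x : M => TangentSpace 𝓘(ℝ, E) x)]
  [IsContMDiffRiemannianBundle 𝓘(ℝ, E) ∞ E (fun x : M => TangentSpace 𝓘(ℝ, E) x)]
  {X : Set M} {Ξ : Type*} [MeasurableSpace Ξ] {φ : Ξ → M → ℝ}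
  {P : Measure Ξ} [IsProbabilityMeasure P] {Φ : M → ℝ}
  {Ω : Type*} [MeasurableSpace Ω] {μ : Measure Ω} [IsProbabilityMeasure μ] {s : ℕ → Ω → Ξ}

theorem batchGrad_firstSamples_eq (φ : Ξ → M → ℝ) (N : ℕ) (s : ℕ → Ξ) (x : M) :
    batchGrad E φ (firstSamples N s) x
      = (N : ℝ)⁻¹ • ∑ i ∈ Finset.range N, grad E (φ (s i)) x := by
  simp only [batchGrad, firstSamples, List.length_map, List.length_range, List.map_map]
  rfl

theorem lintegral_norm_sq_batchGrad_sub_le (hs : ∀ i, Measurable (s i))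
    (hP : ∀ i, μ.map (s i) = P) (hind : iIndepFun s μ) (hφ : MeasurableGrad E X φ)
    (hΦ : ∀ x ∈ X, ∫ ξ, grad E (φ ξ) x ∂P = grad E Φ x) {C : ℝ}
    (hC : ∀ᵐ ξ ∂P, ∀ x ∈ X, ‖grad E (φ ξ) x‖ ≤ C) {N : ℕ} (hN : N = 0 → C = 0) {x : M}
    (hx : x ∈ X) :
    ∫⁻ w, ENNReal.ofReal (‖batchGrad E φ (firstSamples N fun i => s i w) x - grad E Φ x‖ ^ 2) ∂μ
      ≤ ENNReal.ofReal (C ^ 2 / N) := by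
  have hCx : ∀ᵐ ξ ∂P, ‖grad E (φ ξ) x‖ ≤ C := hC.mono fun ξ h => h x hx
  simp_rw [batchGrad_firstSamples_eq]
  rcases eq_or_ne N 0 with rfl | h0
  -- An empty batch returns `0`. Here `C = 0`, so almost all sampled gradients vanish, hence so does
  -- their mean, and the estimate is exact.
  · have h : grad E Φ x = 0 := by
      rw [← hΦ x hx]
      refine integral_eq_zero_of_ae ?_
      filter_upwards [hCx] with ξ h
      rw [hN rfl] at h
      exact norm_le_zero_iff.1 h
    simp [h]
  · have hy : StronglyMeasurable fun ξ => grad E (φ ξ) x :=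
      stronglyMeasurable_of_mk (hφ.comp measurable_const (fun _ => hx) measurable_id)
    have := lintegral_norm_sq_average_le hs hP hind hy hCx 0 h0
    simpa [hΦ x hx] using this

/-- The error at `y` is `T(v - grad Φ x)` plus a centred average of independent vectors of norm at
most `L d`. The average adds `L²d²/⌈cd⌉ ≤ δd`; a batch size linear in `d` is enough because one
factor `d` is kept. -/
theorem lintegral_norm_sq_spiderUpdate_le (hX : GeodesicallyConvex E X)
    (hs : ∀ i, Measurable (s i)) (hP : ∀ i, μ.map (s i) = P) (hind : iIndepFun s μ) (hφ : MeasurableGrad E X φ)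
    (hΦ : ∀ x ∈ X, ∫ ξ, grad E (φ ξ) x ∂P = grad E Φ x) {C : ℝ}
    (hC : ∀ᵐ ξ ∂P, ∀ x ∈ X, ‖grad E (φ ξ) x‖ ≤ C) {L : ℝ} (hL : ∀ᵐ ξ ∂P, LSmoothOn E L X (φ ξ))
    (hLΦ : LSmoothOn E L X Φ)
    {smallBatch : ℝ → (ℕ → Ξ) → List Ξ} (hsb : IsSmallBatchRule E X φ Φ smallBatch)
    {c δ : ℝ} (hc : 0 ≤ c) (hδ : 0 ≤ δ) (hcδ : L ^ 2 = c * δ) {x y : M} (hx : x ∈ X) (hy : y ∈ X)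
    (v : TangentSpace 𝓘(ℝ, E) x) :
    ∫⁻ w, ENNReal.ofReal (‖spiderUpdate φ (smallBatch (c * dist x y) fun i => s i w) x y v
        - grad E Φ y‖ ^ 2) ∂μ
      ≤ ENNReal.ofReal (‖v - grad E Φ x‖ ^ 2 + δ * dist x y) := by
  obtain ⟨T, hT⟩ := exists_transport_eq hX hx hy
  obtain ⟨A, S₀, -, hA, hA'⟩ := hsb
  have hd : 0 ≤ dist x y := dist_nonneg
  -- Covers the two cases without sampling noise, where the error is just the transported old one.
  have key : ∀ u : TangentSpace 𝓘(ℝ, E) y, u = T (v - grad E Φ x) →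
      ENNReal.ofReal (‖u‖ ^ 2) ≤ ENNReal.ofReal (‖v - grad E Φ x‖ ^ 2 + δ * dist x y) := by
    rintro u rfl
    rw [T.norm_map]
    refine ENNReal.ofReal_le_ofReal ?_
    have := mul_nonneg hδ hd
    linarith
  have hconst : ∀ F : Ω → ℝ≥0∞, (∀ w, F w ≤ ENNReal.ofReal (‖v - grad E Φ x‖ ^ 2 + δ * dist x y))
      → ∫⁻ w, F w ∂μ ≤ ENNReal.ofReal (‖v - grad E Φ x‖ ^ 2 + δ * dist x y) := fun F hF =>
    (lintegral_mono hF).trans (by simp)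
  simp_rw [spiderUpdate, hT]
  by_cases hr : c * dist x y ∈ A
  · refine hconst _ fun w => key _ ?_
    rw [(hA _ hr).1, (hA _ hr).2 x hx, (hA _ hr).2 y hy, map_sub, map_sub]
    abel
  simp_rw [hA' _ hr, batchGrad_firstSamples_eq]
  -- If `c d = 0` the batch is empty. Then `L d = 0` because `L² = cδ`, so `grad Φ` at `y` is
  -- exactly the transported one and plain transport loses nothing.
  rcases (mul_nonneg hc hd).eq_or_lt with h0 | h0
  · refine hconst _ fun w => key _ ?_
    have h1 : L * dist x y = 0 := by
      have : (L * dist x y) ^ 2 = 0 := by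
        rw [mul_pow, hcδ]
        linear_combination -(δ * dist x y) * h0
      exact pow_eq_zero_iff two_ne_zero |>.1 this
    have h2 := hLΦ.2 x hx y hy
    rw [h1, norm_le_zero_iff, sub_eq_zero, hT] at h2
    rw [← h0, h2]
    simp
  have hN : ⌈c * dist x y⌉₊ ≠ 0 := (Nat.ceil_pos.2 h0).ne'
  have hgm : ∀ z ∈ X, StronglyMeasurable fun ξ => grad E (φ ξ) z := fun z hz =>
    stronglyMeasurable_of_mk (hφ.comp measurable_const (fun _ => hz) measurable_id)
  have hgi : ∀ z ∈ X, Integrable (fun ξ => grad E (φ ξ) z) P := fun z hz =>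
    Integrable.of_bound (hgm z hz).aestronglyMeasurable C (hC.mono fun ξ h => h z hz)
  have hTi : Integrable (fun ξ => T (grad E (φ ξ) x)) P :=
    T.toContinuousLinearMap.integrable_comp (hgi x hx)
  have hmean : ∫ ξ, (grad E (φ ξ) y - T (grad E (φ ξ) x)) ∂P = grad E Φ y - T (grad E Φ x) := by
    rw [integral_sub (hgi y hy) hTi, hΦ y hy, ← hΦ x hx]
    congr 1
    exact T.toContinuousLinearMap.integral_comp_comm (hgi x hx)
  have hbd : ∀ᵐ ξ ∂P, ‖grad E (φ ξ) y - T (grad E (φ ξ) x)‖ ≤ L * dist x y := by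
    filter_upwards [hL] with ξ h
    rw [← hT]
    exact h.2 x hx y hy
  have hvar := lintegral_norm_sq_average_le hs hP hind
    (y := fun ξ => grad E (φ ξ) y - T (grad E (φ ξ) x))
    ((hgm y hy).sub (T.continuous.comp_stronglyMeasurable (hgm x hx))) hbd
    (T (v - grad E Φ x)) hN
  rw [hmean, T.norm_map] at hvar
  refine le_trans (le_of_eq ?_) (hvar.trans (ENNReal.ofReal_le_ofReal ?_))
  · refine lintegral_congr fun w => ?_
    congr 3
    rw [Finset.sum_sub_distrib, smul_sub, map_sub, map_smul, map_sum, map_sub]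
    abel
  · have h1 : (L * dist x y) ^ 2 / (⌈c * dist x y⌉₊ : ℝ) ≤ δ * dist x y := by
      have hc' := Nat.le_ceil (c * dist x y)
      rw [div_le_iff₀ (h0.trans_le hc'), mul_pow, hcδ]
      nlinarith [mul_nonneg hδ hd]
    linarith

end Variance

/-! ### Step size, accuracy and epoch length. -/

section Parameters

theorem stepSize_nonneg (K : ℕ) : 0 ≤ stepSize K := by
  unfold stepSize
  positivity

theorem stepSize_le_one {K : ℕ} (hK : 1 ≤ K) : stepSize K ≤ 1 := by
  have : (1 : ℝ) ≤ √K := Real.one_le_sqrt.2 (by exact_mod_cast hK)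
  exact div_le_one_of_le₀ this (by positivity)

theorem epochLength_pos {K : ℕ} (hK : 1 ≤ K) : 0 < epochLength K :=
  Nat.ceil_pos.2 (Real.sqrt_pos.2 (by exact_mod_cast hK))

theorem accuracy_sq (K : ℕ) : accuracy K ^ 2 = 1 / (K : ℝ) := by
  rw [accuracy, div_pow, Real.sq_sqrt (Nat.cast_nonneg K), one_pow]

theorem succ_mod_eq_of_ne_zero {k n : ℕ} (h : (k + 1) % n ≠ 0) : (k + 1) % n = k % n + 1 := by
  rcases Nat.eq_zero_or_pos n with rfl | hn
  · simp
  have h1 := Nat.mod_lt k hn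
  rw [Nat.add_mod_eq_ite] at h ⊢
  rcases eq_or_ne n 1 with rfl | hn1
  · simp [Nat.mod_one] at h
  rw [Nat.mod_eq_of_lt (show 1 < n by omega)] at h ⊢
  split_ifs at h ⊢ with h2
  · omega
  · rfl

end Parameters

/-! ### The gradient error along a run. -/

section Run

variable {E : Type*} [NormedAddCommGroup E] [NormedSpace ℝ E] [FiniteDimensional ℝ E]
  {M : Type*} [MetricSpace M] [SecondCountableTopology M] [MeasurableSpace M] [BorelSpace M]
  [ChartedSpace E M] [IsManifold 𝓘(ℝ, E) ∞ M]
  [RiemannianBundle (fun x : M => TangentSpace 𝓘(ℝ, E) x)]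
  [IsContMDiffRiemannianBundle 𝓘(ℝ, E) ∞ E (fun x : M => TangentSpace 𝓘(ℝ, E) x)]
  {X : Set M} {Ξ : Type*} [MeasurableSpace Ξ] {φ : Ξ → M → ℝ}
  {P : Measure Ξ} [IsProbabilityMeasure P] {Φ : M → ℝ} {L C : ℝ} {K N₁ : ℕ}
  {smallBatch : ℝ → (ℕ → Ξ) → List Ξ} {x₀ : M}
  {Ω : Type*} [MeasurableSpace Ω] {μ : Measure Ω} [IsProbabilityMeasure μ]

namespace SpiderRun

theorem x_mem (R : SpiderRun E X φ P L K N₁ smallBatch x₀ μ) (hconv : GeodesicallyConvex E X)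
    (hK : 1 ≤ K) (hx₀ : x₀ ∈ X) {k : ℕ} (hk : k ≤ K) (w : Ω) : R.x k w ∈ X := by
  induction k with
  | zero => rwa [R.x_zero]
  | succ k ih =>
    rw [R.x_succ k (by omega)]
    exact (geod_spec hconv (ih (by omega)) (R.z_mem k (by omega) w)).2 _
      ⟨stepSize_nonneg K, stepSize_le_one hK⟩

theorem measurable_samples (R : SpiderRun E X φ P L K N₁ smallBatch x₀ μ) {k : ℕ} (hk : k < K) :
    Measurable[R.history (k + 1)] fun w i => R.sample k i w :=
  @measurable_pi_lambda _ _ _ (R.history (k + 1)) _ _ fun i => R.measurable_sample k hk i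

/-- The whole sample sequence is kept, since the number of samples used may depend on the past. -/
theorem indepFun_samples (R : SpiderRun E X φ P L K N₁ smallBatch x₀ μ) {k : ℕ} (hk : k < K)
    {α : Type*} [MeasurableSpace α] {U : Ω → α} (hU : Measurable[R.history k] U) :
    IndepFun U (fun w i => R.sample k i w) μ := by
  rw [IndepFun_iff_Indep]
  have hS : Measurable[⨆ i, MeasurableSpace.comap (R.sample k i) inferInstance]
      fun w i => R.sample k i w :=
    @measurable_pi_lambda _ _ _ (⨆ i, MeasurableSpace.comap (R.sample k i) inferInstance) _ _
      fun i => (comap_measurable (R.sample k i)).mono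
        (le_iSup (fun i => MeasurableSpace.comap (R.sample k i) inferInstance) i) le_rfl
  exact indep_of_indep_of_le_left (indep_of_indep_of_le_right (R.indep_sample k hk) hS.comap_le)
    hU.comap_le

/-- Writing the norm of `expInv` as a distance makes the batch size a measurable function of the
iterates, with no measurability of `expInv` needed. -/
theorem g_succ (R : SpiderRun E X φ P L K N₁ smallBatch x₀ μ) (hconv : GeodesicallyConvex E X)
    (hK : 1 ≤ K) (hx₀ : x₀ ∈ X) {k : ℕ} (hk : k + 1 < K) (h : (k + 1) % epochLength K ≠ 0)
    (w : Ω) :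
    R.g (k + 1) w = spiderUpdate φ
      (smallBatch (2 * epochLength K * L ^ 2 * K * dist (R.x k w) (R.x (k + 1) w))
        fun i => R.sample (k + 1) i w) (R.x k w) (R.x (k + 1) w) (R.g k w) := by
  rw [R.g_inner k hk h w, spiderUpdate, norm_expInv hconv (R.x_mem hconv hK hx₀ (by omega) w)
    (R.x_mem hconv hK hx₀ (by omega) w), accuracy_sq]
  have : ∀ d : ℝ, 2 * (epochLength K : ℝ) * L ^ 2 * d / (1 / (K : ℝ))
      = 2 * epochLength K * L ^ 2 * K * d := fun d => by
    rw [div_div_eq_mul_div, div_one]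
    ring
  rw [this]

/-- A run does not postulate this; it is inherited inductively from iterates and samples. The index
is `k + 1` because `g k` uses the batch of iteration `k`. -/
theorem measurable_g (R : SpiderRun E X φ P L K N₁ smallBatch x₀ μ)
    (hconv : GeodesicallyConvex E X) (hΓ : MeasurableTransport E X) (hφ : MeasurableGrad E X φ)
    (hsb : IsSmallBatchRule E X φ Φ smallBatch)
    (hK : 1 ≤ K) (hx₀ : x₀ ∈ X) {k : ℕ} (hk : k < K) :
    Measurable[R.history (k + 1)]
      fun w => (⟨R.x k w, R.g k w⟩ : TangentBundle 𝓘(ℝ, E) M) := by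
  have hx : ∀ {j i}, j ≤ K → j ≤ i → Measurable[R.history i] (R.x j) := fun hj hi =>
    (R.measurable_x _ hj).mono (R.history.mono hi) le_rfl
  have epoch : ∀ {k}, k < K → k % epochLength K = 0 → Measurable[R.history (k + 1)]
      fun w => (⟨R.x k w, R.g k w⟩ : TangentBundle 𝓘(ℝ, E) M) := by
    intro k hk h0
    simp_rw [R.g_epoch k hk h0]
    exact @MeasurableGrad.batchGrad_firstSamples _ _ _ _ _ _ _ _ _ _ _ _ _ _ (R.history (k + 1))
      _ _ _ hφ _ (hx hk.le (Nat.le_succ k)) (R.x_mem hconv hK hx₀ hk.le) _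
      (R.measurable_samples hk) _ (@measurable_const _ _ _ (R.history (k + 1)) _)
  induction k with
  | zero => exact epoch hk (Nat.zero_mod _)
  | succ k ih =>
    by_cases h0 : (k + 1) % epochLength K = 0
    · exact epoch hk h0
    simp_rw [R.g_succ hconv hK hx₀ hk h0]
    exact @measurable_spiderUpdate _ _ _ _ _ _ _ _ _ _ _ _ _ _ (R.history (k + 2))
      _ _ _ hΓ hφ _ _ hsb _ _ _ ((ih (by omega)).mono (R.history.mono (by omega)) le_rfl)
      (hx hk.le (by omega)) (R.x_mem hconv hK hx₀ (by omega)) (R.x_mem hconv hK hx₀ hk.le) _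
      (R.measurable_samples hk) _

/-- The error is at most `B / K` at the start of an epoch, and every later step adds at most `δ`
times the diameter; `k % epochLength K` counts these steps. -/
theorem lintegral_error_le (R : SpiderRun E X φ P L K N₁ smallBatch x₀ μ)
    (hXc : IsCompact X) (hconv : GeodesicallyConvex E X) (hΓ : MeasurableTransport E X)
    (hφ : MeasurableGrad E X φ) (hΦ : ∀ x ∈ X, ∫ ξ, grad E (φ ξ) x ∂P = grad E Φ x)
    (hC : ∀ᵐ ξ ∂P, ∀ x ∈ X, ‖grad E (φ ξ) x‖ ≤ C) (hL : ∀ᵐ ξ ∂P, LSmoothOn E L X (φ ξ))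
    (hLΦ : LSmoothOn E L X Φ) (hsb : IsSmallBatchRule E X φ Φ smallBatch)
    {B : ℝ} (hB : 0 ≤ B) (hN₁ : N₁ = 0 → C = 0) (hBN : C ^ 2 / N₁ ≤ B / K)
    (hK : 1 ≤ K) (hx₀ : x₀ ∈ X) {k : ℕ} (hk : k < K) :
    ∫⁻ w, ENNReal.ofReal (‖R.g k w - grad E Φ (R.x k w)‖ ^ 2) ∂μ
      ≤ ENNReal.ofReal (B / K
        + (k % epochLength K : ℕ) * (1 / (2 * epochLength K * K) * Metric.diam X)) := by
  have hKr : (0 : ℝ) < K := by exact_mod_cast hK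
  have hnr : (0 : ℝ) < epochLength K := by exact_mod_cast epochLength_pos hK
  have hsm : ∀ {k}, k < K → ∀ i, Measurable (R.sample k i) := fun hk i =>
    (R.measurable_sample _ hk i).mono (R.history.le _) le_rfl
  have hS : ∀ {k}, k < K → Measurable fun w i => R.sample k i w := fun hk =>
    (R.measurable_samples hk).mono (R.history.le _) le_rfl
  have epoch : ∀ {k}, k < K → k % epochLength K = 0 →
      ∫⁻ w, ENNReal.ofReal (‖R.g k w - grad E Φ (R.x k w)‖ ^ 2) ∂μ ≤ ENNReal.ofReal (B / K) := by
    intro k hk h0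
    have hxX := R.x_mem hconv hK hx₀ hk.le
    let U : Ω → X := fun w => ⟨R.x k w, hxX w⟩
    have hU : Measurable[R.history k] U := (R.measurable_x k hk.le).subtype_mk
    let G : X × (ℕ → Ξ) → ℝ≥0∞ := fun q => ENNReal.ofReal
      (‖batchGrad E φ (firstSamples N₁ q.2) (q.1 : M) - grad E Φ (q.1 : M)‖ ^ 2)
    have hxm : Measurable fun q : X × (ℕ → Ξ) => (q.1 : M) := measurable_fst.subtype_val
    have hG : Measurable G := ((measurable_norm_mk (measurable_mk_sub
      (hφ.batchGrad_firstSamples hxm (fun q => q.1.2) measurable_snd measurable_const)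
      (hφ.of_integral hxm (fun q => q.1.2) hΦ))).pow_const 2).ennreal_ofReal
    simp_rw [R.g_epoch k hk h0]
    have h1 := lintegral_comp_indepFun (hU.mono (R.history.le k) le_rfl) (hS hk)
      (R.indepFun_samples hk hU) hG
    refine h1.le.trans ((lintegral_mono fun w => ?_).trans
      (by simp : ∫⁻ _ : Ω, ENNReal.ofReal (B / K) ∂μ ≤ _))
    exact (lintegral_norm_sq_batchGrad_sub_le (hsm hk) (R.law_sample k hk)
      (R.iIndep_sample k hk) hφ hΦ hC hN₁ (hxX w)).trans (ENNReal.ofReal_le_ofReal hBN)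
  induction k with
  | zero => simpa using epoch hk (Nat.zero_mod _)
  | succ k ih =>
    by_cases h0 : (k + 1) % epochLength K = 0
    · simpa [h0] using epoch hk h0
    have hxX := R.x_mem hconv hK hx₀ (show k ≤ K by omega)
    have hyX := R.x_mem hconv hK hx₀ hk.le
    have hgm := R.measurable_g hconv hΓ hφ hsb hK hx₀ (show k < K by omega)
    -- `c` is the batch size per unit of distance. `δ` is chosen with `cδ = L²` without dividing by
    -- `L`, so that `L = 0` is allowed.
    set c : ℝ := 2 * epochLength K * L ^ 2 * K with hc
    set δ : ℝ := 1 / (2 * epochLength K * K) with hδ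
    -- The state `(x_k, g_k, x_{k+1})` is known before the samples of iteration `k + 1` are drawn,
    -- hence independent of them.
    let U : Ω → {v : TangentBundle 𝓘(ℝ, E) M // v.proj ∈ X} × X := fun w =>
      (⟨⟨R.x k w, R.g k w⟩, hxX w⟩, ⟨R.x (k + 1) w, hyX w⟩)
    have hU : Measurable[R.history (k + 1)] U :=
      (hgm.subtype_mk).prodMk (R.measurable_x (k + 1) hk.le).subtype_mk
    let G : ({v : TangentBundle 𝓘(ℝ, E) M // v.proj ∈ X} × X) × (ℕ → Ξ) → ℝ≥0∞ := fun q =>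
      ENNReal.ofReal (‖spiderUpdate φ (smallBatch (c * dist q.1.1.1.proj (q.1.2 : M)) q.2)
        q.1.1.1.proj (q.1.2 : M) q.1.1.1.snd - grad E Φ (q.1.2 : M)‖ ^ 2)
    have hvm : Measurable fun q : ({v : TangentBundle 𝓘(ℝ, E) M // v.proj ∈ X} × X) × (ℕ → Ξ) =>
        (⟨q.1.1.1.proj, q.1.1.1.snd⟩ : TangentBundle 𝓘(ℝ, E) M) :=
      measurable_fst.fst.subtype_val
    have hym : Measurable fun q : ({v : TangentBundle 𝓘(ℝ, E) M // v.proj ∈ X} × X) × (ℕ → Ξ) =>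
        (q.1.2 : M) := measurable_fst.snd.subtype_val
    have hG : Measurable G := ((measurable_norm_mk (measurable_mk_sub
      (measurable_spiderUpdate hΓ hφ hsb hvm hym (fun q => q.1.1.2) (fun q => q.1.2.2)
        measurable_snd c)
      (hφ.of_integral hym (fun q => q.1.2.2) hΦ))).pow_const 2).ennreal_ofReal
    have h1 := lintegral_comp_indepFun (hU.mono (R.history.le _) le_rfl) (hS hk)
      (R.indepFun_samples hk hU) hG
    have hδ0 : 0 ≤ δ * Metric.diam X := mul_nonneg (by positivity) Metric.diam_nonneg
    simp_rw [R.g_succ hconv hK hx₀ hk h0]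
    calc _ = ∫⁻ w, ∫⁻ w', G (U w, fun i => R.sample (k + 1) i w') ∂μ ∂μ := h1
      _ ≤ ∫⁻ w, (ENNReal.ofReal (‖R.g k w - grad E Φ (R.x k w)‖ ^ 2)
            + ENNReal.ofReal (δ * Metric.diam X)) ∂μ := by
          refine lintegral_mono fun w => ?_
          refine (lintegral_norm_sq_spiderUpdate_le hconv (hsm hk) (R.law_sample _ hk)
            (R.iIndep_sample _ hk) hφ hΦ hC hL hLΦ hsb (c := c) (δ := δ) (by positivity)
            (by positivity) (by rw [hc, hδ]; field_simp) (hxX w) (hyX w) (R.g k w)).trans ?_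
          rw [← ENNReal.ofReal_add (by positivity) hδ0]
          refine ENNReal.ofReal_le_ofReal (add_le_add le_rfl ?_)
          exact mul_le_mul_of_nonneg_left
            (Metric.dist_le_diam_of_mem hXc.isBounded (hxX w) (hyX w)) (by positivity)
      _ = ∫⁻ w, ENNReal.ofReal (‖R.g k w - grad E Φ (R.x k w)‖ ^ 2) ∂μ
            + ENNReal.ofReal (δ * Metric.diam X) := by
          rw [lintegral_add_right _ measurable_const]
          simp
      _ ≤ _ := by
          refine (add_le_add (ih (by omega)) le_rfl).trans ?_
          rw [← ENNReal.ofReal_add (by positivity) hδ0, succ_mod_eq_of_ne_zero h0]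
          refine ENNReal.ofReal_le_ofReal (le_of_eq ?_)
          push_cast
          ring

end SpiderRun

end Run

/-! ### One inexact Frank–Wolfe step. -/

section Gap

variable {E : Type*} [NormedAddCommGroup E] [NormedSpace ℝ E] [FiniteDimensional ℝ E]
  {M : Type*} [MetricSpace M] [ChartedSpace E M] [IsManifold 𝓘(ℝ, E) ∞ M]
  [RiemannianBundle (fun x : M => TangentSpace 𝓘(ℝ, E) x)]
  [IsContMDiffRiemannianBundle 𝓘(ℝ, E) ∞ E (fun x : M => TangentSpace 𝓘(ℝ, E) x)]
  [IsRiemannianManifold 𝓘(ℝ, E) M] {X : Set M} {Φ : M → ℝ} {L D : ℝ}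

/-- One Frank-Wolfe step with step size `1 / q` and the inexact gradient `g`. -/
theorem inner_neg_grad_le_of_isMinOn (hconv : GeodesicallyConvex E X)
    (hD : ∀ x ∈ X, ∀ y ∈ X, dist x y ≤ D) (hL : 0 ≤ L) (hΦ : LSmoothOn E L X Φ) {q : ℝ}
    (hq : 1 ≤ q) {x y z : M} (hx : x ∈ X) (hy : y ∈ X) (hz : z ∈ X)
    {g : TangentSpace 𝓘(ℝ, E) x} (hmin : IsMinOn (fun u => inner ℝ g (expInv E x u)) X z) :
    inner ℝ (expInv E x y) (-grad E Φ x) ≤ q * (Φ x - Φ (geod E x z (1 / q)))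
      + D * (q * ‖g - grad E Φ x‖ ^ 2 + 1 / q) + L * D ^ 2 / (2 * q) := by
  have hq0 : 0 < q := by linarith
  have hD0 : 0 ≤ D := dist_nonneg.trans (hD x hx x hx)
  have hne : ∀ u ∈ X, ‖expInv E x u‖ ≤ D := fun u hu => by
    rw [norm_expInv hconv hx hu]
    exact hD x hx u hu
  set e := g - grad E Φ x with he
  have h1 : inner ℝ g (expInv E x z) ≤ inner ℝ g (expInv E x y) := hmin hy
  have hg : g = grad E Φ x + e := by rw [he]; abel
  rw [hg, inner_add_left, inner_add_left] at h1
  have h2 := (abs_le.1 ((abs_real_inner_le_norm e (expInv E x z)).trans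
    (mul_le_mul_of_nonneg_left (hne z hz) (norm_nonneg e)))).1
  have h3 := (abs_le.1 ((abs_real_inner_le_norm e (expInv E x y)).trans
    (mul_le_mul_of_nonneg_left (hne y hy) (norm_nonneg e)))).2
  have h4 := hΦ.le_along_geod hconv hL hx hz (t := 1 / q)
    ⟨by positivity, div_le_one_of_le₀ hq hq0.le⟩
  have h5 : L * (1 / q) ^ 2 / 2 * dist x z ^ 2 ≤ L * (1 / q) ^ 2 / 2 * D ^ 2 := by
    have := hD x hx z hz
    gcongr
  have h6 : -inner ℝ (grad E Φ x) (expInv E x z)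
      ≤ q * (Φ x - Φ (geod E x z (1 / q))) + L * D ^ 2 / (2 * q) := by
    have := mul_le_mul_of_nonneg_left (h4.trans (add_le_add le_rfl h5)) hq0.le
    have e1 : q * (Φ x + 1 / q * inner ℝ (grad E Φ x) (expInv E x z)
        + L * (1 / q) ^ 2 / 2 * D ^ 2)
        = q * Φ x + inner ℝ (grad E Φ x) (expInv E x z) + L * D ^ 2 / (2 * q) := by
      field_simp
    rw [e1] at this
    linarith
  -- The error enters twice, at `z` and at `y`. Completing the square brings in `‖e‖²`, whose mean
  -- is controlled, so no root of an expectation is needed.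
  have h7 : 2 * ‖e‖ ≤ q * ‖e‖ ^ 2 + 1 / q := by
    have : 0 ≤ (q * ‖e‖ - 1) ^ 2 / q := by positivity
    have e2 : (q * ‖e‖ - 1) ^ 2 / q = q * ‖e‖ ^ 2 + 1 / q - 2 * ‖e‖ := by
      field_simp
      ring
    linarith
  have h8 := mul_le_mul_of_nonneg_left h7 hD0
  rw [inner_neg_right, real_inner_comm]
  linarith

/-- Settles finite sums on a set of diameter zero. There the large batches are empty while the
gradients need not vanish, so the variance estimate is not available. -/
theorem fwGap_eq_zero_of_diam (hconv : GeodesicallyConvex E X)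
    (hD : ∀ x ∈ X, ∀ y ∈ X, dist x y ≤ 0) {x : M} (hx : x ∈ X) : fwGap E X Φ x = 0 := by
  refine le_antisymm (iSup₂_le fun y hy => ?_) zero_le
  have h : ‖expInv E x y‖ ≤ 0 := (norm_expInv hconv hx hy).le.trans (hD x hx y hy)
  rw [norm_le_zero_iff.1 h, inner_zero_left, ENNReal.ofReal_zero]

theorem LSmoothOn.continuousOn (hΦ : LSmoothOn E L X Φ) : ContinuousOn Φ X := fun x hx =>
  (hΦ.1 x hx).continuousAt.continuousWithinAt

end Gap

/-! ### The expected gap at the random output. -/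

section Run

variable {E : Type*} [NormedAddCommGroup E] [NormedSpace ℝ E] [FiniteDimensional ℝ E]
  {M : Type*} [MetricSpace M] [SecondCountableTopology M] [MeasurableSpace M] [BorelSpace M]
  [ChartedSpace E M] [IsManifold 𝓘(ℝ, E) ∞ M]
  [RiemannianBundle (fun x : M => TangentSpace 𝓘(ℝ, E) x)]
  [IsContMDiffRiemannianBundle 𝓘(ℝ, E) ∞ E (fun x : M => TangentSpace 𝓘(ℝ, E) x)]
  {X : Set M} {Ξ : Type*} [MeasurableSpace Ξ] {φ : Ξ → M → ℝ}
  {P : Measure Ξ} [IsProbabilityMeasure P] {Φ : M → ℝ} {L C : ℝ} {K N₁ : ℕ}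
  {smallBatch : ℝ → (ℕ → Ξ) → List Ξ} {x₀ : M}
  {Ω : Type*} [MeasurableSpace Ω] {μ : Measure Ω} [IsProbabilityMeasure μ]

namespace SpiderRun

theorem ae_outIdx_lt (R : SpiderRun E X φ P L K N₁ smallBatch x₀ μ) (hK : 1 ≤ K) :
    ∀ᵐ w ∂μ, R.outIdx w < K := by
  have hm : ∀ j, MeasurableSet (R.outIdx ⁻¹' {j}) := fun j =>
    R.measurable_outIdx (measurableSet_singleton j)
  have h : μ (⋃ j ∈ Finset.range K, R.outIdx ⁻¹' {j}) = 1 := by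
    rw [measure_biUnion_finset (fun i _ j _ hij => ?_) fun j _ => hm j,
      Finset.sum_congr rfl fun j hj => R.law_outIdx j (Finset.mem_range.1 hj)]
    · rw [Finset.sum_const, Finset.card_range, nsmul_eq_mul]
      exact ENNReal.mul_inv_cancel (by simpa using (by omega : K ≠ 0)) (ENNReal.natCast_ne_top K)
    · exact Disjoint.preimage _ (by simpa using hij)
  have h2 := (prob_compl_eq_zero_iff (Finset.measurableSet_biUnion _ fun j _ => hm j)).2 h
  filter_upwards [measure_eq_zero_iff_ae_notMem.1 h2] with w hw
  simpa using hw

/-- The gap is a supremum over `X` and is not known to be measurable, so independence of the output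
index is applied to measurable majorants instead. -/
theorem lintegral_output_le (R : SpiderRun E X φ P L K N₁ smallBatch x₀ μ) (hK : 1 ≤ K)
    {G : M → ℝ≥0∞} {F : ℕ → Ω → ℝ≥0∞} (hF : ∀ j < K, Measurable[R.history K] (F j))
    (hGF : ∀ j < K, ∀ w, G (R.x j w) ≤ F j w) :
    ∫⁻ w, G (R.output w) ∂μ ≤ (K : ℝ≥0∞)⁻¹ * ∫⁻ w, ∑ j ∈ Finset.range K, F j w ∂μ := by
  have hm : ∀ j, MeasurableSet (R.outIdx ⁻¹' {j}) := fun j =>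
    R.measurable_outIdx (measurableSet_singleton j)
  have hFm : ∀ j ∈ Finset.range K, Measurable (F j) := fun j hj =>
    (hF j (Finset.mem_range.1 hj)).mono (R.history.le K) le_rfl
  calc ∫⁻ w, G (R.output w) ∂μ
      ≤ ∫⁻ w, ∑ j ∈ Finset.range K,
          F j w * (R.outIdx ⁻¹' {j}).indicator (fun _ => 1) w ∂μ := by
        refine lintegral_mono_ae ?_
        filter_upwards [R.ae_outIdx_lt hK] with w hw
        refine (hGF _ hw w).trans (le_trans (le_of_eq ?_)
          (Finset.single_le_sum (f := fun j => F j w * (R.outIdx ⁻¹' {j}).indicator (fun _ => 1) w)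
            (fun _ _ => zero_le) (Finset.mem_range.2 hw)))
        simp
    _ = ∑ j ∈ Finset.range K,
          ∫⁻ w, F j w * (R.outIdx ⁻¹' {j}).indicator (fun _ => 1) w ∂μ :=
        lintegral_finsetSum _ fun j hj =>
          (hFm j hj).mul (measurable_const.indicator (hm j))
    _ = ∑ j ∈ Finset.range K, (∫⁻ w, F j w ∂μ) * (K : ℝ≥0∞)⁻¹ := by
        refine Finset.sum_congr rfl fun j hj => ?_
        have hj' := Finset.mem_range.1 hj
        rw [lintegral_mul_indicator_eq_lintegral_mul_lintegral_indicator (R.history.le K) 1 (hm j)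
          ?_ (hF j hj'), lintegral_indicator_const (hm j), R.law_outIdx j hj', one_mul]
        refine indepSets_of_indepSets_of_le_right ((Indep_iff_IndepSets _ _ μ).1 R.indep_outIdx.symm)
          ?_
        rw [singleton_subset_iff]
        exact ⟨{j}, MeasurableSpace.measurableSet_top, rfl⟩
    _ = _ := by
        rw [← Finset.sum_mul, mul_comm, lintegral_finsetSum _ hFm]

variable [IsRiemannianManifold 𝓘(ℝ, E) M]

/-- With `D` the diameter, the constant collects the range `2b` of `Φ` after telescoping, `D` from
the `1/q` of the completed square, `D(B + D/2)` from the gradient error and `LD²/2` from the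
curvature term. -/
theorem lintegral_fwGap_output_le (R : SpiderRun E X φ P L K N₁ smallBatch x₀ μ)
    (hXc : IsCompact X) (hconv : GeodesicallyConvex E X) (hΓ : MeasurableTransport E X)
    (hφ : MeasurableGrad E X φ) (hΦ : ∀ x ∈ X, ∫ ξ, grad E (φ ξ) x ∂P = grad E Φ x)
    (hC : ∀ᵐ ξ ∂P, ∀ x ∈ X, ‖grad E (φ ξ) x‖ ≤ C) (hL0 : 0 ≤ L)
    (hL : ∀ᵐ ξ ∂P, LSmoothOn E L X (φ ξ))
    (hLΦ : LSmoothOn E L X Φ) (hsb : IsSmallBatchRule E X φ Φ smallBatch)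
    {B b : ℝ} (hB : 0 ≤ B) (hb : ∀ x ∈ X, |Φ x| ≤ b) (hN₁ : N₁ = 0 → C = 0)
    (hBN : C ^ 2 / N₁ ≤ B / K) (hK : 1 ≤ K) (hx₀ : x₀ ∈ X) :
    ∫⁻ w, fwGap E X Φ (R.output w) ∂μ ≤ ENNReal.ofReal
      ((2 * b + Metric.diam X * (1 + (B + Metric.diam X / 2)) + L * Metric.diam X ^ 2 / 2)
        / √(K : ℝ)) := by
  set D := Metric.diam X with hD
  have hD0 : 0 ≤ D := Metric.diam_nonneg
  have hDX : ∀ x ∈ X, ∀ y ∈ X, dist x y ≤ D := fun x hx y hy =>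
    Metric.dist_le_diam_of_mem hXc.isBounded hx hy
  have hb0 : 0 ≤ b := (abs_nonneg _).trans (hb x₀ hx₀)
  have hKr : (0 : ℝ) < K := by exact_mod_cast hK
  set q := √(K : ℝ) with hq
  have hq1 : 1 ≤ q := Real.one_le_sqrt.2 (by exact_mod_cast hK)
  have hqK : q ^ 2 = K := Real.sq_sqrt hKr.le
  have hq0 : 0 < q := by linarith
  have hX : ∀ {k}, k ≤ K → ∀ w, R.x k w ∈ X := fun hk => R.x_mem hconv hK hx₀ hk
  set e : ℕ → Ω → ℝ := fun k w => ‖R.g k w - grad E Φ (R.x k w)‖ ^ 2 with he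
  set r : ℝ := D * (1 / q) + L * D ^ 2 / (2 * q) with hr
  have hr0 : 0 ≤ r := by positivity
  set F : ℕ → Ω → ℝ := fun k w => q * (Φ (R.x k w) - Φ (R.x (k + 1) w)) + D * q * e k w + r with hF
  have hpath : ∀ k < K, ∀ w, ∀ y ∈ X,
      inner ℝ (expInv E (R.x k w) y) (-grad E Φ (R.x k w)) ≤ F k w := fun k hk w y hy => by
    have h := inner_neg_grad_le_of_isMinOn hconv hDX hL0 hLΦ hq1 (hX hk.le w) hy (R.z_mem k hk w)
      (R.z_min k hk w)
    have h2 := R.x_succ k hk w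
    rw [stepSize, ← hq] at h2
    rw [← h2] at h
    refine h.trans (le_of_eq ?_)
    simp only [hF, he, hr]
    ring
  -- Testing with `y = x_k`, where the gap expression is zero. Nonnegativity lets `ENNReal.ofReal`
  -- pass through the sum, which is needed before telescoping.
  have hF0 : ∀ k < K, ∀ w, 0 ≤ F k w := fun k hk w => by
    have h := hpath k hk w _ (hX hk.le w)
    have h2 : ‖expInv E (R.x k w) (R.x k w)‖ = 0 := by
      rw [norm_expInv hconv (hX hk.le w) (hX hk.le w), dist_self]
    rwa [norm_eq_zero.1 h2, inner_zero_left] at h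
  have hΦm : Measurable fun x : X => Φ x := hLΦ.continuousOn.domRestrict.measurable
  have hxm : ∀ {k}, k ≤ K → Measurable[R.history K] (R.x k) := fun hk =>
    (R.measurable_x _ hk).mono (R.history.mono hk) le_rfl
  have hΦx : ∀ {k}, k ≤ K → Measurable[R.history K] fun w => Φ (R.x k w) := fun hk =>
    hΦm.comp ((hxm hk).subtype_mk (h := hX hk))
  have hgm : ∀ k < K, Measurable[R.history K] (e k) := fun k hk =>
    (@measurable_norm_mk _ _ _ _ _ _ _ _ _ _ _ _ (R.history K) _ _ _ _
      (@measurable_mk_sub _ _ _ _ _ _ _ _ _ _ _ _ (R.history K) _ _ _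
        ((R.measurable_g hconv hΓ hφ hsb hK hx₀ hk).mono (R.history.mono hk) le_rfl)
        (@MeasurableGrad.of_integral _ _ _ _ _ _ _ _ _ _ _ _ _ _ (R.history K) _ _ _ hφ _
          (hxm hk.le) (hX hk.le) P _ _ hΦ))).pow_const 2
  have hFm : ∀ k < K, Measurable[R.history K] (F k) := fun k hk =>
    ((((hΦx hk.le).sub (hΦx hk)).const_mul q).add ((hgm k hk).const_mul (D * q))).add_const r
  have hmain := R.lintegral_output_le hK (G := fwGap E X Φ) (F := fun k w => ENNReal.ofReal (F k w))
    (fun k hk => (hFm k hk).ennreal_ofReal)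
    (fun k hk w => iSup₂_le fun y hy => ENNReal.ofReal_le_ofReal (hpath k hk w y hy))
  have herr : ∀ k ∈ Finset.range K,
      ∫⁻ w, ENNReal.ofReal (e k w) ∂μ ≤ ENNReal.ofReal ((B + D / 2) / K) := fun k hk => by
    refine (R.lintegral_error_le hXc hconv hΓ hφ hΦ hC hL hLΦ hsb hB hN₁ hBN hK hx₀
      (Finset.mem_range.1 hk)).trans (ENNReal.ofReal_le_ofReal ?_)
    have hn : (0 : ℝ) < epochLength K := by exact_mod_cast epochLength_pos hK
    have h1 : ((k % epochLength K : ℕ) : ℝ) ≤ epochLength K := by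
      exact_mod_cast (Nat.mod_lt k (epochLength_pos hK)).le
    have h2 := mul_le_mul_of_nonneg_right h1
      (show 0 ≤ 1 / (2 * epochLength K * K) * D by positivity)
    -- An epoch has at most `n` steps, each adding `D / (2nK)`, so the length cancels.
    have h3 : (epochLength K : ℝ) * (1 / (2 * epochLength K * K) * D) = D / 2 / K := by
      field_simp
    rw [add_div]
    linarith
  have hsum : ∀ w, ∑ k ∈ Finset.range K, ENNReal.ofReal (F k w)
      ≤ ENNReal.ofReal (2 * q * b + K * r)
        + ENNReal.ofReal (D * q) * ∑ k ∈ Finset.range K, ENNReal.ofReal (e k w) := fun w => by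
    rw [← ENNReal.ofReal_sum_of_nonneg fun k hk => hF0 k (Finset.mem_range.1 hk) w,
      ← ENNReal.ofReal_sum_of_nonneg fun k _ => by positivity, ← ENNReal.ofReal_mul (by positivity),
      ← ENNReal.ofReal_add (by positivity)
        (mul_nonneg (by positivity) (Finset.sum_nonneg fun k _ => by positivity))]
    refine ENNReal.ofReal_le_ofReal ?_
    have h1 : ∑ k ∈ Finset.range K, F k w = q * (Φ (R.x 0 w) - Φ (R.x K w))
        + D * q * ∑ k ∈ Finset.range K, e k w + K * r := by
      simp only [hF, Finset.sum_add_distrib, ← Finset.mul_sum, Finset.sum_const, Finset.card_range,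
        nsmul_eq_mul, Finset.sum_range_sub']
    have h2 := (abs_le.1 (hb _ (hX (Nat.zero_le K) w))).2
    have h3 := (abs_le.1 (hb _ (hX le_rfl w))).1
    have h4 := mul_le_mul_of_nonneg_left
      (show Φ (R.x 0 w) - Φ (R.x K w) ≤ 2 * b by linarith) hq0.le
    rw [h1]
    linarith
  have hem : ∀ k ∈ Finset.range K, Measurable fun w => ENNReal.ofReal (e k w) := fun k hk =>
    ((hgm k (Finset.mem_range.1 hk)).mono (R.history.le K) le_rfl).ennreal_ofReal
  calc _ ≤ (K : ℝ≥0∞)⁻¹ * ∫⁻ w, (ENNReal.ofReal (2 * q * b + K * r)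
        + ENNReal.ofReal (D * q) * ∑ k ∈ Finset.range K, ENNReal.ofReal (e k w)) ∂μ :=
        hmain.trans (mul_le_mul_right (lintegral_mono hsum) _)
    _ = (K : ℝ≥0∞)⁻¹ * (ENNReal.ofReal (2 * q * b + K * r)
        + ENNReal.ofReal (D * q) * ∑ k ∈ Finset.range K, ∫⁻ w, ENNReal.ofReal (e k w) ∂μ) := by
        rw [lintegral_add_left measurable_const, lintegral_const_mul _
          (Finset.measurable_sum _ hem), lintegral_finsetSum _ hem]
        simp
    _ ≤ (K : ℝ≥0∞)⁻¹ * (ENNReal.ofReal (2 * q * b + K * r)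
        + ENNReal.ofReal (D * q) * (K * ENNReal.ofReal ((B + D / 2) / K))) := by
        have := Finset.sum_le_sum herr
        rw [Finset.sum_const, Finset.card_range, nsmul_eq_mul] at this
        gcongr
    _ = ENNReal.ofReal ((K : ℝ)⁻¹ * (2 * q * b + K * r + D * q * (K * ((B + D / 2) / K)))) := by
        rw [ENNReal.ofReal_mul (p := (K : ℝ)⁻¹) (by positivity),
          ENNReal.ofReal_add (p := 2 * q * b + K * r) (by positivity) (by positivity),
          ENNReal.ofReal_mul (p := D * q) (q := K * ((B + D / 2) / K)) (by positivity),
          ENNReal.ofReal_mul (p := (K : ℝ)) (q := (B + D / 2) / K) (by positivity), ENNReal.ofReal_natCast, ENNReal.ofReal_inv_of_pos hKr,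
          ENNReal.ofReal_natCast]
    _ = _ := by
        congr 1
        rw [hr, ← hqK]
        field_simp
        ring

end SpiderRun

end Run

/-! ### Finite sums as expectations over a uniform index. -/

theorem integral_uniformOn_univ {ι T : Type*} [Fintype ι] [Nonempty ι] [MeasurableSpace ι]
    [MeasurableSingletonClass ι] [NormedAddCommGroup T] [NormedSpace ℝ T] [CompleteSpace T]
    (f : ι → T) :
    ∫ i, f i ∂(uniformOn (univ : Set ι)) = (Fintype.card ι : ℝ)⁻¹ • ∑ i, f i := by
  rw [uniformOn, ProbabilityTheory.cond, Measure.restrict_univ, integral_smul_measure, integral_count,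
    Measure.count_univ]
  simp

section FiniteSum

variable {E : Type*} [NormedAddCommGroup E] [NormedSpace ℝ E] [FiniteDimensional ℝ E]
  {M : Type*} [MetricSpace M] [ChartedSpace E M]
  [RiemannianBundle (fun x : M => TangentSpace 𝓘(ℝ, E) x)]
  {ι : Type} [Fintype ι] {f : ι → M → ℝ} {c : ℝ}

variable (E) in
/-- The differential of a real function on a manifold, as a linear form. -/
def realDifferential (g : M → ℝ) (x : M) : TangentSpace 𝓘(ℝ, E) x →L[ℝ] ℝ :=
  (NormedSpace.fromTangentSpace (g x)).toContinuousLinearMap ∘L mfderiv 𝓘(ℝ, E) 𝓘(ℝ, ℝ) g x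

theorem hasMFDerivAt_realDifferential {g : M → ℝ} {x : M}
    (hg : MDifferentiableAt 𝓘(ℝ, E) 𝓘(ℝ, ℝ) g x) :
    HasMFDerivAt 𝓘(ℝ, E) 𝓘(ℝ, ℝ) g x (realDifferential E g x) :=
  hg.hasMFDerivAt

theorem HasMFDerivAt.realDifferential_eq {g : M → ℝ} {x : M} {A : TangentSpace 𝓘(ℝ, E) x →L[ℝ] ℝ}
    (hg : HasMFDerivAt 𝓘(ℝ, E) 𝓘(ℝ, ℝ) g x A) : realDifferential E g x = A := by
  rw [realDifferential, hg.mfderiv]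
  rfl

theorem hasMFDerivAt_const_mul_sum {x : M}
    (hf : ∀ i, MDifferentiableAt 𝓘(ℝ, E) 𝓘(ℝ, ℝ) (f i) x) :
    HasMFDerivAt 𝓘(ℝ, E) 𝓘(ℝ, ℝ) (fun y => c * ∑ i, f i y) x
      ((c • ∑ i, realDifferential E (f i) x : TangentSpace 𝓘(ℝ, E) x →L[ℝ] ℝ)) := by
  have h := (HasMFDerivAt.sum (t := Finset.univ) (f := f)
    (f' := fun i => realDifferential E (f i) x)
    fun i _ => hasMFDerivAt_realDifferential (hf i)).const_smul c
  have e : (c • ∑ i, f i) = fun y => c * ∑ i, f i y := by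
    ext y
    simp
  rw [e] at h
  exact h

variable [IsManifold 𝓘(ℝ, E) ∞ M]
  [IsContMDiffRiemannianBundle 𝓘(ℝ, E) ∞ E (fun x : M => TangentSpace 𝓘(ℝ, E) x)]
  {X : Set M} {L : ℝ}

theorem grad_const_mul_sum {x : M} (hf : ∀ i, MDifferentiableAt 𝓘(ℝ, E) 𝓘(ℝ, ℝ) (f i) x) :
    grad E (fun y => c * ∑ i, f i y) x = c • ∑ i, grad E (f i) x := by
  have hg : ∀ (g : M → ℝ) (v : TangentSpace 𝓘(ℝ, E) x),
      inner ℝ (grad E g x) v = realDifferential E g x v := fun g v => inner_grad g x v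
  refine ext_inner_right ℝ fun v => ?_
  rw [hg, HasMFDerivAt.realDifferential_eq (hasMFDerivAt_const_mul_sum hf), real_inner_smul_left,
    sum_inner]
  simp_rw [hg]
  rw [_root_.smul_apply, _root_.sum_apply, smul_eq_mul]

theorem LSmoothOn.const_mul_sum (hX : GeodesicallyConvex E X) (hf : ∀ i, LSmoothOn E L X (f i))
    (hc : 0 ≤ c) (hc1 : c * Fintype.card ι = 1) :
    LSmoothOn E L X (fun y => c * ∑ i, f i y) := by
  refine ⟨fun x hx => (hasMFDerivAt_const_mul_sum fun i => (hf i).1 x hx).mdifferentiableAt,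
    fun x hx y hy => ?_⟩
  obtain ⟨T, hT⟩ := exists_transport_eq hX hx hy
  rw [grad_const_mul_sum fun i => (hf i).1 x hx, grad_const_mul_sum fun i => (hf i).1 y hy, hT,
    map_smul, map_sum, ← smul_sub, ← Finset.sum_sub_distrib, norm_smul, Real.norm_of_nonneg hc]
  have h : ‖∑ i, (grad E (f i) y - T (grad E (f i) x))‖ ≤ ∑ _i : ι, L * dist x y :=
    norm_sum_le_of_le _ fun i _ => by
      rw [← hT]
      exact (hf i).2 x hx y hy
  refine (mul_le_mul_of_nonneg_left h hc).trans (le_of_eq ?_)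
  rw [Finset.sum_const, Finset.card_univ, nsmul_eq_mul, ← mul_assoc, hc1, one_mul]

theorem LSmoothOn.norm_grad_le {g : M → ℝ} (hX : GeodesicallyConvex E X) (hg : LSmoothOn E L X g)
    {x y : M} (hx : x ∈ X) (hy : y ∈ X) : ‖grad E g y‖ ≤ ‖grad E g x‖ + L * dist x y := by
  obtain ⟨T, hT⟩ := exists_transport_eq hX hx hy
  have h := hg.2 x hx y hy
  rw [hT] at h
  have h2 := norm_le_norm_add_norm_sub' (grad E g y) (T (grad E g x))
  rw [T.norm_map] at h2
  linarith

/-- No gradient bound is assumed for finite sums. Smoothness and isometry of transport bound each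
gradient by its norm at one base point plus `L` times the diameter. -/
theorem exists_norm_grad_le (hXc : IsCompact X) (hX : GeodesicallyConvex E X) (hL : 0 ≤ L)
    (hf : ∀ i, LSmoothOn E L X (f i)) : ∃ C, ∀ i, ∀ x ∈ X, ‖grad E (f i) x‖ ≤ C := by
  rcases X.eq_empty_or_nonempty with rfl | ⟨x₁, hx₁⟩
  · exact ⟨0, fun i x hx => hx.elim⟩
  refine ⟨∑ i, ‖grad E (f i) x₁‖ + L * Metric.diam X, fun i x hx => ?_⟩
  refine ((hf i).norm_grad_le hX hx₁ hx).trans (add_le_add ?_ ?_)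
  · exact Finset.single_le_sum (f := fun i => ‖grad E (f i) x₁‖) (fun _ _ => norm_nonneg _)
      (Finset.mem_univ i)
  · exact mul_le_mul_of_nonneg_left (Metric.dist_le_diam_of_mem hXc.isBounded hx₁ hx) hL

end FiniteSum

/-! ### The two batch rules and the size of large batches. -/

section Batches

variable {E : Type*} [NormedAddCommGroup E] [NormedSpace ℝ E] [FiniteDimensional ℝ E]
  {M : Type*} [MetricSpace M] [ChartedSpace E M]
  [RiemannianBundle (fun x : M => TangentSpace 𝓘(ℝ, E) x)] {X : Set M}

theorem isSmallBatchRule_stochastic {Ξ : Type*} (φ : Ξ → M → ℝ) (Φ : M → ℝ) :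
    IsSmallBatchRule E X φ Φ smallBatchStochastic :=
  ⟨∅, [], MeasurableSet.empty, fun _ h => h.elim, fun _ _ _ => rfl⟩

/-- The exceptional sizes are those whose capped ceiling equals `m`: the full index set then gives
the exact gradient. For all other sizes `r < m`, and the cap is inactive. -/
theorem isSmallBatchRule_finiteSum {m : ℕ} {φ : Fin m → M → ℝ} {Φ : M → ℝ}
    (h : ∀ x ∈ X, grad E Φ x = (m : ℝ)⁻¹ • ∑ i, grad E (φ i) x) :
    IsSmallBatchRule E X φ Φ smallBatchFiniteSum := by
  refine ⟨{r | ⌈min (m : ℝ) r⌉₊ = m}, List.finRange m, ?_, fun r hr => ⟨fun s => if_pos hr, ?_⟩,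
    fun r hr s => ?_⟩
  · exact (Nat.measurable_ceil.comp (measurable_const.min measurable_id))
      (measurableSet_singleton m)
  · intro x hx
    rw [h x hx, batchGrad, List.length_finRange, ← List.ofFn_eq_map, List.sum_ofFn]
  · rw [mem_ofPred_eq] at hr
    rw [smallBatchFiniteSum, if_neg hr]
    rcases le_total (m : ℝ) r with hmr | hmr
    · exact absurd (by rw [min_eq_left hmr, Nat.ceil_natCast]) hr
    · rw [min_eq_right hmr]

/-- As `1/ε² = K`, the batch has at least `aK` samples and `C²/(aK) = B/K`. If `a = 0` the batch is
empty, but then `C = 0`. -/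
theorem sq_div_ceil_le {a B C : ℝ} {K : ℕ} (hK : 1 ≤ K) (ha : 0 ≤ a) (hB : 0 ≤ B)
    (hC : C ^ 2 = a * B) :
    (⌈a / accuracy K ^ 2⌉₊ = 0 → C = 0) ∧ C ^ 2 / ⌈a / accuracy K ^ 2⌉₊ ≤ B / K := by
  have hKr : (0 : ℝ) < K := by exact_mod_cast hK
  have h1 : a / accuracy K ^ 2 = a * K := by rw [accuracy_sq, div_div_eq_mul_div, div_one]
  rw [h1]
  rcases ha.eq_or_lt with rfl | ha
  · rw [zero_mul] at hC
    have hC0 := (pow_eq_zero_iff two_ne_zero).1 hC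
    refine ⟨fun _ => hC0, ?_⟩
    rw [hC, zero_div]
    positivity
  · have h2 : 0 < a * K := by positivity
    have h3 := Nat.le_ceil (a * K)
    refine ⟨fun h => absurd h (Nat.ceil_pos.2 h2).ne', ?_⟩
    rw [hC, div_le_div_iff₀ (h2.trans_le h3) hKr]
    nlinarith

end Batches

end RiemannianFW

end

/-! ### The constants in the two settings. -/

open RiemannianFW in
theorem mainTheorem3
    {E : Type*} [NormedAddCommGroup E] [NormedSpace ℝ E] [FiniteDimensional ℝ E]
    {M : Type*} [MetricSpace M] [SecondCountableTopology M] [MeasurableSpace M] [BorelSpace M]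
    [ChartedSpace E M] [IsManifold 𝓘(ℝ, E) ∞ M]
    [RiemannianBundle (fun x : M => TangentSpace 𝓘(ℝ, E) x)]
    [IsContMDiffRiemannianBundle 𝓘(ℝ, E) ∞ E (fun x : M => TangentSpace 𝓘(ℝ, E) x)]
    [IsRiemannianManifold 𝓘(ℝ, E) M]
    (X : Set M) (hX : IsCompact X) (hconv : GeodesicallyConvex E X)
    (hΓ : MeasurableTransport E X) :
    -- stochastic objectives `Φ(x) = 𝔼_ξ φ(x, ξ)`
    (∀ {Ξ : Type*} [MeasurableSpace Ξ] (P : Measure Ξ) [IsProbabilityMeasure P]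
      (φ : Ξ → M → ℝ) (L C : ℝ),
      0 ≤ L → 0 ≤ C →
      (∀ x, Integrable (fun ξ => φ ξ x) P) →
      LSmoothOn E L X (fun x => ∫ ξ, φ ξ x ∂P) →
      (∀ᵐ ξ ∂P, LSmoothOn E L X (φ ξ)) →
      (∀ᵐ ξ ∂P, ∀ x ∈ X, ‖grad E (φ ξ) x‖ ≤ C) →
      MeasurableGrad E X φ →
      (∀ x ∈ X, ∫ ξ, grad E (φ ξ) x ∂P = grad E (fun x => ∫ ξ, φ ξ x ∂P) x) →
      ∃ A : ℝ, ∀ (K : ℕ), 1 ≤ K → ∀ x₀ ∈ X,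
        ∀ {Ω : Type*} [MeasurableSpace Ω] (μ : Measure Ω) [IsProbabilityMeasure μ]
          (R : SpiderRun E X φ P L K ⌈2 * C ^ 2 / accuracy K ^ 2⌉₊ smallBatchStochastic x₀ μ),
          ∫⁻ w, fwGap E X (fun x => ∫ ξ, φ ξ x ∂P) (R.output w) ∂μ
            ≤ ENNReal.ofReal (A / √(K : ℝ)))
    ∧
    -- finite-sum objectives `Φ(x) = (1/m) ∑ᵢ φᵢ(x)`
    (∀ (m : ℕ) [NeZero m] (φ : Fin m → M → ℝ) (L : ℝ),
      0 < L →
      (∀ i, LSmoothOn E L X (φ i)) →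
      MeasurableGrad E X φ →
      ∃ A : ℝ, ∀ (K : ℕ), 1 ≤ K → ∀ x₀ ∈ X,
        ∀ {Ω : Type*} [MeasurableSpace Ω] (μ : Measure Ω) [IsProbabilityMeasure μ]
          (R : SpiderRun E X φ (uniformOn Set.univ) L K
            ⌈2 * L ^ 2 * Metric.diam X ^ 2 / accuracy K ^ 2⌉₊ smallBatchFiniteSum x₀ μ),
          ∫⁻ w, fwGap E X (fun x => (1 / (m : ℝ)) * ∑ i, φ i x) (R.output w) ∂μ
            ≤ ENNReal.ofReal (A / √(K : ℝ))) := by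

  refine ⟨?_, ?_⟩
  · intro Ξ _ P _ φ L C hL _ _ hLΦ hLφ hC hφ hΦ
    obtain ⟨b, hb⟩ := hX.exists_bound_of_continuousOn hLΦ.continuousOn
    -- A batch of `2C²K` samples makes the initial error of an epoch at most `1/(2K)`, that is `B =
    -- 1/2`.
    refine ⟨2 * b + Metric.diam X * (1 + (1 / 2 + Metric.diam X / 2)) + L * Metric.diam X ^ 2 / 2,
      fun K hK x₀ hx₀ Ω _ μ _ R => ?_⟩
    have hN := sq_div_ceil_le (a := 2 * C ^ 2) (B := 1 / 2) (C := C) hK (by positivity)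
      (by norm_num) (by ring)
    exact R.lintegral_fwGap_output_le hX hconv hΓ hφ hΦ hC hL hLφ hLΦ
      (isSmallBatchRule_stochastic _ _) (by norm_num) hb hN.1 hN.2 hK hx₀
  · intro m _ φ L hL hLφ hφ
    have hm : (m : ℝ) ≠ 0 := Nat.cast_ne_zero.2 (NeZero.ne m)
    have : IsProbabilityMeasure (uniformOn (Set.univ : Set (Fin m))) :=
      isProbabilityMeasure_uniformOn Set.finite_univ Set.univ_nonempty
    have hgrad : ∀ x ∈ X, grad E (fun x => (1 / (m : ℝ)) * ∑ i, φ i x) x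
        = (m : ℝ)⁻¹ • ∑ i, grad E (φ i) x := fun x hx => by
      rw [grad_const_mul_sum fun i => (hLφ i).1 x hx, one_div]
    have hLΦ : LSmoothOn E L X (fun x => (1 / (m : ℝ)) * ∑ i, φ i x) :=
      LSmoothOn.const_mul_sum hconv hLφ (by positivity)
        (by rw [Fintype.card_fin, one_div, inv_mul_cancel₀ hm])
    have hΦ : ∀ x ∈ X, ∫ i, grad E (φ i) x ∂(uniformOn (Set.univ : Set (Fin m)))
        = grad E (fun x => (1 / (m : ℝ)) * ∑ i, φ i x) x := fun x hx => by
      rw [integral_uniformOn_univ, hgrad x hx, Fintype.card_fin]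
    obtain ⟨b, hb⟩ := hX.exists_bound_of_continuousOn hLΦ.continuousOn
    obtain ⟨C, hC⟩ := exists_norm_grad_le hX hconv hL.le hLφ
    rcases (Metric.diam_nonneg (s := X)).eq_or_lt with hD | hD
    · refine ⟨0, fun K hK x₀ hx₀ Ω _ μ _ R => (le_of_eq ?_).trans zero_le⟩
      refine (lintegral_congr_ae ?_).trans lintegral_zero
      filter_upwards [R.ae_outIdx_lt hK] with w hw
      exact fwGap_eq_zero_of_diam hconv
        (fun x hx y hy => (Metric.dist_le_diam_of_mem hX.isBounded hx hy).trans hD.ge)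
        (R.x_mem hconv hK hx₀ hw.le w)
    -- The batch size `2L²D²K` is not tied to the gradient bound `C`, so their ratio enters the
    -- constant. It is legitimate because `L` and the diameter are positive here.
    · set B : ℝ := C ^ 2 / (2 * L ^ 2 * Metric.diam X ^ 2) with hB
      have hB0 : 0 ≤ B := by positivity
      refine ⟨2 * b + Metric.diam X * (1 + (B + Metric.diam X / 2)) + L * Metric.diam X ^ 2 / 2,
        fun K hK x₀ hx₀ Ω _ μ _ R => ?_⟩
      have hN := sq_div_ceil_le (a := 2 * L ^ 2 * Metric.diam X ^ 2) (B := B) (C := C) hK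
        (by positivity) hB0 (by rw [hB]; field_simp)
      exact R.lintegral_fwGap_output_le hX hconv hΓ hφ hΦ
        (Filter.Eventually.of_forall fun i x hx => hC i x hx) hL.le
        (Filter.Eventually.of_forall hLφ) hLΦ (isSmallBatchRule_finiteSum hgrad) hB0 hb hN.1 hN.2
        hK hx₀
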